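/- For $m\ge 3$ let $G_m$ be the \emph{cycle of stars of cliques} with parts of size $m$: its vertices are $c_i$, $l_{i,j}$, $q_{i,j,k}$ with $1\le i,j,k\le m$; the $c_i$ form a cycle of length $m$ in this order, $c_i$ is adjacent to every $l_{i,j}$, and for all $i,j$ the set $\{l_{i,j},q_{i,j,1},\dots,q_{i,j,m}\}$ is a clique; there are no other edges. A set $A$ of agents performs independent simple random walks on a connected graph $G=(V,E)$ in synchronous rounds, each started from the stationary distribution ($v$ has probability $\deg(v)/(2|E|)$); $s\in V$ is a source vertex. * \emph{Visit-exchange.} In round $0$, $s$ and all agents on $s$ become informed. In each round $t\ge1$ every agent makes one step; every vertex visited by an agent that was informed in a previous round becomes informed, and then every agent on a vertex that was informed in a previous or in the current round becomes informed. $T_{\mathrm{visitx}}$ is the number of rounds until all vertices are informed. * \emph{Meet-exchange.} In round $0$ all agents on $s$ become informed; if there are none, the agents visiting $s$ in the first later round in which $s$ is visited become informed. After that $s$ informs no further agent. In each round $t\ge1$ every agent makes one step, and an agent that shares a vertex with an agent informed in a previous round becomes informed. $T_{\mathrm{meetx}}$ is the number of rounds until all agents are informed. **Lemma.** For an integer $n\ge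 27$ let $m=\lfloor n^{1/3}\rfloor$. Then $G_m$ is connected, has $\Theta(n)$ vertices (more precisely $n/2\le|V|\le 2n$), and is almost regular: all its degrees lie between $m$ and $m+2$. Moreover, for all constants $0<a\le b$ there are constants $C,c>0$ and $N$, depending only on $a$ and $b$, such that for every $n\ge N$, every number $|A|$ of agents with $an\le|A|\le bn$, and every source vertex $s$ of $G_m$, (a) $\mathbb E[T_{\mathrm{visitx}}]\le C\,n^{2/3}$, and (b) $\mathbb E[T_{\mathrm{meetx}}]\ge c\,n^{2/3}\log n$. -/

import Mathlib

open MeasureTheory ProbabilityTheory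
open scoped ENNReal

namespace RumorSpreading

section Protocols

variable {V ι : Type*}

/-- The sets of informed vertices and informed agents after round `t` of visit-exchange with
source `s`, when agent `g` is at vertex `x g t` in round `t`. -/
def visitState (s : V) (x : ι → ℕ → V) : ℕ → Set V × Set ι
  | 0 => ({s}, {g | x g 0 = s})
  | t + 1 =>
    let I := (visitState s x t).1 ∪ {v | ∃ g ∈ (visitState s x t).2, x g (t + 1) = v}
    (I, (visitState s x t).2 ∪ {g | x g (t + 1) ∈ I})

/-- Broadcast time of visit-exchange: the first round after which all vertices are informed
(`∞` if there is none). -/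
noncomputable def visitTime (s : V) (x : ι → ℕ → V) : ℝ≥0∞ :=
  ⨅ (t : ℕ) (_ : (visitState s x t).1 = Set.univ), (t : ℝ≥0∞)

/-- The set of informed agents after round `t` of meet-exchange with source `s`. The source
informs the agents of the first round in which it is visited (it has been visited as soon as some
agent is informed), and from then on only agents inform the agents they meet. -/
def meetState (s : V) (x : ι → ℕ → V) : ℕ → Set ι
  | 0 => {g | x g 0 = s}
  | t + 1 => meetState s x t ∪ {g | ∃ g' ∈ meetState s x t, x g (t + 1) = x g' (t + 1)} ∪
      {g | meetState s x t = ∅ ∧ x g (t + 1) = s}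

/-- Broadcast time of meet-exchange: the first round after which all agents are informed
(`∞` if there is none). -/
noncomputable def meetTime (s : V) (x : ι → ℕ → V) : ℝ≥0∞ :=
  ⨅ (t : ℕ) (_ : meetState s x t = Set.univ), (t : ℝ≥0∞)

end Protocols

section Walks

variable {V : Type*} [Fintype V] (G : SimpleGraph V) [DecidableRel G.Adj]

/-- The probability `deg v / (2|E|)` of `v` in the stationary distribution. -/
noncomputable def stationaryProb (v : V) : ℝ :=
  G.degree v / (2 * G.edgeFinset.card)

/-- The transition probability of simple random walk. -/
noncomputable def stepProb (u v : V) : ℝ :=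
  if G.Adj u v then 1 / G.degree u else 0

/-- `X g t` is the position of agent `g` in round `t`; the agents perform independent simple
random walks on `G`, each started from the stationary distribution. -/
structure IsStationaryWalkSystem {ι Ω : Type*} [MeasurableSpace Ω] (P : Measure Ω)
    (X : ι → ℕ → Ω → V) : Prop where
  measurable_fiber : ∀ g t v, MeasurableSet {ω | X g t ω = v}
  law : ∀ g t (w : ℕ → V), P {ω | ∀ i ≤ t, X g i ω = w i} =
    ENNReal.ofReal (stationaryProb G (w 0) * ∏ i ∈ Finset.range t, stepProb G (w i) (w (i + 1)))
  indep : iIndepFun (m := fun _ => @MeasurableSpace.pi ℕ (fun _ => V) fun _ => ⊤)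
    (fun g ω t => X g t ω) P

end Walks

section WalksExist

theorem sum_stationaryProb {V : Type*} [Fintype V] (G : SimpleGraph V) [DecidableRel G.Adj]
    (hE : G.edgeFinset.Nonempty) : ∑ v, stationaryProb G v = 1 := by
  have h := G.sum_degrees_eq_twice_card_edges
  have h0 : (0 : ℝ) < G.edgeFinset.card := by exact_mod_cast hE.card_pos
  simp only [stationaryProb]
  rw [← Finset.sum_div, ← Nat.cast_sum, h]
  push_cast
  field_simp

theorem sum_stepProb {V : Type*} [Fintype V] (G : SimpleGraph V) [DecidableRel G.Adj]
    (u : V) (hu : 0 < G.degree u) : ∑ v, stepProb G u v = 1 := by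
  have h0 : (0 : ℝ) < G.degree u := by exact_mod_cast hu
  simp only [stepProb]
  rw [← Finset.sum_filter, Finset.sum_const, ← G.neighborFinset_eq_filter,
    G.card_neighborFinset_eq_degree]
  simp
  field_simp

theorem stationaryProb_nonneg {V : Type*} [Fintype V] (G : SimpleGraph V) [DecidableRel G.Adj]
    (v : V) : 0 ≤ stationaryProb G v := by
  unfold stationaryProb; positivity

theorem stepProb_nonneg {V : Type*} [Fintype V] (G : SimpleGraph V) [DecidableRel G.Adj]
    (u v : V) : 0 ≤ stepProb G u v := by
  unfold stepProb; split_ifs <;> positivity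

/-- Systems of independent stationary walks exist on every finite graph without isolated
vertices that has an edge. -/
theorem exists_isStationaryWalkSystem {V : Type} [Fintype V] (G : SimpleGraph V)
    [DecidableRel G.Adj] (hE : G.edgeFinset.Nonempty) (hG : ∀ v, 0 < G.degree v) (A : ℕ) :
    ∃ (Ω : Type) (_ : MeasurableSpace Ω) (P : Measure Ω) (_ : IsProbabilityMeasure P)
      (X : Fin A → ℕ → Ω → V), IsStationaryWalkSystem G P X := by
  classical
  let _ : MeasurableSpace V := ⊤
  have : DiscreteMeasurableSpace V := ⟨fun _ => trivial⟩
  let p : Option (ℕ × V) → PMF V := fun o => match o with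
    | none => PMF.ofFintype (fun v => ENNReal.ofReal (stationaryProb G v)) (by
        rw [← ENNReal.ofReal_sum_of_nonneg fun v _ => stationaryProb_nonneg G v,
          sum_stationaryProb G hE, ENNReal.ofReal_one])
    | some (_, u) => PMF.ofFintype (fun v => ENNReal.ofReal (stepProb G u v)) (by
        rw [← ENNReal.ofReal_sum_of_nonneg fun v _ => stepProb_nonneg G u v,
          sum_stepProb G u (hG u), ENNReal.ofReal_one])
  let Q : Measure (Option (ℕ × V) → V) := Measure.infinitePi fun o => (p o).toMeasure
  let Y : (Option (ℕ × V) → V) → ℕ → V := fun ω t =>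
    Nat.rec (ω none) (fun i v => ω (some (i, v))) t
  have hYm : ∀ t, Measurable fun ω => Y ω t := by
    intro t
    induction t with
    | zero => exact measurable_pi_apply _
    | succ t ih =>
      refine measurable_to_countable' fun v => ?_
      have : (fun ω => Y ω (t + 1)) ⁻¹' {v} =
          ⋃ u, ((fun ω => Y ω t) ⁻¹' {u} ∩ {ω | ω (some (t, u)) = v}) := by
        ext ω
        simp [Y]
      rw [this]
      refine MeasurableSet.iUnion fun u => (ih (measurableSet_singleton u)).inter ?_
      have hc : Measurable fun ω : Option (ℕ × V) → V => ω (some (t, u)) :=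
        measurable_pi_apply _
      exact hc (measurableSet_singleton v)
  have hY : Measurable Y := measurable_pi_lambda _ hYm
  have hYlaw : ∀ (t : ℕ) (w : ℕ → V), Q {ω | ∀ i ≤ t, Y ω i = w i} = ENNReal.ofReal
      (stationaryProb G (w 0) * ∏ i ∈ Finset.range t, stepProb G (w i) (w (i + 1))) := by
    intro t w
    let S : Finset (Option (ℕ × V)) :=
      insert none ((Finset.range t).image fun i => some (i, w i))
    let T : Option (ℕ × V) → Set V := fun o => match o with
      | none => {w 0}
      | some (i, _) => {w (i + 1)}
    have hset : {ω | ∀ i ≤ t, Y ω i = w i} = Set.pi S T := by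
      ext ω
      simp only [Set.mem_ofPred_eq, Set.mem_pi, S, Finset.coe_insert, Set.mem_insert_iff,
        Finset.coe_image, Set.mem_image, Finset.mem_coe, Finset.mem_range, forall_eq_or_imp,
        forall_exists_index, and_imp, forall_apply_eq_imp_iff₂]
      constructor
      · intro h
        refine ⟨h 0 (Nat.zero_le _), fun i hi => ?_⟩
        have h1 := h (i + 1) hi
        have h2 := h i hi.le
        simp only [Y] at h1 h2
        rw [h2] at h1
        exact h1
      · rintro ⟨h0, h⟩ i hi
        induction i with
        | zero => exact h0
        | succ i ih =>
          have h1 := ih (by omega)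
          have h2 : ω (some (i, w i)) = w (i + 1) := h i (by omega)
          simp only [Y] at h1 ⊢
          rw [h1]
          exact h2
    rw [hset, Measure.infinitePi_pi _ fun _ _ => MeasurableSet.of_discrete,
      Finset.prod_insert (by simp), Finset.prod_image (by
        intro i _ j _ h
        simpa using congrArg (Option.map Prod.fst) h),
      ENNReal.ofReal_mul (stationaryProb_nonneg G _),
      ENNReal.ofReal_prod_of_nonneg fun _ _ => stepProb_nonneg G _ _]
    simp [p, T]
  refine ⟨Fin A → Option (ℕ × V) → V, inferInstance, Measure.pi fun _ => Q, inferInstance,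
    fun g t ω => Y (ω g) t, ?_, ?_, ?_⟩
  · intro g t v
    exact ((hYm t).comp (measurable_pi_apply g)) (measurableSet_singleton v)
  · intro g t w
    have hm : MeasurableSet {ω | ∀ i ≤ t, Y ω i = w i} := by
      have : {ω | ∀ i ≤ t, Y ω i = w i} =
          ⋂ i ∈ Finset.range (t + 1), (fun ω => Y ω i) ⁻¹' {w i} := by
        ext ω; simp
      rw [this]
      exact Finset.measurableSet_biInter _ fun i _ => hYm i (measurableSet_singleton _)
    rw [← hYlaw t w, ← (measurePreserving_eval (fun _ : Fin A => Q) g).measure_preimage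
      hm.nullMeasurableSet]
    rfl
  · exact iIndepFun_pi (μ := fun _ : Fin A => Q) (X := fun _ => Y) fun _ => hY.aemeasurable

end WalksExist

section Graph

/-- Vertices of the cycle of stars of cliques with parts of size `m`: the cycle vertices `c i`,
the star leaves `l i j`, and the remaining clique vertices `q i j k`. -/
abbrev CycleStarCliqueVertex (m : ℕ) : Type :=
  Fin m ⊕ (Fin m × Fin m) ⊕ (Fin m × Fin m × Fin m)

/-- The edges of the cycle of stars of cliques, each listed in at least one direction. -/
def cycleStarCliqueRel (m : ℕ) : CycleStarCliqueVertex m → CycleStarCliqueVertex m → Prop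
  | .inl i, .inl i' => (SimpleGraph.cycleGraph m).Adj i i'
  | .inl i, .inr (.inl (i', _)) => i = i'
  | .inr (.inl (i, j)), .inr (.inr (i', j', _)) => i = i' ∧ j = j'
  | .inr (.inr (i, j, k)), .inr (.inr (i', j', k')) => i = i' ∧ j = j' ∧ k ≠ k'
  | _, _ => False

/-- The cycle of stars of cliques with parts of size `m`. -/
def cycleStarClique (m : ℕ) : SimpleGraph (CycleStarCliqueVertex m) :=
  SimpleGraph.fromRel (cycleStarCliqueRel m)

noncomputable instance (m : ℕ) : DecidableRel (cycleStarClique m).Adj :=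
  Classical.decRel _

end Graph

end RumorSpreading

/-! Everything is decided on the cycle. By reversibility a stationary agent crosses a given oriented
edge in a given round with probability exactly `1 / (2|E|)`, of order `m ^ (-4)`; with order `m ^ 3`
agents each edge is crossed about once in `m` rounds. In visit-exchange an informed cycle vertex
stays informed, so every crossing at the frontier advances the rumor and going around takes `O(m ^
2)` rounds. In meet-exchange a cycle vertex remembers nothing: an informed agent on it moves along
the cycle with probability of order `1 / m` only, and otherwise enters a clique, which sends
carriers back at rate of order `1 / m`. Carriers multiply by a constant factor per `m` rounds, so
order `m` of them, enough for one advance, need about `m log m` rounds; this gives `m ^ 2 log m` in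
total.

Lower bound: every informed agent is reached by a chain of carriers, where a clique counts as
infectious forever once reached (`reached_of_mem_meetState`). Loop erasure makes the carriers
distinct (`Chain.append`), hence independent, so a supersolution of the expected one-carrier
equation bounds the probability of reaching a target (`mul_measure_chain_le`). The supersolution is
`θ ^ dist * (1 - lam / m) ^ t` up to constants, with `θ = √m`: at distance `m / 4` the gain `exp(m
log m / 8)` beats the discount over `c m ^ 2 log m` rounds (`reach_far_small`). A fixed agent is in
a far clique with probability at least `1 / 6`.

Upper bound: a second-moment estimate and independence make it unlikely that a prescribed sequence
of edges is never crossed (`measure_no_crossing_le`). Travel around the cycle is cut into blocks of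
length `m`; a union bound over the set of blocks with an advance makes the watched edges
deterministic (`measure_cycle_not_informed_le`). The remaining vertices need four windows of `m ^ 2
/ 4` rounds. All failures are exponentially unlikely, and a crude polynomial hitting-time bound for
one agent controls the expectation on them (`tsum_le_of_antitone`). -/

namespace RumorSpreading

/-! ### Events determined by an initial piece of a trajectory -/

section PrefixEvents

variable {V Ω : Type*}

/-- Events that depend only on the first `t + 1` positions of a trajectory. -/
def IsPrefixEvent (Y : ℕ → Ω → V) (t : ℕ) (E : Set Ω) : Prop :=
  ∀ ω ω', (∀ i ≤ t, Y i ω = Y i ω') → ω ∈ E → ω' ∈ E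

theorem IsPrefixEvent.inter {Y : ℕ → Ω → V} {t : ℕ} {E F : Set Ω} (hE : IsPrefixEvent Y t E)
    (hF : IsPrefixEvent Y t F) : IsPrefixEvent Y t (E ∩ F) :=
  fun ω ω' h hω => ⟨hE ω ω' h hω.1, hF ω ω' h hω.2⟩

theorem IsPrefixEvent.mono {Y : ℕ → Ω → V} {t t' : ℕ} {E : Set Ω} (hE : IsPrefixEvent Y t E)
    (h : t ≤ t') : IsPrefixEvent Y t' E :=
  fun ω ω' h' hω => hE ω ω' (fun i hi => h' i (hi.trans h)) hω

theorem isPrefixEvent_eq (Y : ℕ → Ω → V) {t t' : ℕ} (h : t ≤ t') (v : V) :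
    IsPrefixEvent Y t' {ω | Y t ω = v} :=
  fun _ _ h' hω => (h' t h).symm.trans hω

theorem isPrefixEvent_univ (Y : ℕ → Ω → V) (t : ℕ) : IsPrefixEvent Y t Set.univ :=
  fun _ _ _ _ => trivial

/-- Every prefix event is a finite disjoint union of cylinders. -/
theorem IsPrefixEvent.exists_cylinders [Finite V] {Y : ℕ → Ω → V} {t : ℕ} {E : Set Ω}
    (hE : IsPrefixEvent Y t E) :
    ∃ W : Finset (Fin (t + 1) → V),
      E = ⋃ w ∈ W, {ω | ∀ i ≤ t, Y i ω = w (Fin.ofNat (t + 1) i)} := by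
  classical
  have := Fintype.ofFinite V
  refine ⟨Finset.univ.filter fun w => ∃ ω ∈ E, ∀ i ≤ t, Y i ω = w (Fin.ofNat (t + 1) i), ?_⟩
  ext ω
  simp only [Finset.mem_filter, Finset.mem_univ, true_and, Set.mem_iUnion, Set.mem_ofPred_eq,
    exists_prop]
  constructor
  · intro hω
    have : ∀ i ≤ t, Y i ω = (fun j : Fin (t + 1) => Y j ω) (Fin.ofNat (t + 1) i) := by
      intro i hi
      simp [Nat.mod_eq_of_lt (Nat.lt_succ_of_le hi)]
    exact ⟨fun j : Fin (t + 1) => Y j ω, ⟨ω, hω, this⟩, this⟩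
  · rintro ⟨w, ⟨ω', hω', h1⟩, h2⟩
    exact hE ω' ω (fun i hi => (h1 i hi).trans (h2 i hi).symm) hω'

theorem cylinder_disjoint (Y : ℕ → Ω → V) (t : ℕ) (W : Set (Fin (t + 1) → V)) :
    W.PairwiseDisjoint fun w => {ω | ∀ i ≤ t, Y i ω = w (Fin.ofNat (t + 1) i)} := by
  intro w _ w' _ hne
  rw [Function.onFun, Set.disjoint_left]
  intro ω h1 h2
  apply hne
  funext j
  have := (h1 j (Nat.lt_succ_iff.mp j.2)).symm.trans (h2 j (Nat.lt_succ_iff.mp j.2))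
  simpa using this

end PrefixEvents

/-! ### The transition operator and potential-theoretic bounds -/

section WalkOp

variable {V : Type*} [Fintype V] (G : SimpleGraph V) [DecidableRel G.Adj]

/-- The transition operator of simple random walk, acting on functions. -/
noncomputable def walkOp (f : V → ℝ) (v : V) : ℝ :=
  ∑ w, stepProb G v w * f w

variable {G}

theorem walkOp_mono {f g : V → ℝ} (h : f ≤ g) : walkOp G f ≤ walkOp G g :=
  fun v => Finset.sum_le_sum fun w _ => mul_le_mul_of_nonneg_left (h w) (stepProb_nonneg G v w)

theorem walkOp_iterate_mono (k : ℕ) {f g : V → ℝ} (h : f ≤ g) :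
    (walkOp G)^[k] f ≤ (walkOp G)^[k] g :=
  Monotone.iterate (fun _ _ => walkOp_mono) k h

theorem walkOp_nonneg {f : V → ℝ} (h : 0 ≤ f) : 0 ≤ walkOp G f :=
  fun v => Finset.sum_nonneg fun w _ => mul_nonneg (stepProb_nonneg G v w) (h w)

theorem walkOp_iterate_nonneg (k : ℕ) {f : V → ℝ} (h : 0 ≤ f) : 0 ≤ (walkOp G)^[k] f := by
  induction k generalizing f with
  | zero => exact h
  | succ k ih => exact ih (walkOp_nonneg h)

theorem walkOp_add (f g : V → ℝ) : walkOp G (f + g) = walkOp G f + walkOp G g := by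
  ext v; simp [walkOp, mul_add, Finset.sum_add_distrib]

theorem walkOp_smul (a : ℝ) (f : V → ℝ) : walkOp G (a • f) = a • walkOp G f := by
  ext v; simp only [walkOp, Pi.smul_apply, smul_eq_mul, Finset.mul_sum]
  exact Finset.sum_congr rfl fun w _ => by ring

theorem walkOp_const (hG : ∀ v, 0 < G.degree v) (a : ℝ) : walkOp G (fun _ => a) = fun _ => a := by
  ext v; simp only [walkOp, ← Finset.sum_mul, sum_stepProb G v (hG v), one_mul]

/-- Detailed balance: the degree cancels, so all oriented edges carry the same flow. -/
theorem stationaryProb_mul_stepProb (hG : ∀ v, 0 < G.degree v) (u v : V) :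
    stationaryProb G u * stepProb G u v =
      if G.Adj u v then 1 / (2 * (G.edgeFinset.card : ℝ)) else 0 := by
  have h0 : (G.degree u : ℝ) ≠ 0 := by exact_mod_cast (hG u).ne'
  unfold stationaryProb stepProb
  split_ifs
  · field_simp
  · simp

theorem sum_stationaryProb_mul_stepProb (hG : ∀ v, 0 < G.degree v) (v : V) :
    ∑ u, stationaryProb G u * stepProb G u v = stationaryProb G v := by
  have : ∀ u, stationaryProb G u * stepProb G u v = stationaryProb G v * stepProb G v u := by
    intro u
    rw [stationaryProb_mul_stepProb hG, stationaryProb_mul_stepProb hG]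
    simp [G.adj_comm]
  simp only [this, ← Finset.mul_sum, sum_stepProb G v (hG v), mul_one]

/-- Discounted occupation sums are bounded by supersolutions. -/
theorem sum_discounted_iterate_le {r : ℝ} (hr : 0 ≤ r) {f R : V → ℝ} (hR : 0 ≤ R)
    (h : ∀ v, f v + r * walkOp G R v ≤ R v) (n : ℕ) (v : V) :
    ∑ k ∈ Finset.range n, r ^ k * (walkOp G)^[k] f v ≤ R v := by
  -- The remainder `r ^ n * K ^ n R` makes the induction telescope; being nonnegative, it is dropped
  -- at the end.
  have key : ∀ n, ∀ v, ∑ k ∈ Finset.range n, r ^ k * (walkOp G)^[k] f v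
      + r ^ n * (walkOp G)^[n] R v ≤ R v := by
    intro n
    induction n with
    | zero => simp
    | succ n ih =>
      intro v
      have h1 := walkOp_iterate_mono (G := G) n (f := f + r • walkOp G R) (g := R) h v
      have hadd : ∀ n, ∀ f g : V → ℝ, (walkOp G)^[n] (f + r • g) =
          (walkOp G)^[n] f + r • (walkOp G)^[n] g := by
        intro n
        induction n with
        | zero => intros; rfl
        | succ n ih => intro f g; simp only [Function.iterate_succ_apply, walkOp_add, walkOp_smul, ih]
      rw [hadd, ← Function.iterate_succ_apply] at h1
      have h2 := mul_le_mul_of_nonneg_left h1 (pow_nonneg hr n)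
      rw [Finset.sum_range_succ]
      simp only [Pi.add_apply, Pi.smul_apply, smul_eq_mul] at h2
      have := ih v
      rw [pow_succ]
      nlinarith
  have := key n v
  have h3 := mul_nonneg (pow_nonneg hr n) (walkOp_iterate_nonneg (G := G) n hR v)
  linarith

/-- Occupation sums over a finite horizon are bounded by potentials with bounded drift. -/
theorem sum_iterate_le {ε : ℝ} (hG : ∀ v, 0 < G.degree v) {f h : V → ℝ} (hh : 0 ≤ h)
    (hf : ∀ v, f v + walkOp G h v ≤ h v + ε) (n : ℕ) (v : V) :
    ∑ k ∈ Finset.range n, (walkOp G)^[k] f v ≤ h v + n * ε := by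
  have hconst : ∀ n (f : V → ℝ) (a : ℝ), (walkOp G)^[n] (f + fun _ => a) =
      (walkOp G)^[n] f + fun _ => a := by
    intro n
    induction n with
    | zero => intros; rfl
    | succ n ih =>
      intro f a
      simp only [Function.iterate_succ_apply, walkOp_add, walkOp_const hG, ih]
  have hadd : ∀ n, ∀ f g : V → ℝ, (walkOp G)^[n] (f + g) =
      (walkOp G)^[n] f + (walkOp G)^[n] g := by
    intro n
    induction n with
    | zero => intros; rfl
    | succ n ih => intro f g; simp only [Function.iterate_succ_apply, walkOp_add, ih]
  have key : ∀ n, ∑ k ∈ Finset.range n, (walkOp G)^[k] f v + (walkOp G)^[n] h v ≤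
      h v + n * ε := by
    intro n
    induction n with
    | zero => simp
    | succ n ih =>
      have h1 := walkOp_iterate_mono (G := G) n (f := f + walkOp G h) (g := h + fun _ => ε) hf v
      rw [hadd, hconst, ← Function.iterate_succ_apply] at h1
      rw [Finset.sum_range_succ]
      simp only [Pi.add_apply] at h1
      push_cast
      linarith
  have := key n
  have h3 := walkOp_iterate_nonneg (G := G) n hh v
  simp only [Pi.zero_apply] at h3
  linarith

end WalkOp

/-! ### Markov property and stationarity of a single walk -/

section SingleWalk

variable {V ι Ω : Type*} [Fintype V] {G : SimpleGraph V} [DecidableRel G.Adj]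
  [MeasurableSpace Ω] {P : Measure Ω} {X : ι → ℕ → Ω → V}

namespace IsStationaryWalkSystem

theorem measurableSet_prefix (h : IsStationaryWalkSystem G P X) (g : ι) (t : ℕ) (w : ℕ → V) :
    MeasurableSet {ω | ∀ i ≤ t, X g i ω = w i} := by
  have : {ω | ∀ i ≤ t, X g i ω = w i} =
      ⋂ i ∈ Finset.range (t + 1), {ω | X g i ω = w i} := by
    ext ω; simp
  rw [this]
  exact Finset.measurableSet_biInter _ fun i _ => h.measurable_fiber g i _

theorem measurableSet_of_prefix (h : IsStationaryWalkSystem G P X) {g : ι} {t : ℕ} {E : Set Ω}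
    (hE : IsPrefixEvent (X g) t E) : MeasurableSet E := by
  obtain ⟨W, hW⟩ := hE.exists_cylinders
  rw [hW]
  exact Finset.measurableSet_biUnion _ fun w _ => h.measurableSet_prefix g t fun i => w _

/-- The Markov property for one step. -/
theorem markov_step [IsProbabilityMeasure P] (h : IsStationaryWalkSystem G P X) {g : ι} {t : ℕ}
    {E : Set Ω} (hE : IsPrefixEvent (X g) t E) (u v : V) :
    P.real (E ∩ {ω | X g t ω = u} ∩ {ω | X g (t + 1) ω = v}) =
      P.real (E ∩ {ω | X g t ω = u}) * stepProb G u v := by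
  obtain ⟨W, hW⟩ := (hE.inter (isPrefixEvent_eq (X g) le_rfl u)).exists_cylinders
  rw [hW, Set.iUnion₂_inter, measureReal_biUnion_finset (cylinder_disjoint (X g) t _)
      fun w _ => h.measurableSet_prefix g t _,
    measureReal_biUnion_finset ?_ fun w _ => (h.measurableSet_prefix g t _).inter
      (h.measurable_fiber g _ _), Finset.sum_mul]
  · refine Finset.sum_congr rfl fun w hw => ?_
    -- An empty cylinder need not end at `u`, but contributes zero to both sides; a nonempty one
    -- lies in `{X g t = u}` and so ends at `u`.
    rcases Set.eq_empty_or_nonempty {ω | ∀ i ≤ t, X g i ω = w (Fin.ofNat (t + 1) i)} with he | he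
    · rw [he]; simp
    obtain ⟨ω, hω⟩ := he
    have hu : w (Fin.ofNat (t + 1) t) = u := by
      have : ω ∈ E ∩ {ω | X g t ω = u} := by
        rw [hW]; exact Set.mem_biUnion hw hω
      rw [← hω t le_rfl]; exact this.2
    let w' : ℕ → V := fun i => if i ≤ t then w (Fin.ofNat (t + 1) i) else v
    have e1 : {ω | ∀ i ≤ t, X g i ω = w (Fin.ofNat (t + 1) i)} = {ω | ∀ i ≤ t, X g i ω = w' i} := by
      ext ω
      refine forall₂_congr fun i hi => ?_
      simp [w', hi]
    have e2 : {ω | ∀ i ≤ t, X g i ω = w (Fin.ofNat (t + 1) i)} ∩ {ω | X g (t + 1) ω = v} =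
        {ω | ∀ i ≤ t + 1, X g i ω = w' i} := by
      rw [e1]
      ext ω
      simp only [Set.mem_inter_iff, Set.mem_ofPred_eq]
      constructor
      · rintro ⟨h1, h2⟩ i hi
        rcases Nat.lt_or_ge t i with h3 | h3
        · obtain rfl : i = t + 1 := by omega
          rw [h2]; simp [w']
        · exact h1 i h3
      · intro h1
        refine ⟨fun i hi => h1 i (by omega), ?_⟩
        rw [h1 _ le_rfl]; simp [w']
    rw [e2, e1, measureReal_def, measureReal_def, h.law, h.law, ENNReal.toReal_ofReal,
      ENNReal.toReal_ofReal, Finset.prod_range_succ, ← mul_assoc]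
    · congr 1
      have hu' : w' t = u := by simpa only [w', le_refl, if_true] using hu
      rw [hu']; simp [w']
    · exact mul_nonneg (stationaryProb_nonneg G _) (Finset.prod_nonneg fun _ _ => stepProb_nonneg G _ _)
    · exact mul_nonneg (stationaryProb_nonneg G _) (Finset.prod_nonneg fun _ _ => stepProb_nonneg G _ _)
  · exact fun w hw w' hw' hne => (cylinder_disjoint (X g) t _ hw hw' hne).mono Set.inter_subset_left
      Set.inter_subset_left

theorem sum_real_inter_fiber [IsProbabilityMeasure P] (h : IsStationaryWalkSystem G P X) {g : ι}
    {E : Set Ω} (hE : MeasurableSet E) (t : ℕ) :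
    ∑ v, P.real (E ∩ {ω | X g t ω = v}) = P.real E := by
  rw [← measureReal_biUnion_finset ?_ fun v _ => hE.inter (h.measurable_fiber g t v)]
  · congr 1; ext ω; simp
  · intro v _ v' _ hne
    rw [Function.onFun, Set.disjoint_left]
    rintro ω ⟨_, h1⟩ ⟨_, h2⟩
    exact hne (h1.symm.trans h2)

/-- The Markov property for several steps. -/
theorem markov_iterate [IsProbabilityMeasure P] (h : IsStationaryWalkSystem G P X) {g : ι} {t : ℕ}
    {E : Set Ω} (hE : IsPrefixEvent (X g) t E) (u : V) (k : ℕ) (f : V → ℝ) :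
    ∑ y, P.real (E ∩ {ω | X g t ω = u} ∩ {ω | X g (t + k) ω = y}) * f y =
      P.real (E ∩ {ω | X g t ω = u}) * (walkOp G)^[k] f u := by
  classical
  induction k generalizing f with
  | zero =>
    rw [Finset.sum_eq_single u]
    · simp [Set.inter_assoc]
    · intro y _ hy
      have : E ∩ {ω | X g t ω = u} ∩ {ω | X g (t + 0) ω = y} = ∅ := by
        ext ω
        simp only [Set.mem_inter_iff, Set.mem_ofPred_eq, Set.mem_empty_iff_false, iff_false]
        rintro ⟨⟨_, h1⟩, h2⟩
        exact hy (h2.symm.trans h1)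
      rw [this]; simp
    · simp
  | succ k ih =>
    have hE' : IsPrefixEvent (X g) (t + k) (E ∩ {ω | X g t ω = u}) :=
      (hE.inter (isPrefixEvent_eq (X g) le_rfl u)).mono (by omega)
    rw [Function.iterate_succ_apply, ← ih]
    simp only [walkOp, Finset.mul_sum]
    rw [Finset.sum_comm]
    refine Finset.sum_congr rfl fun y _ => ?_
    have hm : MeasurableSet (E ∩ {ω | X g t ω = u} ∩ {ω | X g (t + (k + 1)) ω = y}) :=
      (h.measurableSet_of_prefix hE').inter (h.measurable_fiber g _ _)
    rw [← h.sum_real_inter_fiber hm (g := g) (t + k), Finset.sum_mul]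
    refine Finset.sum_congr rfl fun z _ => ?_
    rw [← mul_assoc, ← h.markov_step hE', Set.inter_right_comm]
    rfl

theorem markov_iterate_single [IsProbabilityMeasure P] [DecidableEq V]
    (h : IsStationaryWalkSystem G P X) {g : ι}
    {t : ℕ} {E : Set Ω} (hE : IsPrefixEvent (X g) t E) (u : V) (k : ℕ) (y : V) :
    P.real (E ∩ {ω | X g t ω = u} ∩ {ω | X g (t + k) ω = y}) =
      P.real (E ∩ {ω | X g t ω = u}) * (walkOp G)^[k] (Pi.single y 1) u := by
  rw [← h.markov_iterate hE, Finset.sum_eq_single y]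
  · simp
  · intro z _ hz; simp [hz]
  · simp

theorem real_position [IsProbabilityMeasure P] (h : IsStationaryWalkSystem G P X)
    (hG : ∀ v, 0 < G.degree v) (g : ι) (t : ℕ) (v : V) :
    P.real {ω | X g t ω = v} = stationaryProb G v := by
  induction t generalizing v with
  | zero =>
    have := h.law g 0 fun _ => v
    simp only [nonpos_iff_eq_zero, forall_eq, Finset.range_zero, Finset.prod_empty, mul_one] at this
    rw [measureReal_def, this, ENNReal.toReal_ofReal (stationaryProb_nonneg G v)]
  | succ t ih =>
    rw [← h.sum_real_inter_fiber (h.measurable_fiber g (t + 1) v) (g := g) t,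
      ← sum_stationaryProb_mul_stepProb hG v]
    refine Finset.sum_congr rfl fun u _ => ?_
    have := h.markov_step (isPrefixEvent_univ (X g) t) u v
    rw [Set.univ_inter, ih] at this
    rw [← this, Set.inter_comm]

theorem real_crossing [IsProbabilityMeasure P] (h : IsStationaryWalkSystem G P X)
    (hG : ∀ v, 0 < G.degree v) (g : ι) (t : ℕ) (u v : V) :
    P.real ({ω | X g t ω = u} ∩ {ω | X g (t + 1) ω = v}) =
      if G.Adj u v then 1 / (2 * (G.edgeFinset.card : ℝ)) else 0 := by
  have := h.markov_step (isPrefixEvent_univ (X g) t) u v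
  rwa [Set.univ_inter, h.real_position hG, stationaryProb_mul_stepProb hG] at this

end IsStationaryWalkSystem

end SingleWalk

/-! ### Adjacency, degrees and the walk operator of the graph -/

section GraphFacts

variable {m : ℕ}

theorem adj_c_c (i i' : Fin m) :
    (cycleStarClique m).Adj (.inl i) (.inl i') ↔ (SimpleGraph.cycleGraph m).Adj i i' := by
  simp only [cycleStarClique, SimpleGraph.fromRel_adj, cycleStarCliqueRel, ne_eq, Sum.inl.injEq]
  rw [(SimpleGraph.cycleGraph m).adj_comm i' i, or_self]
  exact ⟨fun h => h.2, fun h => ⟨h.ne, h⟩⟩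

theorem adj_c_l (i i' j : Fin m) :
    (cycleStarClique m).Adj (.inl i) (.inr (.inl (i', j))) ↔ i = i' := by
  simp [cycleStarClique, cycleStarCliqueRel]

theorem adj_c_q (i i' j k : Fin m) :
    ¬ (cycleStarClique m).Adj (.inl i) (.inr (.inr (i', j, k))) := by
  simp [cycleStarClique, cycleStarCliqueRel]

theorem adj_l_c (i i' j : Fin m) :
    (cycleStarClique m).Adj (.inr (.inl (i', j))) (.inl i) ↔ i' = i := by
  rw [SimpleGraph.adj_comm, adj_c_l, eq_comm]

theorem adj_l_l (i j i' j' : Fin m) :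
    ¬ (cycleStarClique m).Adj (.inr (.inl (i, j))) (.inr (.inl (i', j'))) := by
  simp [cycleStarClique, cycleStarCliqueRel]

theorem adj_l_q (i j i' j' k : Fin m) :
    (cycleStarClique m).Adj (.inr (.inl (i, j))) (.inr (.inr (i', j', k))) ↔ i = i' ∧ j = j' := by
  simp [cycleStarClique, cycleStarCliqueRel]

theorem adj_q_c (i i' j k : Fin m) :
    ¬ (cycleStarClique m).Adj (.inr (.inr (i', j, k))) (.inl i) := by
  rw [SimpleGraph.adj_comm]; exact adj_c_q _ _ _ _

theorem adj_q_l (i j i' j' k : Fin m) :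
    (cycleStarClique m).Adj (.inr (.inr (i', j', k))) (.inr (.inl (i, j))) ↔ i' = i ∧ j' = j := by
  rw [SimpleGraph.adj_comm, adj_l_q, eq_comm, eq_comm (a := j)]

theorem adj_q_q (i j k i' j' k' : Fin m) :
    (cycleStarClique m).Adj (.inr (.inr (i, j, k))) (.inr (.inr (i', j', k'))) ↔
      i = i' ∧ j = j' ∧ k ≠ k' := by
  simp only [cycleStarClique, SimpleGraph.fromRel_adj, cycleStarCliqueRel]
  grind

/-- Neighbour sums serve twice: for `f = 1` they are the degrees, in general the numerators of the
walk operator. -/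
theorem sum_ite_adj_c (f : CycleStarCliqueVertex m → ℝ) (i : Fin m) :
    ∑ w, (if (cycleStarClique m).Adj (.inl i) w then f w else 0) =
      (∑ i', if (SimpleGraph.cycleGraph m).Adj i i' then f (.inl i') else 0) +
        ∑ j, f (.inr (.inl (i, j))) := by
  simp only [Fintype.sum_sum_type, Fintype.sum_prod_type, adj_c_c, adj_c_l, adj_c_q, if_false,
    Finset.sum_const_zero, add_zero]
  congr 1
  rw [Finset.sum_eq_single i] <;> simp +contextual [eq_comm]

theorem sum_ite_adj_l (f : CycleStarCliqueVertex m → ℝ) (i j : Fin m) :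
    ∑ w, (if (cycleStarClique m).Adj (.inr (.inl (i, j))) w then f w else 0) =
      f (.inl i) + ∑ k, f (.inr (.inr (i, j, k))) := by
  simp only [Fintype.sum_sum_type, Fintype.sum_prod_type, adj_l_c, adj_l_l, adj_l_q, if_false,
    Finset.sum_const_zero, zero_add]
  congr 1
  · simp
  · rw [Finset.sum_eq_single i, Finset.sum_eq_single j] <;> simp +contextual [eq_comm]

theorem sum_ite_adj_q (f : CycleStarCliqueVertex m → ℝ) (i j k : Fin m) :
    ∑ w, (if (cycleStarClique m).Adj (.inr (.inr (i, j, k))) w then f w else 0) =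
      f (.inr (.inl (i, j))) + ((∑ k', f (.inr (.inr (i, j, k')))) - f (.inr (.inr (i, j, k)))) := by
  simp only [Fintype.sum_sum_type, Fintype.sum_prod_type, adj_q_c, adj_q_l, adj_q_q, if_false,
    Finset.sum_const_zero, zero_add]
  congr 1
  · rw [Finset.sum_eq_single i, Finset.sum_eq_single j] <;> simp +contextual [eq_comm]
  · rw [Finset.sum_eq_single i, Finset.sum_eq_single j]
    · rw [← Finset.sum_erase_eq_sub (Finset.mem_univ k), ← Finset.filter_ne' , Finset.sum_filter]
      simp [eq_comm]
    all_goals simp +contextual [eq_comm]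

theorem degree_eq_sum {V : Type*} [Fintype V] (G : SimpleGraph V) [DecidableRel G.Adj] (v : V) :
    (G.degree v : ℝ) = ∑ w, if G.Adj v w then 1 else 0 := by
  rw [← G.card_neighborFinset_eq_degree, G.neighborFinset_eq_filter, Finset.card_filter]
  push_cast
  rfl

theorem walkOp_eq {V : Type*} [Fintype V] (G : SimpleGraph V) [DecidableRel G.Adj] (f : V → ℝ)
    (v : V) : walkOp G f v = (∑ w, if G.Adj v w then f w else 0) / G.degree v := by
  simp only [walkOp, stepProb, Finset.sum_div]
  refine Finset.sum_congr rfl fun w _ => ?_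
  split_ifs <;> ring

theorem card_adj_cycleGraph (hm : 3 ≤ m) (i : Fin m) :
    (∑ i', if (SimpleGraph.cycleGraph m).Adj i i' then (1 : ℝ) else 0) = 2 := by
  obtain ⟨n, rfl⟩ : ∃ n, m = n + 3 := ⟨m - 3, by omega⟩
  rw [← degree_eq_sum, SimpleGraph.cycleGraph_degree_three_le]
  norm_num

theorem degree_c (hm : 3 ≤ m) (i : Fin m) :
    ((cycleStarClique m).degree (.inl i) : ℝ) = m + 2 := by
  rw [degree_eq_sum, sum_ite_adj_c, card_adj_cycleGraph hm]
  simp [add_comm]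

theorem degree_l (i j : Fin m) :
    ((cycleStarClique m).degree (.inr (.inl (i, j))) : ℝ) = m + 1 := by
  rw [degree_eq_sum, sum_ite_adj_l]
  simp [add_comm]

theorem degree_q (i j k : Fin m) :
    ((cycleStarClique m).degree (.inr (.inr (i, j, k))) : ℝ) = m := by
  rw [degree_eq_sum, sum_ite_adj_q]
  simp

theorem degree_bounds (hm : 3 ≤ m) (v : CycleStarCliqueVertex m) :
    m ≤ (cycleStarClique m).degree v ∧ (cycleStarClique m).degree v ≤ m + 2 := by
  rcases v with i | ⟨i, j⟩ | ⟨i, j, k⟩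
  · have : (cycleStarClique m).degree (.inl i) = m + 2 := by exact_mod_cast degree_c hm i
    omega
  · have : (cycleStarClique m).degree (.inr (.inl (i, j))) = m + 1 := by
      exact_mod_cast degree_l i j
    omega
  · have : (cycleStarClique m).degree (.inr (.inr (i, j, k))) = m := by
      exact_mod_cast degree_q i j k
    omega

theorem degree_pos (hm : 3 ≤ m) (v : CycleStarCliqueVertex m) : 0 < (cycleStarClique m).degree v :=
  lt_of_lt_of_le (by omega) (degree_bounds hm v).1

theorem stepProb_le (hm : 3 ≤ m) (u v : CycleStarCliqueVertex m) :
    stepProb (cycleStarClique m) u v ≤ 1 / m := by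
  have h0 : (0 : ℝ) < m := by exact_mod_cast (by omega : 0 < m)
  have h1 : (m : ℝ) ≤ (cycleStarClique m).degree u := by exact_mod_cast (degree_bounds hm u).1
  unfold stepProb
  split_ifs
  · gcongr
  · positivity

theorem two_mul_card_edges (hm : 3 ≤ m) :
    2 * ((cycleStarClique m).edgeFinset.card : ℝ) = m ^ 4 + m ^ 3 + 2 * m ^ 2 + 2 * m := by
  have h := (cycleStarClique m).sum_degrees_eq_twice_card_edges
  have h' : 2 * ((cycleStarClique m).edgeFinset.card : ℝ) =
      ∑ v, ((cycleStarClique m).degree v : ℝ) := by exact_mod_cast h.symm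
  rw [h']
  simp only [Fintype.sum_sum_type, Fintype.sum_prod_type, degree_c hm, degree_l, degree_q,
    Finset.sum_const, Finset.card_univ, Fintype.card_fin, nsmul_eq_mul]
  ring

theorem two_mul_card_edges_le (hm : 3 ≤ m) :
    2 * ((cycleStarClique m).edgeFinset.card : ℝ) ≤ 2 * m ^ 4 := by
  rw [two_mul_card_edges hm]
  have h : (3 : ℝ) ≤ m := by exact_mod_cast hm
  have h2 : 2 * (m : ℝ) ≤ m ^ 2 := by nlinarith
  have h3 : 3 * (m : ℝ) ^ 2 ≤ m ^ 3 := by nlinarith [sq_nonneg (m : ℝ)]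
  have h4 : 3 * (m : ℝ) ^ 3 ≤ m ^ 4 := by nlinarith [pow_nonneg (by linarith : (0 : ℝ) ≤ m) 3]
  nlinarith [sq_nonneg (m : ℝ)]

theorem le_two_mul_card_edges (hm : 3 ≤ m) :
    (m : ℝ) ^ 4 ≤ 2 * ((cycleStarClique m).edgeFinset.card : ℝ) := by
  rw [two_mul_card_edges hm]
  have : (0 : ℝ) ≤ m ^ 3 + 2 * m ^ 2 + 2 * m := by positivity
  linarith

theorem card_vertices (m : ℕ) : Fintype.card (CycleStarCliqueVertex m) = m + m ^ 2 + m ^ 3 := by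
  simp only [Fintype.card_sum, Fintype.card_prod, Fintype.card_fin]
  ring

theorem cycleStarClique_connected (hm : 3 ≤ m) : (cycleStarClique m).Connected := by
  obtain ⟨n, rfl⟩ : ∃ n, m = n + 1 := ⟨m - 1, by omega⟩
  have hcc : ∀ i i' : Fin (n + 1), (cycleStarClique (n + 1)).Reachable (.inl i) (.inl i') := by
    intro i i'
    obtain ⟨p⟩ := (SimpleGraph.cycleGraph_connected (n := n)).preconnected i i'
    induction p with
    | nil => exact .refl _
    | cons hadj _ ih => exact (SimpleGraph.Adj.reachable ((adj_c_c _ _).2 hadj)).trans ih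
  have hl : ∀ i j : Fin (n + 1),
      (cycleStarClique (n + 1)).Reachable (.inl i) (.inr (.inl (i, j))) :=
    fun i j => SimpleGraph.Adj.reachable ((adj_c_l _ _ _).2 rfl)
  have h : ∀ v, (cycleStarClique (n + 1)).Reachable (.inl 0) v := by
    rintro (i | ⟨i, j⟩ | ⟨i, j, k⟩)
    · exact hcc _ _
    · exact (hcc _ _).trans (hl i j)
    · exact ((hcc _ _).trans (hl i j)).trans
        (SimpleGraph.Adj.reachable ((adj_l_q _ _ _ _ _).2 ⟨rfl, rfl⟩))
  exact { preconnected := fun u v => (h u).symm.trans (h v), nonempty := ⟨.inl 0⟩ }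

theorem graph_properties {n m : ℕ} (hm : 3 ≤ m) (h1 : m ^ 3 ≤ n) (h2 : n < (m + 1) ^ 3) :
    (cycleStarClique m).Connected ∧
      (∀ v, m ≤ (cycleStarClique m).degree v ∧ (cycleStarClique m).degree v ≤ m + 2) ∧
      n ≤ 2 * Fintype.card (CycleStarCliqueVertex m) ∧
      Fintype.card (CycleStarCliqueVertex m) ≤ 2 * n := by
  refine ⟨cycleStarClique_connected hm, degree_bounds hm, ?_, ?_⟩ <;> rw [card_vertices]
  all_goals
    have h3 : 3 * m ≤ m ^ 2 := by nlinarith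
    have h4 : 3 * m ^ 2 ≤ m ^ 3 := by nlinarith [sq_nonneg m]
    have h5 : (m + 1) ^ 3 = m ^ 3 + 3 * m ^ 2 + 3 * m + 1 := by ring
    omega

theorem walkOp_l (f : CycleStarCliqueVertex m → ℝ) (i j : Fin m) :
    walkOp (cycleStarClique m) f (.inr (.inl (i, j))) =
      (f (.inl i) + ∑ k, f (.inr (.inr (i, j, k)))) / (m + 1) := by
  rw [walkOp_eq, sum_ite_adj_l, degree_l]

theorem walkOp_q (f : CycleStarCliqueVertex m → ℝ) (i j k : Fin m) :
    walkOp (cycleStarClique m) f (.inr (.inr (i, j, k))) =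
      (f (.inr (.inl (i, j))) + ((∑ k', f (.inr (.inr (i, j, k')))) -
        f (.inr (.inr (i, j, k))))) / m := by
  rw [walkOp_eq, sum_ite_adj_q, degree_q]

/-- The potentials below depend on the position along the cycle, but a common bound for the two
cycle neighbours is all that is needed. -/
theorem walkOp_c_le (hm : 3 ≤ m) (f : CycleStarCliqueVertex m → ℝ) (i : Fin m) {a : ℝ}
    (ha : ∀ i', (SimpleGraph.cycleGraph m).Adj i i' → f (.inl i') ≤ a) :
    walkOp (cycleStarClique m) f (.inl i) ≤
      (2 * a + ∑ j, f (.inr (.inl (i, j)))) / (m + 2) := by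
  rw [walkOp_eq, sum_ite_adj_c, degree_c hm]
  gcongr
  rw [← card_adj_cycleGraph hm i, Finset.sum_mul]
  refine Finset.sum_le_sum fun i' _ => ?_
  split_ifs with h
  · simpa using ha i' h
  · simp

end GraphFacts

/-! ### Chains of carriers dominating meet-exchange -/

section Chains

variable {m : ℕ}

/-- A trajectory picks up the rumor from the state `a` in round `u`: a cycle vertex passes the
rumor on only in its own round, while a star leaf (which stands for its whole clique) passes it
on to the agents that move from the leaf to the cycle in any later round. -/
def PicksUp (y : ℕ → CycleStarCliqueVertex m) (a : CycleStarCliqueVertex m × ℕ) (u : ℕ) : Prop :=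
  match a with
  | (.inl i, t) => u = t ∧ y u = .inl i
  | (.inr (.inl (i, j)), t) => t ≤ u ∧ y u = .inr (.inl (i, j)) ∧ y (u + 1) = .inl i
  | (.inr (.inr _), _) => False

theorem PicksUp.le {y : ℕ → CycleStarCliqueVertex m} {a : CycleStarCliqueVertex m × ℕ} {u : ℕ}
    (h : PicksUp y a u) : a.2 ≤ u := by
  rcases a with ⟨i | ⟨i, j⟩ | q, t⟩
  · exact h.1.ge
  · exact h.1
  · exact h.elim

/-- A trajectory carries the rumor from the state `a` to the state `b`. -/
def Carries (y : ℕ → CycleStarCliqueVertex m) (a b : CycleStarCliqueVertex m × ℕ) : Prop :=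
  ∃ u, PicksUp y a u ∧ u < b.2 ∧ y b.2 = b.1

variable {ι : Type*} [DecidableEq ι]

/-- The rumor is carried from one state to another by distinct agents outside `S`. -/
inductive Chain (x : ι → ℕ → CycleStarCliqueVertex m) :
    Finset ι → CycleStarCliqueVertex m × ℕ → CycleStarCliqueVertex m × ℕ → Prop
  | refl (S a) : Chain x S a a
  | cons {S g a b c} : g ∉ S → Carries (x g) a b → Chain x (insert g S) b c → Chain x S a c

theorem Chain.time_le {x : ι → ℕ → CycleStarCliqueVertex m} {S : Finset ι}
    {a b : CycleStarCliqueVertex m × ℕ} (h : Chain x S a b) : a.2 ≤ b.2 := by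
  induction h with
  | refl => exact le_rfl
  | cons _ hl _ ih =>
    obtain ⟨u, hu, hlt, _⟩ := hl
    have := hu.le
    omega

/-- Appending a carrier, with loop erasure if the agent has occurred before. -/
theorem Chain.append {x : ι → ℕ → CycleStarCliqueVertex m} {S : Finset ι} {g : ι}
    {a b c : CycleStarCliqueVertex m × ℕ} (h : Chain x S a b) (hg : g ∉ S)
    (hl : Carries (x g) b c) : Chain x S a c := by
  induction h with
  | refl => exact .cons hg hl (.refl _ _)
  | @cons S g' a a' b hg' hl' hch ih =>
    -- If the new agent already carried the first link, its own trajectory leads from `a` directly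
    -- to `c`, since the pick-up precedes `a'`, `b` and `c` in time; everything in between is
    -- erased.
    by_cases he : g = g'
    · subst he
      obtain ⟨u, hu, hlt, _⟩ := hl'
      obtain ⟨u', hu', hlt', heq⟩ := hl
      have h1 := hu'.le
      have h2 := hch.time_le
      exact .cons hg ⟨u, hu, by omega, heq⟩ (.refl _ _)
    · exact .cons hg' hl' (ih (by simp [he, hg]) hl)

/-- The states from which chains start if the source is `s`. -/
def initialStates (s : CycleStarCliqueVertex m) : Set (CycleStarCliqueVertex m × ℕ) :=
  match s with
  | .inl i => {a | a.1 = .inl i}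
  | .inr (.inl (i, j)) => {(.inr (.inl (i, j)), 0)}
  | .inr (.inr (i, j, _)) => {(.inr (.inl (i, j)), 0)}

/-- Some chain from the initial states has reached the vertex `v`, or the leaf of its clique, by
round `t`. -/
def Reached (s : CycleStarCliqueVertex m) (x : ι → ℕ → CycleStarCliqueVertex m)
    (v : CycleStarCliqueVertex m) (t : ℕ) : Prop :=
  match v with
  | .inl i => ∃ a ∈ initialStates s, Chain x ∅ a (.inl i, t)
  | .inr (.inl (i, j)) => ∃ t' ≤ t, ∃ a ∈ initialStates s, Chain x ∅ a (.inr (.inl (i, j)), t')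
  | .inr (.inr (i, j, _)) => ∃ t' ≤ t, ∃ a ∈ initialStates s,
      Chain x ∅ a (.inr (.inl (i, j)), t')

/-- The source may inform its first visitors in a round not known in advance. A source on the cycle
therefore has an initial state in every round, while a clique state lasts from round `0` on. -/
theorem reached_source (s : CycleStarCliqueVertex m) (x : ι → ℕ → CycleStarCliqueVertex m)
    (t : ℕ) : Reached s x s t := by
  rcases s with i | ⟨i, j⟩ | ⟨i, j, k⟩
  · exact ⟨(.inl i, t), rfl, .refl _ _⟩
  · exact ⟨0, Nat.zero_le _, _, rfl, .refl _ _⟩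
  · exact ⟨0, Nat.zero_le _, _, rfl, .refl _ _⟩

/-- Only steps out of a cycle vertex and from a leaf to the cycle need a new link. Moves inside a
clique keep the old state, because a leaf stands for its clique and never expires. -/
theorem Reached.step {s : CycleStarCliqueVertex m} {x : ι → ℕ → CycleStarCliqueVertex m} {t : ℕ}
    {g : ι} (h : Reached s x (x g t) t)
    (hadj : (cycleStarClique m).Adj (x g t) (x g (t + 1))) :
    Reached s x (x g (t + 1)) (t + 1) := by
  generalize hv : x g t = v at h hadj
  generalize hw : x g (t + 1) = w at hadj
  rcases v with i | ⟨i, j⟩ | ⟨i, j, k⟩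
  · obtain ⟨a, ha, hch⟩ := h
    have hch' : Chain x ∅ a (w, t + 1) :=
      hch.append (Finset.notMem_empty g) ⟨t, ⟨rfl, hv⟩, Nat.lt_succ_self t, hw⟩
    rcases w with i' | ⟨i', j'⟩ | ⟨i', j', k'⟩
    · exact ⟨a, ha, hch'⟩
    · exact ⟨t + 1, le_rfl, a, ha, hch'⟩
    · exact (adj_c_q _ _ _ _ hadj).elim
  · obtain ⟨t', ht', a, ha, hch⟩ := h
    rcases w with i' | ⟨i', j'⟩ | ⟨i', j', k'⟩
    · obtain rfl := (adj_l_c _ _ _).1 hadj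
      exact ⟨a, ha, hch.append (Finset.notMem_empty g)
        ⟨t, ⟨ht', hv, hw⟩, Nat.lt_succ_self t, hw⟩⟩
    · exact (adj_l_l _ _ _ _ hadj).elim
    · obtain ⟨rfl, rfl⟩ := (adj_l_q _ _ _ _ _).1 hadj
      exact ⟨t', by omega, a, ha, hch⟩
  · obtain ⟨t', ht', a, ha, hch⟩ := h
    rcases w with i' | ⟨i', j'⟩ | ⟨i', j', k'⟩
    · exact (adj_q_c _ _ _ _ hadj).elim
    · obtain ⟨rfl, rfl⟩ := (adj_q_l _ _ _ _ _).1 hadj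
      exact ⟨t', by omega, a, ha, hch⟩
    · obtain ⟨rfl, rfl, _⟩ := (adj_q_q _ _ _ _ _ _).1 hadj
      exact ⟨t', by omega, a, ha, hch⟩

/-- In meet-exchange, the positions of informed agents are reached by chains. -/
theorem reached_of_mem_meetState {s : CycleStarCliqueVertex m}
    {x : ι → ℕ → CycleStarCliqueVertex m}
    (hx : ∀ g t, (cycleStarClique m).Adj (x g t) (x g (t + 1))) (t : ℕ) :
    ∀ g ∈ meetState s x t, Reached s x (x g t) t := by
  induction t with
  | zero =>
    intro g hg
    have : x g 0 = s := hg
    rw [this]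
    exact reached_source s x 0
  | succ t ih =>
    rintro g ((hg | ⟨g', hg', heq⟩) | ⟨_, hs⟩)
    · exact (ih g hg).step (hx g t)
    -- A newly informed agent stands where an informed one stands, so the meeting itself costs no
    -- link.
    · rw [heq]
      exact (ih g' hg').step (hx g' t)
    · have hs' : x g (t + 1) = s := hs
      rw [hs']
      exact reached_source s x (t + 1)

end Chains

/-! ### Bounding chain probabilities by supersolutions -/

section ChainProbability

variable {m : ℕ} {ι Ω : Type*} [Fintype ι] [DecidableEq ι] [MeasurableSpace Ω] {P : Measure Ω}
  {X : ι → ℕ → Ω → CycleStarCliqueVertex m}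

/-- Trajectory sets that are measurable for the product of the discrete σ-algebras. -/
abbrev MeasurableTrajectories (B : Set (ℕ → CycleStarCliqueVertex m)) : Prop :=
  @MeasurableSet _ (@MeasurableSpace.pi ℕ (fun _ => CycleStarCliqueVertex m) fun _ => ⊤) B

theorem measurableTrajectories_eq (t : ℕ) (v : CycleStarCliqueVertex m) :
    MeasurableTrajectories {y | y t = v} := by
  let _ : MeasurableSpace (CycleStarCliqueVertex m) := ⊤
  exact measurable_pi_apply (X := fun _ : ℕ => CycleStarCliqueVertex m) t (MeasurableSpace.measurableSet_top (s := {v}))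

theorem measurableTrajectories_picksUp (a : CycleStarCliqueVertex m × ℕ) (u : ℕ) :
    MeasurableTrajectories {y | PicksUp y a u} := by
  let _ : MeasurableSpace (CycleStarCliqueVertex m) := ⊤
  rcases a with ⟨i | ⟨i, j⟩ | q, t⟩
  · exact (MeasurableSet.const _).inter (measurableTrajectories_eq _ _)
  · exact (MeasurableSet.const _).inter
      ((measurableTrajectories_eq _ _).inter (measurableTrajectories_eq _ _))
  · exact MeasurableSet.const _

theorem measurableTrajectories_carries (a b : CycleStarCliqueVertex m × ℕ) :
    MeasurableTrajectories {y | Carries y a b} := by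
  let _ : MeasurableSpace (CycleStarCliqueVertex m) := ⊤
  simp only [Carries, Set.ofPred_exists]
  exact MeasurableSet.iUnion fun u => (measurableTrajectories_picksUp a u).inter
      ((MeasurableSet.const _).inter (measurableTrajectories_eq _ _))

/-- A supersolution of the one-carrier equation bounds the probability that a chain of distinct
agents reaches a target, jointly with any event of agents that the chain does not use. -/
theorem mul_measure_chain_le
    (hind : iIndepFun (m := fun _ => @MeasurableSpace.pi ℕ (fun _ => CycleStarCliqueVertex m)
      fun _ => ⊤) (fun g ω t => X g t ω) P)
    {Φ : CycleStarCliqueVertex m × ℕ → ℝ≥0∞} {T : Set (CycleStarCliqueVertex m × ℕ)} {κ : ℝ≥0∞}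
    (hT : ∀ a ∈ T, κ ≤ Φ a)
    (hΦ : ∀ a, ∑ g, ∑' b, P {ω | Carries (fun t => X g t ω) a b} * Φ b ≤ Φ a)
    (S : Finset ι) (B : ι → Set (ℕ → CycleStarCliqueVertex m))
    (hB : ∀ g ∈ S, MeasurableTrajectories (B g)) (a : CycleStarCliqueVertex m × ℕ) :
    κ * P ((⋂ g ∈ S, {ω | (fun t => X g t ω) ∈ B g}) ∩
      {ω | ∃ b ∈ T, Chain (fun g t => X g t ω) S a b}) ≤
        P (⋂ g ∈ S, {ω | (fun t => X g t ω) ∈ B g}) * Φ a := by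
  -- Induction on the number of unused agents. The events `B g` record the links already assigned to
  -- the agents in `S`.
  induction hn : Sᶜ.card using Nat.strong_induction_on generalizing S B a with
  | _ n ih =>
  by_cases ha : a ∈ T
  · rw [mul_comm]
    exact mul_le_mul' (measure_mono Set.inter_subset_left) (hT a ha)
  -- The first link, from `a` to `b` by agent `g`, becomes the event prescribed for `g`, which joins
  -- the used agents.
  let B' : ι → CycleStarCliqueVertex m × ℕ → ι → Set (ℕ → CycleStarCliqueVertex m) :=
    fun g b => Function.update B g {y | Carries y a b}
  have hB' : ∀ g ∉ S, ∀ b, (⋂ g' ∈ insert g S, {ω | (fun t => X g' t ω) ∈ B' g b g'}) =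
      (⋂ g' ∈ S, {ω | (fun t => X g' t ω) ∈ B g'}) ∩ {ω | Carries (fun t => X g t ω) a b} := by
    intro g hg b
    rw [Finset.set_biInter_insert, Set.inter_comm]
    congr 1
    · refine Set.iInter₂_congr fun g' hg' => ?_
      have : g' ≠ g := fun h => hg (h ▸ hg')
      simp [B', this]
    · simp [B']
  have hsub : (⋂ g ∈ S, {ω | (fun t => X g t ω) ∈ B g}) ∩
      {ω | ∃ b ∈ T, Chain (fun g t => X g t ω) S a b} ⊆
      ⋃ g ∈ Sᶜ, ⋃ b, ((⋂ g' ∈ insert g S, {ω | (fun t => X g' t ω) ∈ B' g b g'}) ∩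
        {ω | ∃ c ∈ T, Chain (fun g t => X g t ω) (insert g S) b c}) := by
    rintro ω ⟨hω, c, hc, hch⟩
    cases hch with
    | refl => exact (ha hc).elim
    | @cons _ g _ b _ hg hl hch =>
      simp only [Set.mem_iUnion]
      refine ⟨g, Finset.mem_compl.2 hg, b, ?_, c, hc, hch⟩
      rw [hB' g hg b]
      exact ⟨hω, hl⟩
  -- Independence enters here: the link of `g ∉ S` factors out of the events of the agents in `S`.
  have hone : ∀ g ∉ S, ∀ b, P (⋂ g' ∈ insert g S, {ω | (fun t => X g' t ω) ∈ B' g b g'}) =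
      P {ω | Carries (fun t => X g t ω) a b} * P (⋂ g' ∈ S, {ω | (fun t => X g' t ω) ∈ B g'}) := by
    intro g hg b
    have hm : ∀ g' ∈ insert g S, MeasurableTrajectories (B' g b g') := by
      intro g' hg'
      by_cases h : g' = g
      · subst h; simpa [B'] using measurableTrajectories_carries a b
      · simp only [B', Function.update_of_ne h]
        exact hB g' ((Finset.mem_insert.1 hg').resolve_left h)
    have h1 := hind.measure_inter_preimage_eq_mul (insert g S) hm
    have h2 := hind.measure_inter_preimage_eq_mul S hB
    simp only [Set.preimage] at h1 h2
    rw [h1, h2, Finset.prod_insert hg]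
    congr 1
    · simp [B']
    · refine Finset.prod_congr rfl fun g' hg' => ?_
      have : g' ≠ g := fun h => hg (h ▸ hg')
      simp [B', this]
  calc κ * P _ ≤ κ * ∑ g ∈ Sᶜ, ∑' b, P ((⋂ g' ∈ insert g S,
          {ω | (fun t => X g' t ω) ∈ B' g b g'}) ∩
        {ω | ∃ c ∈ T, Chain (fun g t => X g t ω) (insert g S) b c}) := by
        gcongr
        refine (measure_mono hsub).trans ((measure_biUnion_finset_le _ _).trans ?_)
        exact Finset.sum_le_sum fun g _ => measure_iUnion_le _
    _ = ∑ g ∈ Sᶜ, ∑' b, κ * P ((⋂ g' ∈ insert g S,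
          {ω | (fun t => X g' t ω) ∈ B' g b g'}) ∩
        {ω | ∃ c ∈ T, Chain (fun g t => X g t ω) (insert g S) b c}) := by
        rw [Finset.mul_sum]
        exact Finset.sum_congr rfl fun g _ => ENNReal.tsum_mul_left.symm
    _ ≤ ∑ g ∈ Sᶜ, ∑' b, P (⋂ g' ∈ S, {ω | (fun t => X g' t ω) ∈ B g'}) *
        (P {ω | Carries (fun t => X g t ω) a b} * Φ b) := by
        refine Finset.sum_le_sum fun g hg => ENNReal.tsum_le_tsum fun b => ?_
        have hg' := Finset.mem_compl.1 hg
        refine (ih _ ?_ (insert g S) (B' g b) ?_ b rfl).trans (le_of_eq ?_)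
        · rw [← hn]
          exact Finset.card_lt_card (Finset.compl_ssubset_compl.2 (Finset.ssubset_insert hg'))
        · intro g' hg''
          by_cases h : g' = g
          · subst h; simpa [B'] using measurableTrajectories_carries a b
          · simp only [B', Function.update_of_ne h]
            exact hB g' ((Finset.mem_insert.1 hg'').resolve_left h)
        · rw [hone g hg' b]; ring
    _ ≤ ∑ g, ∑' b, P (⋂ g' ∈ S, {ω | (fun t => X g' t ω) ∈ B g'}) *
        (P {ω | Carries (fun t => X g t ω) a b} * Φ b) :=
        Finset.sum_le_sum_of_subset (Finset.subset_univ _)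
    _ = P (⋂ g' ∈ S, {ω | (fun t => X g' t ω) ∈ B g'}) *
        ∑ g, ∑' b, P {ω | Carries (fun t => X g t ω) a b} * Φ b := by
        simp only [ENNReal.tsum_mul_left, ← Finset.mul_sum]
    _ ≤ _ := by gcongr; exact hΦ a

end ChainProbability

/-! ### Discounted occupation after a prefix event -/

section Supersolution

variable {V ι Ω : Type*} [Fintype V] {G : SimpleGraph V} [DecidableRel G.Adj]
  [MeasurableSpace Ω] {P : Measure Ω} [IsProbabilityMeasure P] {X : ι → ℕ → Ω → V}

/-- Discounted occupation sums of a walk after a prefix event. -/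
theorem IsStationaryWalkSystem.tsum_occupation_le (h : IsStationaryWalkSystem G P X) {g : ι}
    {t : ℕ} {E : Set Ω} (hE : IsPrefixEvent (X g) t E) (v : V) (j : ℕ) {r : ℝ} (hr : 0 ≤ r)
    {f R : V → ℝ} (hf : 0 ≤ f) (hR : 0 ≤ R)
    (hj : ∀ v, (walkOp G)^[j] f v + r * walkOp G ((walkOp G)^[j] R) v ≤ (walkOp G)^[j] R v) :
    ∑' k, ∑ y, P (E ∩ {ω | X g t ω = v} ∩ {ω | X g (t + (j + k)) ω = y}) *
        ENNReal.ofReal (f y * r ^ k) ≤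
      ENNReal.ofReal (P.real (E ∩ {ω | X g t ω = v}) * (walkOp G)^[j] R v) := by
  refine ENNReal.tsum_le_of_sum_range_le fun n => ?_
  have hterm : ∀ k y, P (E ∩ {ω | X g t ω = v} ∩ {ω | X g (t + (j + k)) ω = y}) *
        ENNReal.ofReal (f y * r ^ k) = ENNReal.ofReal
        (P.real (E ∩ {ω | X g t ω = v} ∩ {ω | X g (t + (j + k)) ω = y}) * (f y * r ^ k)) := by
    intro k y
    rw [ENNReal.ofReal_mul measureReal_nonneg, ofReal_measureReal]
  simp only [hterm]
  have hnn : ∀ k y, 0 ≤ P.real (E ∩ {ω | X g t ω = v} ∩ {ω | X g (t + (j + k)) ω = y}) *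
      (f y * r ^ k) :=
    fun k y => mul_nonneg measureReal_nonneg (mul_nonneg (hf y) (pow_nonneg hr k))
  rw [Finset.sum_congr rfl fun k _ => (ENNReal.ofReal_sum_of_nonneg fun y _ => hnn k y).symm,
    ← ENNReal.ofReal_sum_of_nonneg fun k _ => Finset.sum_nonneg fun y _ => hnn k y]
  refine ENNReal.ofReal_le_ofReal ?_
  -- The first `j` steps only replace `f` and `R` by their images under the walk operator; the
  -- discount starts afterwards.
  have hk : ∀ k, ∑ y, P.real (E ∩ {ω | X g t ω = v} ∩ {ω | X g (t + (j + k)) ω = y}) *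
      (f y * r ^ k) = P.real (E ∩ {ω | X g t ω = v}) *
        (r ^ k * (walkOp G)^[k] ((walkOp G)^[j] f) v) := by
    intro k
    rw [← Function.iterate_add_apply, Nat.add_comm k j, mul_left_comm, ← h.markov_iterate hE,
      Finset.mul_sum]
    exact Finset.sum_congr rfl fun y _ => by ring
  simp only [hk, ← Finset.mul_sum]
  exact mul_le_mul_of_nonneg_left
    (sum_discounted_iterate_le hr (walkOp_iterate_nonneg j hR) hj n v) measureReal_nonneg

end Supersolution

/-! ### From a supersolution of the walk to one for carriers -/

section Carriers

variable {m : ℕ} {ι Ω : Type*} [MeasurableSpace Ω] {P : Measure Ω}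
  {X : ι → ℕ → Ω → CycleStarCliqueVertex m}

/-- Union bound over the pick-up round `u` and the delay `k` until delivery: an agent may deliver in
every round after the pick-up. -/
theorem tsum_carries_le (g : ι) (a : CycleStarCliqueVertex m × ℕ)
    (Φ : CycleStarCliqueVertex m × ℕ → ℝ≥0∞) :
    ∑' b, P {ω | Carries (fun t => X g t ω) a b} * Φ b ≤
      ∑' u, ∑' k, ∑ y, P ({ω | PicksUp (fun t => X g t ω) a u} ∩ {ω | X g (u + 1 + k) ω = y}) *
        Φ (y, u + 1 + k) := by
  have hb : ∀ y t, P {ω | Carries (fun t => X g t ω) a (y, t)} * Φ (y, t) ≤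
      ∑' u, ∑' k, if t = u + 1 + k then
        P ({ω | PicksUp (fun t => X g t ω) a u} ∩ {ω | X g (u + 1 + k) ω = y}) *
          Φ (y, u + 1 + k) else 0 := by
    intro y t
    have hsub : {ω | Carries (fun t => X g t ω) a (y, t)} ⊆ ⋃ u, ⋃ k,
        if t = u + 1 + k then
          {ω | PicksUp (fun t => X g t ω) a u} ∩ {ω | X g (u + 1 + k) ω = y} else ∅ := by
      rintro ω ⟨u, hu, hlt, heq⟩
      obtain ⟨k, hk⟩ : ∃ k, t = u + 1 + k := ⟨t - (u + 1), by simp only at hlt; omega⟩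
      simp only [Set.mem_iUnion]
      refine ⟨u, k, ?_⟩
      rw [if_pos hk]
      subst hk
      exact ⟨hu, heq⟩
    refine (mul_le_mul_left (measure_mono hsub) _).trans ?_
    refine (mul_le_mul_left ((measure_iUnion_le _).trans
      (ENNReal.tsum_le_tsum fun u => measure_iUnion_le _)) _).trans ?_
    rw [← ENNReal.tsum_mul_right]
    refine ENNReal.tsum_le_tsum fun u => ?_
    rw [← ENNReal.tsum_mul_right]
    refine ENNReal.tsum_le_tsum fun k => ?_
    split_ifs with hk
    · subst hk; exact le_rfl
    · simp
  rw [ENNReal.tsum_prod']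
  refine (ENNReal.tsum_le_tsum fun y => ENNReal.tsum_le_tsum fun t => hb y t).trans ?_
  rw [tsum_fintype, Finset.sum_congr rfl fun y _ => ENNReal.tsum_comm,
    ← Summable.tsum_finsetSum fun _ _ => ENNReal.summable]
  refine ENNReal.tsum_le_tsum fun u => ?_
  rw [Finset.sum_congr rfl fun y _ => ENNReal.tsum_comm,
    ← Summable.tsum_finsetSum fun _ _ => ENNReal.summable]
  refine ENNReal.tsum_le_tsum fun k => Finset.sum_le_sum fun y _ => ?_
  rw [tsum_eq_single (u + 1 + k)]
  · simp
  · intro t ht; simp [ht]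

variable [IsProbabilityMeasure P]

/-- A discounted supersolution of the walk yields one for the carriers. -/
theorem sum_tsum_carries_le [Fintype ι] (h : IsStationaryWalkSystem (cycleStarClique m) P X)
    (hm : 3 ≤ m) {ψ R : CycleStarCliqueVertex m → ℝ} (hψ : 0 ≤ ψ) (hR : 0 ≤ R) {r : ℝ}
    (hr : 0 ≤ r) (hr1 : r < 1)
    (h1 : ∀ v, ψ v + r * walkOp (cycleStarClique m) R v ≤ R v)
    (h2 : ∀ i, Fintype.card ι * (stationaryProb (cycleStarClique m) (.inl i) *
      (r * walkOp (cycleStarClique m) R (.inl i))) ≤ ψ (.inl i))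
    (h3 : ∀ i j, Fintype.card ι * (1 / (2 * ((cycleStarClique m).edgeFinset.card : ℝ)) *
      (r / (1 - r) * R (.inl i))) ≤ ψ (.inr (.inl (i, j))))
    (a : CycleStarCliqueVertex m × ℕ) :
    ∑ g, ∑' b, P {ω | Carries (fun t => X g t ω) a b} * ENNReal.ofReal (ψ b.1 * r ^ b.2) ≤
      ENNReal.ofReal (ψ a.1 * r ^ a.2) := by
  have hG := degree_pos hm
  -- All agents have the same law, so a common bound per agent is multiplied by their number.
  suffices hg : ∃ c : ℝ, 0 ≤ c ∧ Fintype.card ι * c ≤ ψ a.1 * r ^ a.2 ∧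
      ∀ g, ∑' u, ∑' k, ∑ y, P ({ω | PicksUp (fun t => X g t ω) a u} ∩
        {ω | X g (u + 1 + k) ω = y}) * ENNReal.ofReal (ψ y * r ^ (u + 1 + k)) ≤
        ENNReal.ofReal c by
    obtain ⟨c, hc, hle, hg⟩ := hg
    calc _ ≤ ∑ g : ι, ENNReal.ofReal c :=
          Finset.sum_le_sum fun g _ => (tsum_carries_le g a _).trans (hg g)
      _ = ENNReal.ofReal (Fintype.card ι * c) := by
          rw [Finset.sum_const, Finset.card_univ, nsmul_eq_mul,
            ENNReal.ofReal_mul (Nat.cast_nonneg _), ENNReal.ofReal_natCast]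
      _ ≤ _ := ENNReal.ofReal_le_ofReal hle
  have hpow : ∀ (s : ℝ) (u k : ℕ), ENNReal.ofReal (s * r ^ (u + 1 + k)) =
      ENNReal.ofReal (s * r ^ k) * ENNReal.ofReal (r ^ (u + 1)) := by
    intro s u k
    rw [← ENNReal.ofReal_mul' (by positivity)]
    congr 1; ring
  rcases a with ⟨i | ⟨i, j⟩ | q, t⟩
  · refine ⟨stationaryProb (cycleStarClique m) (.inl i) *
      (r * walkOp (cycleStarClique m) R (.inl i)) * r ^ t, ?_, ?_, fun g => ?_⟩
    · exact mul_nonneg (mul_nonneg (stationaryProb_nonneg _ _)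
        (mul_nonneg hr (walkOp_nonneg hR _))) (pow_nonneg hr t)
    · rw [← mul_assoc]
      exact mul_le_mul_of_nonneg_right (h2 i) (pow_nonneg hr t)
    rw [tsum_eq_single t]
    -- `j = 1`: the pick-up is at the cycle vertex itself and deliveries start one step later, in
    -- round `t + 1`.
    · have key := h.tsum_occupation_le (isPrefixEvent_univ (X g) t) (.inl i) 1 hr hψ hR (by
        intro v
        have := walkOp_mono (G := cycleStarClique m) (f := ψ + r • walkOp (cycleStarClique m) R)
          (g := R) h1 v
        rwa [walkOp_add, walkOp_smul] at this)
      rw [Set.univ_inter, h.real_position hG] at key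
      simp only [hpow, ← mul_assoc, ← Finset.sum_mul, ENNReal.tsum_mul_right]
      have hset : {ω | PicksUp (fun t => X g t ω) (.inl i, t) t} = {ω | X g t ω = .inl i} := by
        ext ω; simp [PicksUp]
      simp only [hset, add_assoc]
      refine (mul_le_mul_left key _).trans (le_of_eq ?_)
      rw [← ENNReal.ofReal_mul' (by positivity)]
      congr 1
      simp only [Function.iterate_one]
      ring
    · intro u hu
      have : {ω | PicksUp (fun t => X g t ω) (.inl i, t) u} = ∅ := by
        ext ω; simp [PicksUp, hu]
      simp [this]
  · refine ⟨1 / (2 * ((cycleStarClique m).edgeFinset.card : ℝ)) *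
      (r / (1 - r) * R (.inl i)) * r ^ t, ?_, ?_, fun g => ?_⟩
    · have := hR (.inl i)
      have h0 : 0 ≤ 1 - r := by linarith
      exact mul_nonneg (mul_nonneg (by positivity) (mul_nonneg (div_nonneg hr h0) this))
        (pow_nonneg hr t)
    · rw [← mul_assoc]
      exact mul_le_mul_of_nonneg_right (h3 i j) (pow_nonneg hr t)
    · set p0 : ℝ := 1 / (2 * ((cycleStarClique m).edgeFinset.card : ℝ))
      have hu : ∀ u, ∑' k, ∑ y, P ({ω | PicksUp (fun t => X g t ω) (.inr (.inl (i, j)), t) u} ∩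
          {ω | X g (u + 1 + k) ω = y}) * ENNReal.ofReal (ψ y * r ^ (u + 1 + k)) ≤
          if t ≤ u then ENNReal.ofReal (p0 * R (.inl i) * r ^ (u + 1)) else 0 := by
        intro u
        split_ifs with htu
        -- `j = 0`: the crossing ends at the cycle vertex in round `u + 1`, and this arrival already
        -- counts as a delivery.
        · have key := h.tsum_occupation_le (t := u + 1)
            (isPrefixEvent_eq (X g) (Nat.le_succ u) (.inr (.inl (i, j)))) (.inl i) 0 hr hψ hR h1
          rw [h.real_crossing hG, if_pos ((adj_l_c _ _ _).2 rfl)] at key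
          simp only [hpow, ← mul_assoc, ← Finset.sum_mul, ENNReal.tsum_mul_right]
          have hset : {ω | PicksUp (fun t => X g t ω) (.inr (.inl (i, j)), t) u} =
              {ω | X g u ω = .inr (.inl (i, j))} ∩ {ω | X g (u + 1) ω = .inl i} := by
            ext ω; simp [PicksUp, htu]
          simp only [hset]
          simp only [zero_add] at key
          refine (mul_le_mul_left key _).trans (le_of_eq ?_)
          rw [← ENNReal.ofReal_mul' (by positivity)]
          rfl
        · have : {ω | PicksUp (fun t => X g t ω) (.inr (.inl (i, j)), t) u} = ∅ := by
            ext ω; simp [PicksUp, htu]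
          simp [this]
      refine (ENNReal.tsum_le_tsum hu).trans ?_
      refine ENNReal.tsum_le_of_sum_range_le fun n => ?_
      have hRi := hR (.inl i)
      have hp0 : 0 ≤ p0 := by positivity
      have hterm : ∀ u, (if t ≤ u then ENNReal.ofReal (p0 * R (.inl i) * r ^ (u + 1)) else 0) =
          ENNReal.ofReal (p0 * R (.inl i) * if t ≤ u then r ^ (u + 1) else 0) := by
        intro u; split_ifs <;> simp
      have hnn : ∀ u, 0 ≤ p0 * R (.inl i) * (if t ≤ u then r ^ (u + 1) else 0) := by
        intro u
        refine mul_nonneg (mul_nonneg hp0 hRi) ?_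
        split_ifs <;> positivity
      simp only [hterm]
      rw [← ENNReal.ofReal_sum_of_nonneg fun u _ => hnn u, ← Finset.mul_sum]
      refine ENNReal.ofReal_le_ofReal ?_
      -- A leaf emits carriers in every round `u ≥ t`; with the discount these rounds add up to a
      -- factor `r / (1 - r)`.
      have hgeom : ∑ u ∈ Finset.range n, (if t ≤ u then r ^ (u + 1) else 0) ≤
          r / (1 - r) * r ^ t := by
        rw [div_mul_eq_mul_div, le_div_iff₀ (by linarith)]
        have : ∀ n, (∑ u ∈ Finset.range n, (if t ≤ u then r ^ (u + 1) else 0)) * (1 - r) +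
            r ^ (max n t + 1) ≤ r * r ^ t := by
          intro n
          induction n with
          | zero => simp [pow_succ, mul_comm]
          | succ n ih =>
            rw [Finset.sum_range_succ]
            split_ifs with htn
            · rw [max_eq_left htn] at ih
              rw [max_eq_left (by omega)]
              have : r ^ (n + 1) * (1 - r) + r ^ (n + 1 + 1) = r ^ (n + 1) := by ring
              linarith
            · rw [max_eq_right (by omega)] at ih ⊢
              linarith
        have h4 := this n
        have h5 : 0 ≤ r ^ (max n t + 1) := by positivity
        linarith
      calc _ ≤ p0 * R (.inl i) * (r / (1 - r) * r ^ t) :=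
            mul_le_mul_of_nonneg_left hgeom (mul_nonneg hp0 hRi)
        _ = _ := by ring
  · refine ⟨0, le_rfl, ?_, fun g => ?_⟩
    · simpa using mul_nonneg (hψ (.inr (.inr q))) (pow_nonneg hr t)
    · simp [PicksUp]

end Carriers

/-! ### An explicit supersolution growing along the cycle -/

section MeetExchange

variable {m : ℕ}

/-- The distance of two vertices of the cycle. -/
def cycleDist (i₀ i : Fin m) : ℕ :=
  min (max i.val i₀.val - min i.val i₀.val) (m - (max i.val i₀.val - min i.val i₀.val))

theorem cycleDist_self (i : Fin m) : cycleDist i i = 0 := by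
  simp [cycleDist]

/-- Adjacency with the wrap-around made explicit, so that distances on the cycle become linear
arithmetic. -/
theorem cycleGraph_adj_val {i i' : Fin m} (h : (SimpleGraph.cycleGraph m).Adj i i') :
    i'.val = i.val + 1 ∨ i.val = i'.val + 1 ∨ i.val + 1 = i'.val + m ∨ i'.val + 1 = i.val + m := by
  rw [SimpleGraph.cycleGraph_adj'] at h
  have h1 := i.isLt
  have h2 := i'.isLt
  rw [Fin.sub_def, Fin.sub_def] at h
  simp only at h
  rcases h with h | h
  · rcases Nat.lt_or_ge (m - i'.val + i.val) m with h3 | h3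
    · rw [Nat.mod_eq_of_lt h3] at h; omega
    · rw [Nat.mod_eq_sub_mod h3, Nat.mod_eq_of_lt (by omega)] at h; omega
  · rcases Nat.lt_or_ge (m - i.val + i'.val) m with h3 | h3
    · rw [Nat.mod_eq_of_lt h3] at h; omega
    · rw [Nat.mod_eq_sub_mod h3, Nat.mod_eq_of_lt (by omega)] at h; omega

theorem cycleDist_le_of_adj {i₀ i i' : Fin m} (h : (SimpleGraph.cycleGraph m).Adj i i') :
    cycleDist i₀ i' ≤ cycleDist i₀ i + 1 := by
  have h1 := i.isLt
  have h2 := i'.isLt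
  have h3 := i₀.isLt
  have := cycleGraph_adj_val h
  unfold cycleDist
  omega

/-- The offsets `m / 4 + k` with `k < m / 2` stay at least `m / 4` away from `i₀` in both
directions. -/
theorem card_far_ge (i₀ : Fin m) :
    m / 2 ≤ (Finset.univ.filter fun i => m / 4 ≤ cycleDist i₀ i).card := by
  have hm : 0 < m := i₀.pos
  let f : ℕ → Fin m := fun k => ⟨(i₀.val + m / 4 + k) % m, Nat.mod_lt _ hm⟩
  have h0 := i₀.isLt
  have hf : ∀ k < m / 2, (f k).val = i₀.val + m / 4 + k ∨ (f k).val + m = i₀.val + m / 4 + k := by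
    intro k hk
    simp only [f]
    rcases Nat.lt_or_ge (i₀.val + m / 4 + k) m with h | h
    · rw [Nat.mod_eq_of_lt h]; omega
    · rw [Nat.mod_eq_sub_mod h, Nat.mod_eq_of_lt (by omega)]; omega
  rw [← Finset.card_range (m / 2)]
  refine Finset.card_le_card_of_injOn f ?_ ?_
  · intro k hk
    have hk' : k < m / 2 := by simpa using hk
    have := hf k hk'
    have := (f k).isLt
    refine Finset.mem_coe.2 (Finset.mem_filter.2 ⟨Finset.mem_univ _, ?_⟩)
    unfold cycleDist
    omega
  · intro k hk k' hk' heq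
    have h1 := hf k (by simpa using hk)
    have h2 := hf k' (by simpa using hk')
    rw [heq] at h1
    have : k < m / 2 := by simpa using hk
    have : k' < m / 2 := by simpa using hk'
    omega

/-- The weights of the states of chains, growing with the distance from the source. -/
noncomputable def chainWeight (i₀ : Fin m) (θ w : ℝ) : CycleStarCliqueVertex m → ℝ
  | .inl i => w * θ ^ cycleDist i₀ i
  | .inr (.inl (i, _)) => θ ^ cycleDist i₀ i
  | .inr (.inr _) => 0

/-- A supersolution for the discounted occupation sums of `chainWeight`. -/
noncomputable def chainPotential (i₀ : Fin m) (θ ρ lam : ℝ) : CycleStarCliqueVertex m → ℝ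
  | .inl i => ρ * θ ^ cycleDist i₀ i
  | .inr (.inl (i, _)) => 4 * θ ^ cycleDist i₀ i
  | .inr (.inr (i, _, _)) => 4 / lam * θ ^ cycleDist i₀ i

/-- A cycle neighbour may cost an extra factor `θ`, but only two of the `m + 2` neighbours are on
the cycle: by `2 * θ * ρ ≤ m` they contribute at most `1`, and the leaves at most `4`. -/
theorem walkOp_chainPotential_c (hm : 3 ≤ m) (i₀ i : Fin m) {θ ρ lam : ℝ} (hθ : 1 ≤ θ)
    (hρ : 0 ≤ ρ) (hθρ : 2 * θ * ρ ≤ m) :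
    walkOp (cycleStarClique m) (chainPotential i₀ θ ρ lam) (.inl i) ≤
      5 * θ ^ cycleDist i₀ i := by
  have hD : 0 < θ ^ cycleDist i₀ i := by positivity
  refine (walkOp_c_le hm _ i (a := ρ * (θ * θ ^ cycleDist i₀ i)) fun i' h => ?_).trans ?_
  · rw [← pow_succ']
    exact mul_le_mul_of_nonneg_left (pow_le_pow_right₀ hθ (cycleDist_le_of_adj h)) hρ
  · simp only [chainPotential, Finset.sum_const, Finset.card_univ, Fintype.card_fin, nsmul_eq_mul]
    rw [div_le_iff₀ (by positivity)]
    nlinarith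

/-- In units of `θ ^ dist` the inequalities are `w + 5 ≤ ρ` on the cycle and `1 + 3 ≤ 4` at a leaf.
Inside a clique the walk finds the leaf with probability `1 / m` per step and is discounted at rate
`lam / m`, whence the value `4 / lam`, a fraction `1 / lam` of the value at the leaf. -/
theorem chainPotential_supersolution (hm : 3 ≤ m) (i₀ : Fin m) {θ w ρ lam : ℝ} (hθ : 1 ≤ θ)
    (hw : 0 ≤ w) (hρ : ρ = 2 * w + 8) (hθρ : 2 * θ * ρ ≤ m) (hlam : 2 ≤ lam) (hlm : lam ≤ m)
    (v : CycleStarCliqueVertex m) :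
    chainWeight i₀ θ w v + (1 - lam / m) *
      walkOp (cycleStarClique m) (chainPotential i₀ θ ρ lam) v ≤ chainPotential i₀ θ ρ lam v := by
  have hm0 : (0 : ℝ) < m := by exact_mod_cast (by omega : 0 < m)
  have hr0 : 0 ≤ 1 - lam / m := by rw [sub_nonneg, div_le_one hm0]; exact hlm
  have hr1 : 1 - lam / m ≤ 1 := by have : 0 ≤ lam / m := by positivity
                                   linarith
  rcases v with i | ⟨i, j⟩ | ⟨i, j, k⟩
  · have h1 := walkOp_chainPotential_c hm i₀ i (lam := lam) hθ (by linarith) hθρ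
    have hD : 0 < θ ^ cycleDist i₀ i := by positivity
    have h2 : (1 - lam / m) * walkOp (cycleStarClique m) (chainPotential i₀ θ ρ lam) (.inl i) ≤
        1 * (5 * θ ^ cycleDist i₀ i) :=
      mul_le_mul hr1 h1 (walkOp_nonneg (by
        rintro (i | ⟨i, j⟩ | ⟨i, j, k⟩) <;> simp only [chainPotential, Pi.zero_apply] <;>
          (have : 0 ≤ ρ := by linarith) <;> positivity) _) zero_le_one
    simp only [chainWeight, chainPotential] at h2 ⊢
    nlinarith
  · have hD : 0 < θ ^ cycleDist i₀ i := by positivity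
    rw [walkOp_l]
    simp only [chainWeight, chainPotential, Finset.sum_const, Finset.card_univ, Fintype.card_fin,
      nsmul_eq_mul]
    have h4 : 4 / lam ≤ 2 := by rw [div_le_iff₀ (by linarith)]; linarith
    have hρm : ρ ≤ m := by nlinarith
    have h5 : (ρ * θ ^ cycleDist i₀ i + m * (4 / lam * θ ^ cycleDist i₀ i)) / (m + 1) ≤
        3 * θ ^ cycleDist i₀ i := by
      rw [div_le_iff₀ (by positivity)]
      have : m * (4 / lam * θ ^ cycleDist i₀ i) ≤ m * (2 * θ ^ cycleDist i₀ i) := by gcongr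
      nlinarith
    have h6 : 0 ≤ (ρ * θ ^ cycleDist i₀ i + m * (4 / lam * θ ^ cycleDist i₀ i)) / (m + 1) := by
      have : 0 ≤ ρ := by linarith
      positivity
    have := mul_le_mul hr1 h5 h6 zero_le_one
    linarith
  · have hD : 0 < θ ^ cycleDist i₀ i := by positivity
    rw [walkOp_q]
    simp only [chainWeight, chainPotential, Finset.sum_const, Finset.card_univ, Fintype.card_fin,
      nsmul_eq_mul]
    have hl0 : 0 < lam := by linarith
    have : (1 - lam / m) * ((4 * θ ^ cycleDist i₀ i + (m * (4 / lam * θ ^ cycleDist i₀ i) -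
        4 / lam * θ ^ cycleDist i₀ i)) / m) =
        4 / lam * θ ^ cycleDist i₀ i * (((m - lam) * (lam + m - 1)) / m ^ 2) := by
      field_simp; ring
    rw [this, zero_add]
    refine mul_le_of_le_one_right (by positivity) ?_
    -- The numerator is `m ^ 2 - m - lam * (lam - 1)`.
    rw [div_le_one (by positivity)]
    nlinarith

variable {A : ℕ} {Ω : Type*} [MeasurableSpace Ω] {P : Measure Ω} [IsProbabilityMeasure P]
  {X : Fin A → ℕ → Ω → CycleStarCliqueVertex m}

/-- The constants balance as follows. At a cycle vertex there are on average at most `4 * b` agents,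
each worth at most `5`, and `20 * b ≤ w`. A leaf emits at most `8 * b / m` agents per round over an
effective horizon `m / lam`, each worth `ρ`, and `8 * b * ρ ≤ lam`. -/
theorem sum_tsum_carries_chainWeight_le (h : IsStationaryWalkSystem (cycleStarClique m) P X)
    (hm : 3 ≤ m) (i₀ : Fin m) {b θ w ρ lam : ℝ} (hb : 0 < b) (hA : (A : ℝ) ≤ b * (m + 1) ^ 3)
    (hθ : 1 ≤ θ) (hw : w = 20 * b + 1) (hρ : ρ = 2 * w + 8) (hθρ : 2 * θ * ρ ≤ m)
    (hlam : lam = 8 * b * ρ + 2) (hlm : lam ≤ m) (a : CycleStarCliqueVertex m × ℕ) :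
    ∑ g, ∑' b, P {ω | Carries (fun t => X g t ω) a b} *
        ENNReal.ofReal (chainWeight i₀ θ w b.1 * (1 - lam / m) ^ b.2) ≤
      ENNReal.ofReal (chainWeight i₀ θ w a.1 * (1 - lam / m) ^ a.2) := by
  have hm3 : (3 : ℝ) ≤ m := by exact_mod_cast hm
  have hm0 : (0 : ℝ) < m := by linarith
  have hw0 : 0 < w := by linarith
  have hρ0 : 0 < ρ := by linarith
  have hl2 : 2 ≤ lam := by have : 0 < 8 * b * ρ := by positivity
                           linarith
  have hl0 : 0 < lam := by linarith
  have hr0 : 0 ≤ 1 - lam / m := by rw [sub_nonneg, div_le_one hm0]; exact hlm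
  have hr1 : 1 - lam / m < 1 := by have : 0 < lam / m := by positivity
                                   linarith
  have hE := le_two_mul_card_edges hm
  set E : ℝ := 2 * ((cycleStarClique m).edgeFinset.card : ℝ) with hEdef
  have hE0 : 0 < E := lt_of_lt_of_le (by positivity) hE
  have hR : 0 ≤ chainPotential i₀ θ ρ lam := by
    rintro (i | ⟨i, j⟩ | ⟨i, j, k⟩) <;> simp only [chainPotential, Pi.zero_apply] <;> positivity
  refine sum_tsum_carries_le h hm ?_ hR hr0 hr1
    (chainPotential_supersolution hm i₀ hθ hw0.le hρ hθρ hl2 hlm) ?_ ?_ a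
  · rintro (i | ⟨i, j⟩ | ⟨i, j, k⟩) <;> simp only [chainWeight, Pi.zero_apply] <;> positivity
  · intro i
    have hD : 0 < θ ^ cycleDist i₀ i := by positivity
    have h1 := walkOp_chainPotential_c hm i₀ i (lam := lam) hθ hρ0.le hθρ
    have h2 : (1 - lam / m) * walkOp (cycleStarClique m) (chainPotential i₀ θ ρ lam) (.inl i) ≤
        1 * (5 * θ ^ cycleDist i₀ i) := mul_le_mul hr1.le h1 (walkOp_nonneg hR _) zero_le_one
    have h3 : A * stationaryProb (cycleStarClique m) (.inl i) ≤ 4 * b := by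
      rw [stationaryProb, degree_c hm, ← hEdef, mul_div_assoc', div_le_iff₀ hE0]
      have h4 : (A : ℝ) * (m + 2) ≤ b * (m + 1) ^ 3 * (m + 2) := by gcongr
      have h5 : ((m : ℝ) + 1) ^ 3 * (m + 2) ≤ 4 * m ^ 4 := by
        have h51 : (m : ℝ) + 1 ≤ 4 / 3 * m := by linarith
        have h52 : (m : ℝ) + 2 ≤ 5 / 3 * m := by linarith
        calc ((m : ℝ) + 1) ^ 3 * (m + 2) ≤ (4 / 3 * m) ^ 3 * (5 / 3 * m) := by gcongr
          _ = 320 / 81 * (m : ℝ) ^ 4 := by ring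
          _ ≤ 4 * m ^ 4 := by gcongr; norm_num
      nlinarith
    rw [Fintype.card_fin, ← mul_assoc]
    calc _ ≤ 4 * b * (1 * (5 * θ ^ cycleDist i₀ i)) :=
          mul_le_mul h3 h2 (mul_nonneg hr0 (walkOp_nonneg hR _)) (by positivity)
      _ ≤ _ := by simp only [chainWeight]; nlinarith
  · intro i j
    have hD : 0 < θ ^ cycleDist i₀ i := by positivity
    have h1 : (1 - lam / m) / (1 - (1 - lam / m)) ≤ m / lam := by
      rw [sub_sub_cancel, div_div_eq_mul_div]
      gcongr
      nlinarith
    have h3 : A * (1 / E) ≤ 8 * b / m := by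
      rw [mul_one_div, div_le_div_iff₀ hE0 hm0]
      have h5 : ((m : ℝ) + 1) ^ 3 * (m : ℝ) ≤ 8 * (m : ℝ) ^ 4 := by
        have h51 : (m : ℝ) + 1 ≤ 2 * m := by linarith
        calc ((m : ℝ) + 1) ^ 3 * (m : ℝ) ≤ (2 * (m : ℝ)) ^ 3 * (m : ℝ) := by gcongr
          _ = 8 * (m : ℝ) ^ 4 := by ring
      nlinarith
    rw [Fintype.card_fin, ← mul_assoc]
    simp only [chainPotential, chainWeight]
    calc _ ≤ 8 * b / m * (m / lam * (ρ * θ ^ cycleDist i₀ i)) := by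
          gcongr
      _ = (8 * b * ρ) / lam * θ ^ cycleDist i₀ i := by field_simp
      _ ≤ 1 * θ ^ cycleDist i₀ i := by
          gcongr
          rw [div_le_one hl0]; linarith
      _ = _ := one_mul _

end MeetExchange

/-! ### Chains rarely reach far stars; lower bound for meet-exchange -/

section MeetLowerBound

/-- The chain argument is pathwise and needs genuine walks; the law excludes illegal steps only up
to null sets, of which there are countably many. -/
theorem IsStationaryWalkSystem.ae_adj {V ι Ω : Type*} [Fintype V] {G : SimpleGraph V}
    [DecidableRel G.Adj] [MeasurableSpace Ω] {P : Measure Ω} [IsProbabilityMeasure P]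
    [Countable ι] {X : ι → ℕ → Ω → V} (h : IsStationaryWalkSystem G P X)
    (hG : ∀ v, 0 < G.degree v) : ∀ᵐ ω ∂P, ∀ g t, G.Adj (X g t ω) (X g (t + 1) ω) := by
  have : ∀ᵐ ω ∂P, ∀ g t u v, ¬ G.Adj u v → ¬ (X g t ω = u ∧ X g (t + 1) ω = v) := by
    simp only [ae_all_iff]
    intro g t u v huv
    have h1 := h.real_crossing hG g t u v
    rw [if_neg huv, measureReal_eq_zero_iff] at h1
    rw [ae_iff]
    simp only [not_not]
    exact h1
  filter_upwards [this] with ω hω g t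
  by_contra hn
  exact hω g t _ _ hn ⟨rfl, rfl⟩

variable {m : ℕ}

/-- The index of the star that contains a vertex. -/
def starIndex : CycleStarCliqueVertex m → Fin m
  | .inl i => i
  | .inr (.inl (i, _)) => i
  | .inr (.inr (i, _, _)) => i

theorem meetState_mono {V ι : Type*} (s : V) (x : ι → ℕ → V) {t t' : ℕ} (h : t ≤ t') :
    meetState s x t ⊆ meetState s x t' := by
  induction h with
  | refl => exact subset_rfl
  | step _ ih => exact ih.trans fun g hg => Or.inl (Or.inl hg)

/-- The states of cliques in stars far from `i₀`, up to round `T`. -/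
def farStates (i₀ : Fin m) (T : ℕ) : Set (CycleStarCliqueVertex m × ℕ) :=
  {a | ∃ i j, a.1 = .inr (.inl (i, j)) ∧ m / 4 ≤ cycleDist i₀ i ∧ a.2 ≤ T}

variable {A : ℕ} {Ω : Type*} [MeasurableSpace Ω] {P : Measure Ω} [IsProbabilityMeasure P]
  {X : Fin A → ℕ → Ω → CycleStarCliqueVertex m}

/-- The supersolution is at least the prefactor on far states and `1` at a clique source. A source
on the cycle has a start in each round, and the discounted sum of these is `w * m / lam ≤ w * m`. -/
theorem mul_measure_reach_far_le (h : IsStationaryWalkSystem (cycleStarClique m) P X)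
    (hm : 3 ≤ m) (s : CycleStarCliqueVertex m) {b θ w ρ lam : ℝ} (hb : 0 < b)
    (hA : (A : ℝ) ≤ b * (m + 1) ^ 3)
    (hθ : 1 ≤ θ) (hw : w = 20 * b + 1) (hρ : ρ = 2 * w + 8) (hθρ : 2 * θ * ρ ≤ m)
    (hlam : lam = 8 * b * ρ + 2) (hlm : lam ≤ m) (T : ℕ) :
    ENNReal.ofReal (θ ^ (m / 4) * (1 - lam / m) ^ T) *
      P {ω | ∃ a ∈ initialStates s, ∃ c ∈ farStates (starIndex s) T,
        Chain (fun g t => X g t ω) ∅ a c} ≤ ENNReal.ofReal (w * m) := by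
  have hm3 : (3 : ℝ) ≤ m := by exact_mod_cast hm
  have hm0 : (0 : ℝ) < m := by linarith
  have hw0 : 1 ≤ w := by linarith
  have hρ0 : 0 < ρ := by linarith
  have hl2 : 2 ≤ lam := by have : 0 < 8 * b * ρ := by positivity
                           linarith
  have hl0 : 0 < lam := by linarith
  have hr0 : 0 ≤ 1 - lam / m := by rw [sub_nonneg, div_le_one hm0]; exact hlm
  have hr1 : 1 - lam / m < 1 := by have : 0 < lam / m := by positivity
                                   linarith
  have key : ∀ a, ENNReal.ofReal (θ ^ (m / 4) * (1 - lam / m) ^ T) *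
      P {ω | ∃ c ∈ farStates (starIndex s) T, Chain (fun g t => X g t ω) ∅ a c} ≤
        ENNReal.ofReal (chainWeight (starIndex s) θ w a.1 * (1 - lam / m) ^ a.2) := by
    intro a
    have := mul_measure_chain_le h.indep (T := farStates (starIndex s) T)
      (κ := ENNReal.ofReal (θ ^ (m / 4) * (1 - lam / m) ^ T)) ?_
      (sum_tsum_carries_chainWeight_le h hm (starIndex s) hb hA hθ hw hρ hθρ hlam hlm) ∅
      (fun _ => Set.univ) (by simp) a
    · simpa using this
    · rintro ⟨v, t⟩ ⟨i, j, hv, hi, ht⟩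
      simp only at hv ht
      subst hv
      refine ENNReal.ofReal_le_ofReal ?_
      simp only [chainWeight]
      exact mul_le_mul (pow_le_pow_right₀ hθ hi) (pow_le_pow_of_le_one hr0 hr1.le ht)
        (by positivity) (by positivity)
  have hcell : ∀ i j, starIndex s = i → initialStates s = {(.inr (.inl (i, j)), 0)} →
      ENNReal.ofReal (θ ^ (m / 4) * (1 - lam / m) ^ T) *
      P {ω | ∃ a ∈ initialStates s, ∃ c ∈ farStates (starIndex s) T,
        Chain (fun g t => X g t ω) ∅ a c} ≤ ENNReal.ofReal (w * m) := by
    intro i j hi hs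
    have h1 := key (.inr (.inl (i, j)), 0)
    rw [hs]
    simp only [Set.mem_singleton_iff, exists_eq_left]
    refine h1.trans (ENNReal.ofReal_le_ofReal ?_)
    simp only [chainWeight, hi, cycleDist_self, pow_zero, mul_one]
    nlinarith
  rcases s with i | ⟨i, j⟩ | ⟨i, j, k⟩
  · have hsub : {ω | ∃ a ∈ initialStates (.inl i), ∃ c ∈ farStates (starIndex (.inl i)) T,
        Chain (fun g t => X g t ω) ∅ a c} ⊆
        ⋃ t : ℕ, {ω | ∃ c ∈ farStates (starIndex (.inl i)) T,
          Chain (fun g t => X g t ω) ∅ (.inl i, t) c} := by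
      rintro ω ⟨⟨v, t⟩, ha, hc⟩
      have hv : v = .inl i := ha
      subst hv
      exact Set.mem_iUnion.2 ⟨t, hc⟩
    refine (mul_le_mul_right ((measure_mono hsub).trans (measure_iUnion_le _)) _).trans ?_
    rw [← ENNReal.tsum_mul_left]
    refine (ENNReal.tsum_le_tsum fun t => key (.inl i, t)).trans ?_
    simp only [chainWeight, starIndex, cycleDist_self, pow_zero, mul_one]
    have hs : Summable fun t : ℕ => w * (1 - lam / m) ^ t :=
      (summable_geometric_of_lt_one hr0 hr1).mul_left w
    rw [← ENNReal.ofReal_tsum_of_nonneg (fun t => by positivity) hs, tsum_mul_left,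
      tsum_geometric_of_lt_one hr0 hr1, sub_sub_cancel, inv_div]
    refine ENNReal.ofReal_le_ofReal ?_
    have : m / lam ≤ m := div_le_self hm0.le (by linarith)
    gcongr
  · exact hcell i j rfl rfl
  · exact hcell i j rfl rfl

/-- At least `m / 3` stars are far, each with `m ^ 2` clique vertices of degree `m`, and `2|E| ≤ 2 *
m ^ 4`. -/
theorem real_far_ge (h : IsStationaryWalkSystem (cycleStarClique m) P X) (hm : 3 ≤ m)
    (i₀ : Fin m) (g : Fin A) (T : ℕ) :
    1 / 6 ≤ P.real {ω | ∃ i j k, m / 4 ≤ cycleDist i₀ i ∧ X g T ω = .inr (.inr (i, j, k))} := by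
  have hG := degree_pos hm
  let F : Finset (Fin m) := Finset.univ.filter fun i => m / 4 ≤ cycleDist i₀ i
  have hset : {ω | ∃ i j k, m / 4 ≤ cycleDist i₀ i ∧ X g T ω = .inr (.inr (i, j, k))} =
      ⋃ p ∈ F ×ˢ (Finset.univ : Finset (Fin m × Fin m)),
        {ω | X g T ω = .inr (.inr (p.1, p.2.1, p.2.2))} := by
    ext ω
    simp [F]
  rw [hset, measureReal_biUnion_finset _ fun p _ => h.measurable_fiber g T _]
  · simp only [h.real_position hG, stationaryProb, degree_q]
    rw [Finset.sum_const, Finset.card_product, Finset.card_univ, Fintype.card_prod,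
      Fintype.card_fin, nsmul_eq_mul]
    have hF : m / 2 ≤ F.card := card_far_ge i₀
    have hF' : (m : ℝ) ≤ 3 * F.card := by exact_mod_cast (by omega : m ≤ 3 * F.card)
    have hE := two_mul_card_edges_le hm
    have hE' := le_two_mul_card_edges hm
    have hm0 : (0 : ℝ) < m := by exact_mod_cast (by omega : 0 < m)
    have hE0 : 0 < 2 * ((cycleStarClique m).edgeFinset.card : ℝ) :=
      lt_of_lt_of_le (by positivity) hE'
    rw [mul_div_assoc', div_le_div_iff₀ (by norm_num) hE0]
    push_cast
    have : (m : ℝ) * (m * m * m) ≤ 3 * F.card * (m * m * m) := by gcongr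
    nlinarith
  · rintro ⟨i, j, k⟩ _ ⟨i', j', k'⟩ _ hne
    rw [Function.onFun, Set.disjoint_left]
    intro ω h1 h2
    apply hne
    have := h1.symm.trans h2
    simpa using this

/-- Meet-exchange is slow as soon as chains are unlikely to reach far stars. -/
theorem meetTime_lintegral_ge (h : IsStationaryWalkSystem (cycleStarClique m) P X) (hm : 3 ≤ m)
    (hA : 0 < A) (s : CycleStarCliqueVertex m) (T : ℕ)
    (hP : P {ω | ∃ a ∈ initialStates s, ∃ c ∈ farStates (starIndex s) T,
        Chain (fun g t => X g t ω) ∅ a c} ≤ ENNReal.ofReal (1 / 24)) :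
    ENNReal.ofReal (T / 8) ≤ ∫⁻ ω, meetTime s (fun g t => X g t ω) ∂P := by
  set E := {ω | ∃ a ∈ initialStates s, ∃ c ∈ farStates (starIndex s) T,
        Chain (fun g t => X g t ω) ∅ a c}
  let g₀ : Fin A := ⟨0, hA⟩
  set F := {ω | ∃ i j k, m / 4 ≤ cycleDist (starIndex s) i ∧ X g₀ T ω = .inr (.inr (i, j, k))}
    with hFdef
  have hFm : MeasurableSet F := by
    refine h.measurableSet_of_prefix (g := g₀) (t := T) ?_
    rintro ω ω' hω ⟨i, j, k, hi, hX⟩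
    exact ⟨i, j, k, hi, (hω T le_rfl).symm.trans hX⟩
  set N := {ω | ¬ ∀ g t, (cycleStarClique m).Adj (X g t ω) (X g (t + 1) ω)}
  have hN : P N = 0 := h.ae_adj (degree_pos hm)
  -- The chain event is not known to be measurable, so a measurable hull is removed. What remains
  -- has probability at least `1 / 6 - 1 / 24 = 1 / 8`.
  set W := F \ toMeasurable P (E ∪ N) with hW
  have hWm : MeasurableSet W := hFm.diff (measurableSet_toMeasurable _ _)
  have hWT : ∀ ω ∈ W, (T : ℝ≥0∞) ≤ meetTime s (fun g t => X g t ω) := by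
    rintro ω ⟨⟨i, j, k, hi, hX⟩, hω⟩
    have hω' : ω ∉ E ∪ N := fun h' => hω (subset_toMeasurable _ _ h')
    have hE : ω ∉ E := fun h' => hω' (Or.inl h')
    have hadj : ∀ g t, (cycleStarClique m).Adj (X g t ω) (X g (t + 1) ω) := by
      by_contra h'; exact hω' (Or.inr h')
    refine le_iInf₂ fun t ht => ?_
    by_contra hlt
    have htT : t ≤ T := by
      have : (t : ℝ≥0∞) < T := not_le.1 hlt
      exact le_of_lt (by exact_mod_cast this)
    have hg : g₀ ∈ meetState s (fun g t => X g t ω) T :=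
      meetState_mono s _ htT (ht ▸ Set.mem_univ _)
    -- For an agent on a clique vertex, this yields a chain that has reached its leaf by round `T`,
    -- which is a far state.
    have hr := reached_of_mem_meetState hadj T g₀ hg
    rw [show X g₀ T ω = .inr (.inr (i, j, k)) from hX] at hr
    obtain ⟨t', ht', a, ha, hch⟩ := hr
    exact hE ⟨a, ha, _, ⟨i, j, rfl, hi, ht'⟩, hch⟩
  have hPW : ENNReal.ofReal (1 / 8) ≤ P W := by
    have h1 : P (toMeasurable P (E ∪ N)) ≤ ENNReal.ofReal (1 / 24) := by
      rw [measure_toMeasurable]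
      refine (measure_union_le _ _).trans ?_
      rw [hN, add_zero]
      exact hP
    have h2 : ENNReal.ofReal (1 / 6) ≤ P F := by
      rw [← ofReal_measureReal]
      exact ENNReal.ofReal_le_ofReal (real_far_ge h hm (starIndex s) g₀ T)
    calc ENNReal.ofReal (1 / 8) = ENNReal.ofReal (1 / 6) - ENNReal.ofReal (1 / 24) := by
          rw [← ENNReal.ofReal_sub _ (by norm_num)]; norm_num
      _ ≤ P F - P (toMeasurable P (E ∪ N)) := tsub_le_tsub h2 h1
      _ ≤ P W := le_measure_sdiff
  calc ENNReal.ofReal (T / 8) = T * ENNReal.ofReal (1 / 8) := by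
        rw [div_eq_mul_one_div, ENNReal.ofReal_mul (Nat.cast_nonneg _), ENNReal.ofReal_natCast]
    _ ≤ T * P W := by gcongr
    _ = ∫⁻ _ in W, T ∂P := by rw [setLIntegral_const]
    _ ≤ ∫⁻ ω in W, meetTime s (fun g t => X g t ω) ∂P := setLIntegral_mono' hWm hWT
    _ ≤ _ := setLIntegral_le_lintegral _ _

/-- From `(1 - x) * (1 + 2 * x) = 1 + x * (1 - 2 * x) ≥ 1`. -/
theorem exp_neg_two_mul_le {x : ℝ} (h0 : 0 ≤ x) (h1 : x ≤ 1 / 2) : Real.exp (-(2 * x)) ≤ 1 - x := by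
  have h2 : Real.exp (-(2 * x)) * Real.exp (2 * x) = 1 := by rw [← Real.exp_add]; simp
  have h3 := Real.add_one_le_exp (2 * x)
  have h4 : 1 ≤ (1 - x) * Real.exp (2 * x) := by nlinarith
  have h5 := Real.exp_pos (2 * x)
  by_contra hlt
  nlinarith

/-- With `θ = √m` the weight at distance `m / 4` is about `exp (m log m / 8)`, whereas the discount
up to `T` costs at most `exp (m log m / 16)`. The quotient exceeds `m ^ 2` (here `40 ≤ m` absorbs
the rounding of `m / 4`), which leaves `w * m / m ^ 2 ≤ 1 / 24`. -/
theorem reach_far_small (h : IsStationaryWalkSystem (cycleStarClique m) P X)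
    (s : CycleStarCliqueVertex m) {b w ρ lam : ℝ} (hb : 0 < b)
    (hA : (A : ℝ) ≤ b * (m + 1) ^ 3) (hw : w = 20 * b + 1) (hρ : ρ = 2 * w + 8)
    (hlam : lam = 8 * b * ρ + 2) (hm : 40 ≤ m) (hmw : 24 * w ≤ m) (hmρ : 4 * ρ ^ 2 ≤ m)
    (hml : 2 * lam ≤ m) (T : ℕ) (hT : (T : ℝ) ≤ m ^ 2 * Real.log m / (32 * lam)) :
    P {ω | ∃ a ∈ initialStates s, ∃ c ∈ farStates (starIndex s) T,
        Chain (fun g t => X g t ω) ∅ a c} ≤ ENNReal.ofReal (1 / 24) := by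
  have hm40 : (40 : ℝ) ≤ m := by exact_mod_cast hm
  have hm0 : (0 : ℝ) < m := by linarith
  have hρ0 : 0 < ρ := by linarith
  have hl2 : 2 ≤ lam := by have : 0 < 8 * b * ρ := by positivity
                           linarith
  have hθ : 1 ≤ √(m : ℝ) := by rw [Real.one_le_sqrt]; linarith
  have hsq : √(m : ℝ) * √(m : ℝ) = m := Real.mul_self_sqrt hm0.le
  have h2ρ : 2 * ρ ≤ √(m : ℝ) := by
    apply Real.le_sqrt_of_sq_le; nlinarith
  have key := mul_measure_reach_far_le h (by omega) s hb hA hθ hw hρ (by nlinarith) hlam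
    (by linarith) T
  set p := P {ω | ∃ a ∈ initialStates s, ∃ c ∈ farStates (starIndex s) T,
        Chain (fun g t => X g t ω) ∅ a c}
  have hlog : 0 ≤ Real.log m := Real.log_nonneg (by linarith)
  have hx : lam / m ≤ 1 / 2 := by rw [div_le_iff₀ hm0]; linarith
  have hκ : (m : ℝ) ^ 2 ≤ √(m : ℝ) ^ (m / 4) * (1 - lam / m) ^ T := by
    have e1 : Real.exp (-(m * Real.log m / 16)) ≤ (1 - lam / m) ^ T := by
      calc _ ≤ Real.exp (T * -(2 * (lam / m))) := by
            apply Real.exp_le_exp.2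
            have : (T : ℝ) * (2 * (lam / m)) ≤
                m ^ 2 * Real.log m / (32 * lam) * (2 * (lam / m)) := by gcongr
            have e : m ^ 2 * Real.log m / (32 * lam) * (2 * (lam / m)) =
                m * Real.log m / 16 := by field_simp; ring
            linarith
        _ = Real.exp (-(2 * (lam / m))) ^ T := Real.exp_nat_mul _ _
        _ ≤ _ := by
          gcongr
          exact exp_neg_two_mul_le (by positivity) hx
    have e2 : √(m : ℝ) ^ (m / 4) = Real.exp ((m / 4 : ℕ) * (Real.log m / 2)) := by
      rw [Real.exp_nat_mul]
      congr 1
      rw [Real.sqrt_eq_rpow, Real.rpow_def_of_pos hm0]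
      ring_nf
    have e3 : (m : ℝ) ^ 2 = Real.exp (2 * Real.log m) := by
      have := Real.exp_nat_mul (Real.log m) 2
      rw [Real.exp_log hm0] at this
      exact_mod_cast this.symm
    have e4 : (m : ℝ) / 4 - 1 ≤ (m / 4 : ℕ) := by
      have : m ≤ 4 * (m / 4) + 3 := by omega
      have : (m : ℝ) ≤ 4 * (m / 4 : ℕ) + 3 := by exact_mod_cast this
      linarith
    calc (m : ℝ) ^ 2 ≤ Real.exp ((m / 4 : ℕ) * (Real.log m / 2)) *
          Real.exp (-(m * Real.log m / 16)) := by
          rw [e3, ← Real.exp_add]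
          apply Real.exp_le_exp.2
          have : ((m : ℝ) / 4 - 1) * (Real.log m / 2) ≤ (m / 4 : ℕ) * (Real.log m / 2) := by
            gcongr
          nlinarith
      _ ≤ _ := by rw [e2]; gcongr
  have h1 : ENNReal.ofReal ((m : ℝ) ^ 2) * p ≤ ENNReal.ofReal ((m : ℝ) ^ 2) *
      ENNReal.ofReal (1 / 24) := by
    refine (mul_le_mul_left (ENNReal.ofReal_le_ofReal hκ) p).trans (key.trans ?_)
    rw [← ENNReal.ofReal_mul (by positivity)]
    apply ENNReal.ofReal_le_ofReal
    nlinarith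
  refine (ENNReal.mul_le_mul_iff_right ?_ ENNReal.ofReal_ne_top).1 h1
  simp only [ne_eq, ENNReal.ofReal_eq_zero, not_le]
  positivity

end MeetLowerBound

/-- The lower bound for meet-exchange. -/
theorem exists_meetTime_lower_bound {b : ℝ} (hb : 0 < b) :
    ∃ c : ℝ, 0 < c ∧ ∃ M : ℕ, ∀ n m A : ℕ, M ≤ m → n < (m + 1) ^ 3 → 0 < n → 0 < A →
      (A : ℝ) ≤ b * n →
      ∀ (Ω : Type*) [MeasurableSpace Ω] (P : Measure Ω) [IsProbabilityMeasure P]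
        (X : Fin A → ℕ → Ω → CycleStarCliqueVertex m),
        IsStationaryWalkSystem (cycleStarClique m) P X → ∀ s : CycleStarCliqueVertex m,
          ENNReal.ofReal (c * ((n : ℝ) ^ (2 / 3 : ℝ) * Real.log n)) ≤
            ∫⁻ ω, meetTime s (fun g t => X g t ω) ∂P := by
  obtain ⟨w, hw⟩ : ∃ w, w = 20 * b + 1 := ⟨_, rfl⟩
  obtain ⟨ρ, hρ⟩ : ∃ ρ, ρ = 2 * w + 8 := ⟨_, rfl⟩
  obtain ⟨lam, hlam⟩ : ∃ lam, lam = 8 * b * ρ + 2 := ⟨_, rfl⟩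
  have hw0 : 0 < w := by linarith
  have hρ0 : 0 < ρ := by linarith
  have hl2 : 2 ≤ lam := by have : 0 < 8 * b * ρ := by positivity
                           linarith
  have hl0 : 0 < lam := by linarith
  obtain ⟨M, hM⟩ := exists_nat_ge (40 + 24 * w + 4 * ρ ^ 2 + 2 * lam)
  refine ⟨1 / (16384 * lam), by positivity, M, ?_⟩
  intro n m A hMm hn hn0 hA0 hA Ω _ P _ X h s
  have hMm' : (M : ℝ) ≤ m := by exact_mod_cast hMm
  have hρ2 : 0 < ρ ^ 2 := by positivity
  have hm40 : (40 : ℝ) ≤ m := by linarith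
  have hm0 : (0 : ℝ) < m := by linarith
  have hnR : (n : ℝ) ≤ (m + 1) ^ 3 := by exact_mod_cast hn.le
  have hn0R : (0 : ℝ) < n := by exact_mod_cast hn0
  have hT := Nat.floor_le (a := (m : ℝ) ^ 2 * Real.log m / (32 * lam)) (by positivity)
  have hT' := Nat.lt_floor_add_one ((m : ℝ) ^ 2 * Real.log m / (32 * lam))
  set T := ⌊(m : ℝ) ^ 2 * Real.log m / (32 * lam)⌋₊
  have hm40' : 40 ≤ m := by exact_mod_cast hm40
  refine le_trans (ENNReal.ofReal_le_ofReal ?_) (meetTime_lintegral_ge h (by omega) hA0 s T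
    (reach_far_small h s hb (hA.trans (by gcongr)) hw hρ hlam hm40'
      (by linarith) (by linarith) (by linarith) T hT))
  have hlog1 : 1 ≤ Real.log m := by
    rw [Real.le_log_iff_exp_le hm0]
    have := Real.exp_one_lt_d9
    linarith
  have hn8 : (n : ℝ) ≤ (2 * m) ^ 3 := hnR.trans (by gcongr; linarith)
  have h1 : (n : ℝ) ^ (2 / 3 : ℝ) ≤ 4 * m ^ 2 := by
    calc (n : ℝ) ^ (2 / 3 : ℝ) ≤ ((2 * m : ℝ) ^ 3) ^ (2 / 3 : ℝ) :=
          Real.rpow_le_rpow hn0R.le hn8 (by norm_num)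
      _ = (2 * m : ℝ) ^ 2 := by
          rw [← Real.rpow_natCast, ← Real.rpow_mul (by positivity), ← Real.rpow_natCast]
          norm_num
      _ = 4 * m ^ 2 := by ring
  have h2 : Real.log n ≤ 6 * Real.log m := by
    have : Real.log n ≤ Real.log ((m ^ 2 : ℝ) ^ 3) :=
      Real.log_le_log hn0R (hn8.trans (by gcongr; nlinarith))
    rw [← pow_mul, Real.log_pow] at this
    norm_num at this
    exact this
  have h3 : (n : ℝ) ^ (2 / 3 : ℝ) * Real.log n ≤ 4 * m ^ 2 * (6 * Real.log m) :=
    mul_le_mul h1 h2 (Real.log_nonneg (by exact_mod_cast hn0)) (by positivity)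
  -- A value of at least `2` loses at most half of itself under the floor defining `T`.
  have h4 : 2 ≤ (m : ℝ) ^ 2 * Real.log m / (32 * lam) := by
    rw [le_div_iff₀ (by positivity)]
    nlinarith
  have h5 : 1 / (16384 * lam) * ((n : ℝ) ^ (2 / 3 : ℝ) * Real.log n) ≤
      1 / (16384 * lam) * (4 * m ^ 2 * (6 * Real.log m)) := by gcongr
  -- The constant leaves room: `3 / 64 * (2 * T) = 3 * T / 32 ≤ T / 8`.
  have h6 : 1 / (16384 * lam) * (4 * m ^ 2 * (6 * Real.log m)) =
      3 / 64 * ((m : ℝ) ^ 2 * Real.log m / (32 * lam)) := by field_simp; norm_num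
  have h7 : (m : ℝ) ^ 2 * Real.log m / (32 * lam) ≤ 2 * T := by linarith
  linarith

/-! ### Second-moment bound for crossings of prescribed edges -/

section Crossings

theorem walkOp_single {V : Type*} [Fintype V] [DecidableEq V] (G : SimpleGraph V)
    [DecidableRel G.Adj] (x v : V) : walkOp G (Pi.single x 1) v = stepProb G v x := by
  simp [walkOp, Pi.single_apply]

variable {V Ω : Type*} [Fintype V] {G : SimpleGraph V} [DecidableRel G.Adj]
  [MeasurableSpace Ω] {P : Measure Ω} [IsProbabilityMeasure P]

/-- A walk that may cross prescribed edges at prescribed times does so with probability at least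
`1 - δ` times the expected number of crossings, if the potential `h` shows that few crossings
follow a given one. -/
theorem IsStationaryWalkSystem.real_exists_crossing_ge {ι : Type*} {X : ι → ℕ → Ω → V}
    (hX : IsStationaryWalkSystem G P X) (hG : ∀ v, 0 < G.degree v) (g : ι) (e : ℕ → V × V)
    {L : ℕ} {f h : V → ℝ} {ε δ p : ℝ} (hf : 0 ≤ f) (hh : 0 ≤ h)
    (hfh : ∀ v, f v + walkOp G h v ≤ h v + ε) (hp : ∀ u v, stepProb G u v ≤ p)
    (hδ : ∀ v, p * (h v + L * ε) ≤ δ) (S : Finset ℕ) (hS : ∀ u ∈ S, ∀ u' ∈ S, u' < u + L)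
    (hadj : ∀ u ∈ S, G.Adj (e u).1 (e u).2) (hf1 : ∀ u ∈ S, 1 ≤ f (e u).1) :
    S.card * (1 / (2 * (G.edgeFinset.card : ℝ)) * (1 - δ)) ≤
      P.real (⋃ u ∈ S, {ω | X g u ω = (e u).1} ∩ {ω | X g (u + 1) ω = (e u).2}) := by
  classical
  set p₀ : ℝ := 1 / (2 * (G.edgeFinset.card : ℝ))
  have hp₀ : 0 ≤ p₀ := by positivity
  induction S using Finset.induction_on_min with
  | empty => simp
  -- The new time `u` is the earliest one. Its crossing adds `p₀` to the probability of the union,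
  -- minus the overlap with later crossings, which is at most `p₀ * δ`.
  | insert u S hu ih =>
    have huS : u ∉ S := fun h => lt_irrefl _ (hu u h)
    have ih' := ih (fun v hv w hw => hS v (Finset.mem_insert_of_mem hv) w
      (Finset.mem_insert_of_mem hw)) (fun v hv => hadj v (Finset.mem_insert_of_mem hv))
      (fun v hv => hf1 v (Finset.mem_insert_of_mem hv))
    set E : ℕ → Set Ω := fun u => {ω | X g u ω = (e u).1} ∩ {ω | X g (u + 1) ω = (e u).2}
    have hE : ∀ u, MeasurableSet (E u) := fun u =>
      (hX.measurable_fiber g _ _).inter (hX.measurable_fiber g _ _)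
    have hEu : P.real (E u) = p₀ := by
      rw [hX.real_crossing hG, if_pos (hadj u (Finset.mem_insert_self _ _))]
    have hpnn : 0 ≤ p := (stepProb_nonneg G (e u).1 (e u).1).trans (hp _ _)
    -- A second crossing at `u'` requires a walk from the end of the first edge to the start of the
    -- second, counted by `f`, and one more step, of probability at most `p`.
    have hpair : ∀ u' ∈ S, P.real (E u ∩ E u') ≤
        p * (p₀ * (walkOp G)^[u' - (u + 1)] f (e u).2) := by
      intro u' hu'
      obtain ⟨k, rfl⟩ : ∃ k, u' = u + 1 + k := ⟨u' - (u + 1), by have := hu u' hu'; omega⟩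
      have h1 := hX.markov_step (g := g) (t := u + 1 + k) (E := E u)
        (((isPrefixEvent_eq (X g) (by omega) _).inter (isPrefixEvent_eq (X g) (by omega) _)))
        (e (u + 1 + k)).1 (e (u + 1 + k)).2
      have h2 := hX.markov_iterate_single (g := g) (t := u + 1) (E := {ω | X g u ω = (e u).1})
        (isPrefixEvent_eq (X g) (by omega) _) (e u).2 k (e (u + 1 + k)).1
      rw [← Set.inter_assoc, h1]
      have h3 : P.real (E u ∩ {ω | X g (u + 1 + k) ω = (e (u + 1 + k)).1}) ≤
          p₀ * (walkOp G)^[k] f (e u).2 := by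
        rw [h2, show P.real ({ω | X g u ω = (e u).1} ∩ {ω | X g (u + 1) ω = (e u).2}) = p₀ from hEu]
        refine mul_le_mul_of_nonneg_left (walkOp_iterate_mono k ?_ _) hp₀
        intro v
        by_cases hv : v = (e (u + 1 + k)).1
        · subst hv; simpa using hf1 _ (Finset.mem_insert_of_mem hu')
        · simpa [hv] using hf v
      rw [add_tsub_cancel_left, mul_comm]
      exact mul_le_mul (hp _ _) h3 measureReal_nonneg hpnn
    have hsum : ∑ u' ∈ S, (walkOp G)^[u' - (u + 1)] f (e u).2 ≤ h (e u).2 + L * ε := by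
      refine le_trans ?_ (sum_iterate_le hG hh hfh L (e u).2)
      -- The delays `u' - (u + 1)` are distinct and smaller than `L`, so their sum is part of an
      -- occupation sum over `L` rounds.
      rw [← Finset.sum_image (f := fun k => (walkOp G)^[k] f (e u).2) (g := fun u' => u' - (u + 1))]
      · refine Finset.sum_le_sum_of_subset_of_nonneg ?_ fun k _ _ =>
          walkOp_iterate_nonneg k hf _
        intro k hk
        obtain ⟨u', hu', rfl⟩ := Finset.mem_image.1 hk
        have := hS u (Finset.mem_insert_self _ _) u' (Finset.mem_insert_of_mem hu')
        have := hu u' hu'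
        rw [Finset.mem_range]; omega
      · intro v hv w hw hvw
        have := hu v hv
        have := hu w hw
        simp only at hvw
        omega
    have hinter : P.real (E u ∩ ⋃ u' ∈ S, E u') ≤ p₀ * δ := by
      rw [Set.inter_iUnion₂]
      refine (measureReal_biUnion_finset_le S _).trans ((Finset.sum_le_sum hpair).trans ?_)
      rw [← Finset.mul_sum, ← Finset.mul_sum, mul_left_comm]
      refine mul_le_mul_of_nonneg_left (le_trans ?_ (hδ (e u).2)) hp₀
      exact mul_le_mul_of_nonneg_left hsum hpnn
    rw [Finset.set_biUnion_insert, Finset.card_insert_of_notMem huS]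
    have h4 := measureReal_union_add_inter (μ := P) (s := E u)
      (t := ⋃ u' ∈ S, E u') (S.measurableSet_biUnion fun u _ => hE u)
      (measure_ne_top P _) (measure_ne_top P _)
    push_cast
    change _ ≤ P.real (E u ∪ ⋃ u' ∈ S, E u')
    rw [hEu] at h4
    have : P.real (⋃ u' ∈ S, E u') = P.real (⋃ u' ∈ S, {ω | X g u' ω = (e u').1} ∩
      {ω | X g (u' + 1) ω = (e u').2}) := rfl
    nlinarith

/-- It is unlikely that none of many walks crosses the prescribed edges. -/
theorem IsStationaryWalkSystem.measure_no_crossing_le {A : ℕ} {X : Fin A → ℕ → Ω → V}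
    (hX : IsStationaryWalkSystem G P X) (hG : ∀ v, 0 < G.degree v) (e : ℕ → V × V)
    {L : ℕ} {f h : V → ℝ} {ε p : ℝ} (hf : 0 ≤ f) (hh : 0 ≤ h)
    (hfh : ∀ v, f v + walkOp G h v ≤ h v + ε) (hp : ∀ u v, stepProb G u v ≤ p)
    (hδ : ∀ v, p * (h v + L * ε) ≤ 1 / 2) (S : Finset ℕ) (hS : ∀ u ∈ S, ∀ u' ∈ S, u' < u + L)
    (hadj : ∀ u ∈ S, G.Adj (e u).1 (e u).2) (hf1 : ∀ u ∈ S, 1 ≤ f (e u).1) :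
    P {ω | ∀ g, ∀ u ∈ S, ¬ (X g u ω = (e u).1 ∧ X g (u + 1) ω = (e u).2)} ≤
      ENNReal.ofReal (Real.exp (-(A * S.card / (2 * (2 * (G.edgeFinset.card : ℝ)))))) := by
  set D : ℝ := 2 * (G.edgeFinset.card : ℝ)
  let B : Set (ℕ → V) := {y | ∀ u ∈ S, ¬ (y u = (e u).1 ∧ y (u + 1) = (e u).2)}
  have hBm : @MeasurableSet _ (@MeasurableSpace.pi ℕ (fun _ => V) fun _ => ⊤) B := by
    let _ : MeasurableSpace V := ⊤
    have hm : ∀ t v, MeasurableSet {y : ℕ → V | y t = v} := fun t v =>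
      measurable_pi_apply (X := fun _ : ℕ => V) t (MeasurableSpace.measurableSet_top (s := {v}))
    have : B = ⋂ u ∈ S, ({y : ℕ → V | y u = (e u).1} ∩ {y | y (u + 1) = (e u).2})ᶜ := by
      ext y; simp [B]
    rw [this]
    exact Finset.measurableSet_biInter _ fun u _ => ((hm _ _).inter (hm _ _)).compl
  have h1 := hX.indep.measure_inter_preimage_eq_mul Finset.univ (sets := fun _ => B)
    fun _ _ => hBm
  have h2 : {ω | ∀ g, ∀ u ∈ S, ¬ (X g u ω = (e u).1 ∧ X g (u + 1) ω = (e u).2)} =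
      ⋂ g ∈ (Finset.univ : Finset (Fin A)), (fun ω t => X g t ω) ⁻¹' B := by
    ext ω; simp [B]
  have h3 : ∀ g : Fin A, P ((fun ω t => X g t ω) ⁻¹' B) ≤
      ENNReal.ofReal (Real.exp (-(S.card / (2 * D)))) := by
    intro g
    have hU := hX.real_exists_crossing_ge hG g e hf hh hfh hp hδ S hS hadj hf1
    have hUm : MeasurableSet
        (⋃ u ∈ S, {ω | X g u ω = (e u).1} ∩ {ω | X g (u + 1) ω = (e u).2}) :=
      S.measurableSet_biUnion fun u _ =>
        (hX.measurable_fiber g _ _).inter (hX.measurable_fiber g _ _)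
    have hc : (fun ω t => X g t ω) ⁻¹' B =
        (⋃ u ∈ S, {ω | X g u ω = (e u).1} ∩ {ω | X g (u + 1) ω = (e u).2})ᶜ := by
      ext ω; simp [B]
    rw [← ofReal_measureReal, hc, probReal_compl_eq_one_sub hUm]
    apply ENNReal.ofReal_le_ofReal
    have h4 := Real.one_sub_le_exp_neg (S.card / (2 * D))
    have h5 : (S.card : ℝ) * (1 / D * (1 - 1 / 2)) = S.card / (2 * D) := by
      rw [show (1 : ℝ) - 1 / 2 = 1 / 2 by norm_num, one_div_mul_one_div, mul_one_div,
        mul_comm D]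
    linarith
  rw [h2, h1]
  refine (Finset.prod_le_prod' fun g _ => h3 g).trans (le_of_eq ?_)
  rw [Finset.prod_const, Finset.card_univ, Fintype.card_fin, ← ENNReal.ofReal_pow (Real.exp_nonneg _),
    ← Real.exp_nat_mul]
  congr 2
  ring

end Crossings

/-! ### Crossing bounds for this graph -/

section GraphCrossings

variable {m A : ℕ} {Ω : Type*} [MeasurableSpace Ω] {P : Measure Ω} [IsProbabilityMeasure P]
  {X : Fin A → ℕ → Ω → CycleStarCliqueVertex m}

theorem mul_div_edges_ge (hm : 3 ≤ m) {a : ℝ} (ha : 0 < a) (hA : a * m ^ 3 ≤ A) (c : ℕ) :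
    a * c / (4 * m) ≤
      A * c / (2 * (2 * ((cycleStarClique m).edgeFinset.card : ℝ))) := by
  have hm0 : (0 : ℝ) < m := by exact_mod_cast (by omega : 0 < m)
  have hE := two_mul_card_edges_le hm
  have hE' := le_two_mul_card_edges hm
  have hE0 : 0 < 2 * ((cycleStarClique m).edgeFinset.card : ℝ) := lt_of_lt_of_le (by positivity) hE'
  calc a * c / (4 * m) = a * m ^ 3 * c / (2 * (2 * m ^ 4)) := by field_simp; norm_num
    _ ≤ _ := by gcongr

/-- A step hits `x` with probability at most `1 / m`, so `m ^ 2 / 4` rounds bring at most `1 + m /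
4` expected visits; with the factor `1 / m` of the crossing step this stays below `1 / 2`. This
crude potential limits the window to order `m ^ 2 / 4`. -/
theorem measure_no_edge_crossing_le (hX : IsStationaryWalkSystem (cycleStarClique m) P X)
    (hm : 8 ≤ m) {a : ℝ} (ha : 0 < a) (hA : a * m ^ 3 ≤ A) {x y : CycleStarCliqueVertex m}
    (hxy : (cycleStarClique m).Adj x y) (τ : ℕ) :
    P {ω | ∀ g, ∀ u ∈ Finset.Ico τ (τ + m ^ 2 / 4), ¬ (X g u ω = x ∧ X g (u + 1) ω = y)} ≤
      ENNReal.ofReal (Real.exp (-(a / 32 * m))) := by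
  classical
  have hm8 : (8 : ℝ) ≤ m := by exact_mod_cast hm
  have hm0 : (0 : ℝ) < m := by linarith
  have hL : ((m ^ 2 / 4 : ℕ) : ℝ) ≤ m ^ 2 / 4 := by
    have := @Nat.cast_div_le ℝ _ _ _ (m ^ 2) 4
    push_cast at this; exact this
  have hL' : (m : ℝ) ^ 2 / 8 ≤ (m ^ 2 / 4 : ℕ) := by
    have h1 : m ^ 2 ≤ 8 * (m ^ 2 / 4) := by
      have : 64 ≤ m ^ 2 := by nlinarith
      omega
    have : (m : ℝ) ^ 2 ≤ 8 * (m ^ 2 / 4 : ℕ) := by exact_mod_cast h1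
    linarith
  refine (hX.measure_no_crossing_le (degree_pos (by omega)) (fun _ => (x, y)) (L := m ^ 2 / 4)
    (f := Pi.single x 1) (h := Pi.single x 1) (ε := 1 / m) (p := 1 / m) ?_ ?_ ?_
    (stepProb_le (by omega)) ?_ _ ?_ (fun _ _ => hxy) (by simp)).trans ?_
  · exact Pi.single_nonneg.2 zero_le_one
  · exact Pi.single_nonneg.2 zero_le_one
  · intro v
    rw [walkOp_single]
    have := stepProb_le (by omega) v x
    linarith
  · intro v
    have h1 : (Pi.single x 1 : CycleStarCliqueVertex m → ℝ) v ≤ 1 := by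
      by_cases hv : v = x
      · subst hv; simp
      · simp [hv]
    have h2 : ((m ^ 2 / 4 : ℕ) : ℝ) * (1 / m) ≤ m / 4 := by
      rw [mul_one_div, div_le_iff₀ hm0]; linarith
    rw [one_div_mul_eq_div, div_le_iff₀ hm0]
    linarith
  · intro u hu u' hu'
    rw [Finset.mem_Ico] at hu hu'
    omega
  · apply ENNReal.ofReal_le_ofReal
    apply Real.exp_le_exp.2
    apply neg_le_neg
    rw [Nat.card_Ico, Nat.add_sub_cancel_left]
    refine le_trans ?_ (mul_div_edges_ge (by omega) ha hA _)
    rw [le_div_iff₀ (by positivity)]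
    nlinarith

/-- Windows of `C * m ^ 2` rounds with large `C` need a better potential. A walk in a clique returns
to the cycle at rate about `m ^ (-2)`, which the values `4`, `4 / m`, `0` and the drift `4 / m ^ 2`
express: at most `4 + 4 * C` expected visits to the whole cycle. -/
theorem measure_no_cycle_crossing_le (hX : IsStationaryWalkSystem (cycleStarClique m) P X)
    (hm : 3 ≤ m) {a : ℝ} (ha : 0 < a) (hA : a * m ^ 3 ≤ A) {C : ℕ} (hC : 8 * (C + 1) ≤ m)
    (e : ℕ → Fin m × Fin m) (S : Finset ℕ) (hS : ∀ u ∈ S, ∀ u' ∈ S, u' < u + C * m ^ 2)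
    (hadj : ∀ u, (SimpleGraph.cycleGraph m).Adj (e u).1 (e u).2) :
    P {ω | ∀ g, ∀ u ∈ S, ¬ (X g u ω = .inl (e u).1 ∧ X g (u + 1) ω = .inl (e u).2)} ≤
      ENNReal.ofReal (Real.exp (-(a * S.card / (4 * m)))) := by
  have hm3 : (3 : ℝ) ≤ m := by exact_mod_cast hm
  have hm0 : (0 : ℝ) < m := by linarith
  let f : CycleStarCliqueVertex m → ℝ := fun v => match v with
    | .inl _ => 1
    | _ => 0
  let h : CycleStarCliqueVertex m → ℝ := fun v => match v with
    | .inl _ => 4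
    | .inr (.inl _) => 4 / m
    | .inr (.inr _) => 0
  refine (hX.measure_no_crossing_le (degree_pos hm) (fun u => (.inl (e u).1, .inl (e u).2))
    (L := C * m ^ 2) (f := f) (h := h) (ε := 4 / m ^ 2) (p := 1 / m) ?_ ?_ ?_ (stepProb_le hm) ?_
    S hS (fun u _ => (adj_c_c _ _).2 (hadj u)) (fun _ _ => le_rfl)).trans ?_
  · rintro (i | ⟨i, j⟩ | ⟨i, j, k⟩) <;> simp [f]
  · rintro (i | ⟨i, j⟩ | ⟨i, j, k⟩) <;> simp only [h, Pi.zero_apply] <;> positivity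
  · rintro (i | ⟨i, j⟩ | ⟨i, j, k⟩)
    · have h1 := walkOp_c_le hm h i (a := 4) fun _ _ => le_rfl
      have h2 : (2 * 4 + ∑ j, h (.inr (.inl (i, j)))) / (m + 2) ≤ 3 := by
        simp only [h, Finset.sum_const, Finset.card_univ, Fintype.card_fin, nsmul_eq_mul]
        rw [mul_div_cancel₀ _ hm0.ne', div_le_iff₀ (by positivity)]
        linarith
      have h3 : (0 : ℝ) ≤ 4 / m ^ 2 := by positivity
      simp only [f, h] at h1 h2 ⊢
      linarith
    · rw [walkOp_l]
      have h3 : (0 : ℝ) ≤ 4 / m ^ 2 := by positivity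
      have h4 : (4 : ℝ) / (m + 1) ≤ 4 / m := by gcongr; linarith
      simp only [f, h, Finset.sum_const_zero]
      rw [zero_add, add_zero]
      linarith
    · rw [walkOp_q]
      simp only [f, h, Finset.sum_const_zero]
      rw [sub_zero, add_zero, zero_add, zero_add, div_div, sq]
  · intro v
    have hC' : (8 : ℝ) * (C + 1) ≤ m := by exact_mod_cast hC
    have h1 : h v ≤ 4 := by
      rcases v with i | ⟨i, j⟩ | ⟨i, j, k⟩
      · exact le_rfl
      · simp only [h]
        rw [div_le_iff₀ hm0]; linarith
      · simp [h]
    have h2 : ((C * m ^ 2 : ℕ) : ℝ) * (4 / m ^ 2) = 4 * C := by push_cast; field_simp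
    rw [h2, one_div_mul_eq_div, div_le_iff₀ hm0]
    linarith
  · apply ENNReal.ofReal_le_ofReal
    apply Real.exp_le_exp.2
    exact neg_le_neg (mul_div_edges_ge hm ha hA _)

end GraphCrossings

/-! ### Monotonicity and propagation in visit-exchange -/

section VisitProcess

variable {V ι : Type*} {s : V} {x : ι → ℕ → V}

theorem visitState_mono {t t' : ℕ} (h : t ≤ t') :
    (visitState s x t).1 ⊆ (visitState s x t').1 ∧ (visitState s x t).2 ⊆ (visitState s x t').2 := by
  induction h with
  | refl => exact ⟨subset_rfl, subset_rfl⟩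
  | step _ ih => exact ⟨ih.1.trans fun _ h => Or.inl h, ih.2.trans fun _ h => Or.inl h⟩

theorem mem_agents_of_mem_vertices {t : ℕ} {g : ι} (h : x g t ∈ (visitState s x t).1) :
    g ∈ (visitState s x t).2 := by
  cases t with
  | zero => exact h
  | succ t => exact Or.inr h

theorem mem_vertices_of_mem_agents {t : ℕ} {g : ι} (h : g ∈ (visitState s x t).2) :
    x g t ∈ (visitState s x t).1 := by
  cases t with
  | zero => exact h
  | succ t =>
    rcases h with h | h
    · exact Or.inr ⟨g, h, rfl⟩
    · exact h

/-- An agent that has visited an informed vertex informs all vertices that it visits later. -/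
theorem mem_visitState_of_visit {t t' : ℕ} {g : ι} (h : x g t ∈ (visitState s x t).1)
    (ht : t ≤ t') : x g t' ∈ (visitState s x t').1 :=
  mem_vertices_of_mem_agents ((visitState_mono ht).2 (mem_agents_of_mem_vertices h))

theorem mem_visitState_of_crossing {τ u τ' : ℕ} {g : ι} {v w : V} (hv : v ∈ (visitState s x τ).1)
    (h1 : τ ≤ u) (h2 : u < τ') (hg : x g u = v) (hg' : x g (u + 1) = w) :
    w ∈ (visitState s x τ').1 := by
  subst hg hg'
  exact (visitState_mono h2).1
    (mem_visitState_of_visit ((visitState_mono h1).1 hv) (Nat.le_succ u))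

end VisitProcess

/-! ### Travel around the cycle in blocks -/

section Staircase

variable {m : ℕ}

/-- The cyclic successor. -/
def cycleSucc (i : Fin m) : Fin m :=
  if h : i.val + 1 < m then ⟨i.val + 1, h⟩ else ⟨0, i.pos⟩

theorem cycleSucc_adj (hm : 3 ≤ m) (i : Fin m) :
    (SimpleGraph.cycleGraph m).Adj i (cycleSucc i) := by
  rw [SimpleGraph.cycleGraph_adj']
  right
  have h1 := i.isLt
  rw [Fin.sub_def]
  unfold cycleSucc
  split_ifs with h
  · simp only
    rw [Nat.mod_eq_sub_mod (by omega), Nat.mod_eq_of_lt (by omega)]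
    omega
  · simp only
    rw [Nat.mod_eq_of_lt (by omega)]
    omega

theorem cycleSucc_iterate_surjective (i₀ j : Fin m) : ∃ r < m, cycleSucc^[r] i₀ = j := by
  have h0 := i₀.isLt
  have h1 := j.isLt
  have hsucc : ∀ i : Fin m, (cycleSucc i).val = i.val + 1 ∨ (cycleSucc i).val + m = i.val + 1 := by
    intro i
    have := i.isLt
    unfold cycleSucc
    split_ifs
    · exact Or.inl rfl
    · right
      simp only
      omega
  have key : ∀ r < m, (cycleSucc^[r] i₀).val = i₀.val + r ∨
      (cycleSucc^[r] i₀).val + m = i₀.val + r := by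
    intro r
    induction r with
    | zero => simp
    | succ r ih =>
      intro hr
      have h2 := ih (by omega)
      have h3 := hsucc (cycleSucc^[r] i₀)
      have h4 := (cycleSucc (cycleSucc^[r] i₀)).isLt
      rw [Function.iterate_succ_apply']
      omega
  rcases le_or_gt i₀.val j.val with h | h
  · refine ⟨j.val - i₀.val, by omega, Fin.ext ?_⟩
    have := key (j.val - i₀.val) (by omega)
    have := (cycleSucc^[j.val - i₀.val] i₀).isLt
    omega
  · refine ⟨j.val + m - i₀.val, by omega, Fin.ext ?_⟩
    have := key (j.val + m - i₀.val) (by omega)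
    have := (cycleSucc^[j.val + m - i₀.val] i₀).isLt
    omega

/-- No agent crosses the `r`-th edge of the cycle after `i₀` during the `k`-th block of length `m`
after `τ`. -/
def NoBlockCrossing {ι : Type*} (x : ι → ℕ → CycleStarCliqueVertex m) (i₀ : Fin m)
    (τ r k : ℕ) : Prop :=
  ∀ g, ∀ j < m, ¬ (x g (τ + k * m + j) = .inl (cycleSucc^[r] i₀) ∧
    x g (τ + k * m + j + 1) = .inl (cycleSucc^[r + 1] i₀))

/-- Unless the rumor has advanced once in each block of a set `B`, the blocks outside `B` have
no crossings at the frontier. -/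
theorem exists_blocks {ι : Type*} {s : CycleStarCliqueVertex m}
    {x : ι → ℕ → CycleStarCliqueVertex m} {i₀ : Fin m} {τ : ℕ}
    (h0 : .inl i₀ ∈ (visitState s x τ).1) (K : ℕ) :
    ∃ B ⊆ Finset.range K,
      (∀ r ≤ B.card, .inl (cycleSucc^[r] i₀) ∈ (visitState s x (τ + K * m)).1) ∧
      ∀ k ∈ Finset.range K \ B, NoBlockCrossing x i₀ τ (B.filter (· < k)).card k := by
  classical
  induction K with
  | zero => exact ⟨∅, by simp, by simpa using h0, by simp⟩
  | succ K ih =>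
    obtain ⟨B, hB, hI, hN⟩ := ih
    have hmono : (visitState s x (τ + K * m)).1 ⊆ (visitState s x (τ + (K + 1) * m)).1 :=
      (visitState_mono (by rw [add_mul]; omega)).1
    have hBK : K ∉ B := fun h => by simpa using hB h
    have hBf : B.filter (· < K) = B :=
      Finset.filter_true_of_mem fun k hk => Finset.mem_range.1 (hB hk)
    -- At most one advance is counted per block, so the frontier before a block is the number of
    -- earlier elements of `B`. Block `K` joins `B` exactly if the current frontier edge is crossed
    -- in it.
    by_cases hc : NoBlockCrossing x i₀ τ B.card K
    · refine ⟨B, hB.trans (Finset.range_mono (Nat.le_succ K)), fun r hr => hmono (hI r hr), ?_⟩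
      intro k hk
      rw [Finset.mem_sdiff, Finset.mem_range] at hk
      rcases Nat.lt_succ_iff_lt_or_eq.1 hk.1 with h | rfl
      · exact hN k (by simp [h, hk.2])
      · rwa [hBf]
    · unfold NoBlockCrossing at hc
      push Not at hc
      obtain ⟨g, j, hj, h1, h2⟩ := hc
      refine ⟨insert K B, ?_, ?_, ?_⟩
      · rw [Finset.range_add_one]; exact Finset.insert_subset_insert _ hB
      · intro r hr
        rw [Finset.card_insert_of_notMem hBK] at hr
        rcases Nat.le_succ_iff.1 hr with h | rfl
        · exact hmono (hI r h)
        · exact mem_visitState_of_crossing (hI _ le_rfl) (by omega)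
            (by rw [add_mul]; omega) h1 h2
      · intro k hk
        rw [Finset.mem_sdiff, Finset.mem_range, Finset.mem_insert, not_or] at hk
        have hkK : k < K := by omega
        rw [Finset.filter_insert, if_neg (by omega)]
        exact hN k (by simp [hkK, hk.2.2])

/-- If all edges are crossed in four windows and the rumor travels around the cycle between the
second and the third of them, then all vertices become informed. -/
theorem visitState_eq_univ {ι : Type*} {s : CycleStarCliqueVertex m}
    {x : ι → ℕ → CycleStarCliqueVertex m} {L D : ℕ} (hL : 0 < L)
    (hcross : ∀ τ ∈ [0, L, 2 * L + D, 3 * L + D], ∀ v w, (cycleStarClique m).Adj v w →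
      ∃ g, ∃ u ∈ Finset.Ico τ (τ + L), x g u = v ∧ x g (u + 1) = w)
    (hcyc : .inl (starIndex s) ∈ (visitState s x (2 * L)).1 →
      ∀ i, .inl i ∈ (visitState s x (2 * L + D)).1) :
    (visitState s x (4 * L + D)).1 = Set.univ := by
  have hstep : ∀ τ ∈ [0, L, 2 * L + D, 3 * L + D], ∀ v w, v ∈ (visitState s x τ).1 →
      (cycleStarClique m).Adj v w → w ∈ (visitState s x (τ + L)).1 := by
    intro τ hτ v w hv hvw
    obtain ⟨g, u, hu, h1, h2⟩ := hcross τ hτ v w hvw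
    rw [Finset.mem_Ico] at hu
    exact mem_visitState_of_crossing hv hu.1 hu.2 h1 h2
  have hs : s ∈ (visitState s x 0).1 := rfl
  -- A source inside a clique is two steps away from the cycle, hence two windows before the travel;
  -- symmetrically two windows follow it.
  have hc : .inl (starIndex s) ∈ (visitState s x (2 * L)).1 := by
    rcases s with i | ⟨i, j⟩ | ⟨i, j, k⟩
    · exact (visitState_mono (Nat.zero_le _)).1 hs
    · exact (visitState_mono (by omega)).1
        (hstep 0 (by simp) _ (.inl i) hs ((adj_l_c _ _ _).2 rfl))
    · have h1 := hstep 0 (by simp) _ (.inr (.inl (i, j))) hs ((adj_q_l _ _ _ _ _).2 ⟨rfl, rfl⟩)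
      rw [zero_add] at h1
      have h2 := hstep L (by simp) _ (.inl i) h1 ((adj_l_c _ _ _).2 rfl)
      rwa [← two_mul] at h2
  have hC := hcyc hc
  have hl : ∀ i j, .inr (.inl (i, j)) ∈ (visitState s x (3 * L + D)).1 := fun i j => by
    have := hstep (2 * L + D) (by simp) _ (.inr (.inl (i, j))) (hC i) ((adj_c_l _ _ _).2 rfl)
    rwa [show 2 * L + D + L = 3 * L + D by ring] at this
  rw [Set.eq_univ_iff_forall]
  rintro (i | ⟨i, j⟩ | ⟨i, j, k⟩)
  · exact (visitState_mono (by omega)).1 (hC i)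
  · exact (visitState_mono (by omega)).1 (hl i j)
  · have := hstep (3 * L + D) (by simp) _ (.inr (.inr (i, j, k))) (hl i j)
      ((adj_l_q _ _ _ _ _).2 ⟨rfl, rfl⟩)
    rwa [show 3 * L + D + L = 4 * L + D by ring] at this

end Staircase

/-! ### Probability of slow travel around the cycle -/

section StaircaseProbability

variable {m A : ℕ} {Ω : Type*} [MeasurableSpace Ω] {P : Measure Ω} [IsProbabilityMeasure P]
  {X : Fin A → ℕ → Ω → CycleStarCliqueVertex m}

/-- For a fixed `B` the edge to be watched in each round is deterministic, so the crossing bound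
applies to the `(C * m - B.card) * m` rounds outside `B`. -/
theorem measure_no_block_crossings_le (hX : IsStationaryWalkSystem (cycleStarClique m) P X)
    (hm : 3 ≤ m) {a : ℝ} (ha : 0 < a) (hA : a * m ^ 3 ≤ A) {C : ℕ} (hC : 8 * (C + 1) ≤ m)
    (i₀ : Fin m) (τ : ℕ) {B : Finset ℕ} (hB : B ⊆ Finset.range (C * m)) :
    P {ω | ∀ k ∈ Finset.range (C * m) \ B,
        NoBlockCrossing (fun g t => X g t ω) i₀ τ (B.filter (· < k)).card k} ≤
      ENNReal.ofReal (Real.exp (-(a / 4)) ^ (C * m - B.card)) := by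
  classical
  have hm0 : 0 < m := by omega
  have hm0' : (0 : ℝ) < m := by exact_mod_cast hm0
  let S : Finset ℕ := ((Finset.range (C * m) \ B) ×ˢ Finset.range m).image
    fun p => τ + p.1 * m + p.2
  have hdiv : ∀ k j, j < m → (τ + k * m + j - τ) / m = k := by
    intro k j hj
    rw [show τ + k * m + j - τ = j + k * m by omega, Nat.add_mul_div_right _ _ hm0,
      Nat.div_eq_of_lt hj, zero_add]
  have hcard : S.card = (C * m - B.card) * m := by
    rw [Finset.card_image_of_injOn, Finset.card_product, Finset.card_range,
      Finset.card_sdiff_of_subset hB, Finset.card_range]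
    rintro ⟨k, j⟩ hk ⟨k', j'⟩ hk' heq
    simp only [Finset.coe_product, Set.mem_prod, Finset.mem_coe, Finset.mem_range] at hk hk' heq
    have h1 := hdiv k j hk.2
    have h2 := hdiv k' j' hk'.2
    rw [heq, h2] at h1
    subst h1
    simp only [Prod.mk.injEq, true_and]
    omega
  -- The block containing round `u` is `(u - τ) / m`.
  let r : ℕ → ℕ := fun u => (B.filter (· < (u - τ) / m)).card
  have key := measure_no_cycle_crossing_le hX hm ha hA hC
    (fun u => (cycleSucc^[r u] i₀, cycleSucc^[r u + 1] i₀)) S (by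
      intro u hu u' hu'
      obtain ⟨⟨k, j⟩, hk, rfl⟩ := Finset.mem_image.1 hu
      obtain ⟨⟨k', j'⟩, hk', rfl⟩ := Finset.mem_image.1 hu'
      simp only [Finset.mem_product, Finset.mem_sdiff, Finset.mem_range] at hk hk' ⊢
      have : (k' + 1) * m ≤ C * m * m := Nat.mul_le_mul_right m hk'.1.1
      have h3 : C * m ^ 2 = C * m * m := by ring
      have h4 : (k' + 1) * m = k' * m + m := by ring
      omega) (by
      intro u
      rw [Function.iterate_succ_apply']
      exact cycleSucc_adj hm _)
  refine (measure_mono ?_).trans (key.trans (le_of_eq ?_))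
  · intro ω hω g u hu
    obtain ⟨⟨k, j⟩, hk, rfl⟩ := Finset.mem_image.1 hu
    obtain ⟨hk, hj⟩ := Finset.mem_product.1 hk
    have hj' : j < m := Finset.mem_range.1 hj
    have := hω k hk g j hj'
    simp only [r, hdiv k j hj']
    exact this
  · rw [hcard, ← Real.exp_nat_mul]
    congr 2
    push_cast
    field_simp

/-- The rumor is unlikely to need long for travelling around the cycle. -/
theorem measure_cycle_not_informed_le (hX : IsStationaryWalkSystem (cycleStarClique m) P X)
    (hm : 3 ≤ m) {a : ℝ} (ha : 0 < a) (hA : a * m ^ 3 ≤ A) {C : ℕ} (hC : 8 * (C + 1) ≤ m)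
    (s : CycleStarCliqueVertex m) (i₀ : Fin m) (τ : ℕ) {y : ℝ} (hy : 0 < y) (hy1 : y ≤ 1) :
    P {ω | .inl i₀ ∈ (visitState s (fun g t => X g t ω) τ).1 ∧
        ¬ ∀ i, .inl i ∈ (visitState s (fun g t => X g t ω) (τ + C * m * m)).1} ≤
      ENNReal.ofReal (((y + Real.exp (-(a / 4))) ^ C / y) ^ m) := by
  classical
  set q := Real.exp (-(a / 4))
  have hq : 0 < q := Real.exp_pos _
  let F : Finset (Finset ℕ) := (Finset.range (C * m)).powerset.filter fun B => B.card < m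
  have hsub : {ω | .inl i₀ ∈ (visitState s (fun g t => X g t ω) τ).1 ∧
        ¬ ∀ i, .inl i ∈ (visitState s (fun g t => X g t ω) (τ + C * m * m)).1} ⊆
      ⋃ B ∈ F, {ω | ∀ k ∈ Finset.range (C * m) \ B,
        NoBlockCrossing (fun g t => X g t ω) i₀ τ (B.filter (· < k)).card k} := by
    rintro ω ⟨h1, h2⟩
    obtain ⟨B, hB, hI, hN⟩ := exists_blocks h1 (C * m)
    refine Set.mem_biUnion (x := B) ?_ hN
    refine Finset.mem_coe.2 (Finset.mem_filter.2 ⟨Finset.mem_powerset.2 hB, ?_⟩)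
    by_contra hlt
    apply h2
    intro i
    obtain ⟨r, hr, rfl⟩ := cycleSucc_iterate_surjective i₀ i
    exact hI r (by omega)
  refine (measure_mono hsub).trans ((measure_biUnion_finset_le _ _).trans ?_)
  calc _ ≤ ∑ B ∈ F, ENNReal.ofReal (q ^ (C * m - B.card)) := by
        refine Finset.sum_le_sum fun B hB => ?_
        exact measure_no_block_crossings_le hX hm ha hA hC i₀ τ
          (Finset.mem_powerset.1 (Finset.mem_filter.1 hB).1)
    _ = ENNReal.ofReal (∑ B ∈ F, q ^ (C * m - B.card)) :=
        (ENNReal.ofReal_sum_of_nonneg fun B _ => by positivity).symm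
    _ ≤ _ := by
        apply ENNReal.ofReal_le_ofReal
        -- Since `y ≤ 1`, every `B` with fewer than `m` elements satisfies `y ^ m ≤ y ^ B.card`;
        -- extending the sum to all subsets then gives the binomial theorem.
        rw [div_pow, le_div_iff₀ (by positivity), ← pow_mul, Finset.sum_mul]
        calc ∑ B ∈ F, q ^ (C * m - B.card) * y ^ m
            ≤ ∑ B ∈ F, y ^ B.card * q ^ ((Finset.range (C * m)).card - B.card) := by
              refine Finset.sum_le_sum fun B hB => ?_
              rw [Finset.card_range, mul_comm]
              gcongr ?_ * _
              exact pow_le_pow_of_le_one hy.le hy1 (Finset.mem_filter.1 hB).2.le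
          _ ≤ ∑ B ∈ (Finset.range (C * m)).powerset,
                y ^ B.card * q ^ ((Finset.range (C * m)).card - B.card) :=
              Finset.sum_le_sum_of_subset_of_nonneg (Finset.filter_subset _ _)
                fun B _ _ => by positivity
          _ = (y + q) ^ (C * m) := by
              rw [Finset.sum_pow_mul_eq_add_pow, Finset.card_range]

end StaircaseProbability

/-! ### Polynomial hitting times via the Dirichlet form -/

section HittingTimes

variable {V : Type*} [Fintype V] (G : SimpleGraph V) [DecidableRel G.Adj]

open Classical in
/-- The probability that the walk from `v` avoids `x` in the rounds `0, …, k`. -/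
noncomputable def avoidProb (x : V) : ℕ → V → ℝ
  | 0 => fun v => if v = x then 0 else 1
  | k + 1 => fun v => if v = x then 0 else walkOp G (avoidProb x k) v

variable {G}

theorem avoidProb_self (x : V) (k : ℕ) : avoidProb G x k x = 0 := by
  cases k <;> simp [avoidProb]

theorem avoidProb_zero_of_ne {x v : V} (hv : v ≠ x) : avoidProb G x 0 v = 1 := by
  simp [avoidProb, hv]

theorem avoidProb_succ_of_ne {x v : V} (hv : v ≠ x) (k : ℕ) :
    avoidProb G x (k + 1) v = walkOp G (avoidProb G x k) v := by
  simp [avoidProb, hv]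

theorem avoidProb_nonneg (x : V) (k : ℕ) : 0 ≤ avoidProb G x k := by
  induction k with
  | zero => intro v; simp only [avoidProb, Pi.zero_apply]; split_ifs <;> norm_num
  | succ k ih =>
    intro v
    simp only [avoidProb, Pi.zero_apply]
    split_ifs
    · exact le_rfl
    · exact walkOp_nonneg ih v

theorem avoidProb_le_one (x : V) (v : V) : avoidProb G x 0 v ≤ 1 := by
  simp only [avoidProb]; split_ifs <;> norm_num

theorem avoidProb_antitone (hG : ∀ v, 0 < G.degree v) (x : V) : Antitone (avoidProb G x) := by
  refine antitone_nat_of_succ_le fun k => ?_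
  induction k with
  | zero =>
    intro v
    have h : walkOp G (avoidProb G x 0) v ≤ 1 := by
      have h1 := walkOp_mono (G := G) (f := avoidProb G x 0) (g := fun _ => 1)
        (avoidProb_le_one x) v
      rwa [walkOp_const hG] at h1
    by_cases hv : v = x
    · subst hv; simp only [avoidProb_self, le_refl]
    · rwa [avoidProb_succ_of_ne hv, avoidProb_zero_of_ne hv]
  | succ k ih =>
    intro v
    by_cases hv : v = x
    · subst hv; simp only [avoidProb_self, le_refl]
    · rw [avoidProb_succ_of_ne hv, avoidProb_succ_of_ne hv]
      exact walkOp_mono ih v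

theorem walkOp_sum (f : ℕ → V → ℝ) (s : Finset ℕ) (v : V) :
    walkOp G (fun w => ∑ k ∈ s, f k w) v = ∑ k ∈ s, walkOp G (f k) v := by
  simp only [walkOp, Finset.mul_sum]
  exact Finset.sum_comm

/-- The Dirichlet form of a nonnegative function with `h - K h ≤ 1` off its zero `x`. -/
theorem sum_sq_sub_le (hG : ∀ v, 0 < G.degree v) {x : V} {h : V → ℝ} (hh : 0 ≤ h) (hx : h x = 0)
    (hle : ∀ v, v ≠ x → h v - walkOp G h v ≤ 1) :
    ∑ u, ∑ v, (if G.Adj u v then (h u - h v) ^ 2 else 0) ≤ 2 * ∑ v, G.degree v * h v := by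
  have hsq : ∑ u, ∑ v, (if G.Adj u v then h u ^ 2 else 0) = ∑ u, G.degree u * h u ^ 2 := by
    refine Finset.sum_congr rfl fun u _ => ?_
    rw [degree_eq_sum, Finset.sum_mul]
    exact Finset.sum_congr rfl fun v _ => by split_ifs <;> simp
  have hsq' : ∑ u, ∑ v, (if G.Adj u v then h v ^ 2 else 0) = ∑ u, G.degree u * h u ^ 2 := by
    rw [Finset.sum_comm, ← hsq]
    simp only [G.adj_comm]
  have hcr : ∑ u, ∑ v, (if G.Adj u v then h u * h v else 0) =
      ∑ u, G.degree u * (h u * walkOp G h u) := by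
    refine Finset.sum_congr rfl fun u _ => ?_
    have h0 : (G.degree u : ℝ) ≠ 0 := by exact_mod_cast (hG u).ne'
    rw [walkOp_eq, mul_left_comm, mul_div_cancel₀ _ h0, Finset.mul_sum]
    exact Finset.sum_congr rfl fun v _ => by split_ifs <;> simp
  -- Summation by parts for the reversible walk.
  have hexp : ∑ u, ∑ v, (if G.Adj u v then (h u - h v) ^ 2 else 0) =
      2 * ∑ u, G.degree u * (h u * (h u - walkOp G h u)) := by
    have h1 : ∀ u v, (if G.Adj u v then (h u - h v) ^ 2 else 0) =
        (if G.Adj u v then h u ^ 2 else 0) + (if G.Adj u v then h v ^ 2 else 0) -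
          2 * (if G.Adj u v then h u * h v else 0) := by
      intro u v; split_ifs <;> ring
    simp only [h1, Finset.sum_sub_distrib, Finset.sum_add_distrib, ← Finset.mul_sum]
    rw [hsq, hsq', hcr]
    simp only [mul_sub, Finset.sum_sub_distrib, ← sq]
    ring
  rw [hexp]
  refine mul_le_mul_of_nonneg_left (Finset.sum_le_sum fun v _ => ?_) zero_le_two
  refine mul_le_mul_of_nonneg_left ?_ (Nat.cast_nonneg _)
  by_cases hv : v = x
  · subst hv; simp [hx]
  · exact mul_le_of_le_one_right (hh v) (hle v hv)

theorem abs_sub_le_sqrt_of_adj (h : V → ℝ) {u v : V} (huv : G.Adj u v) :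
    |h u - h v| ≤ √(∑ u, ∑ v, (if G.Adj u v then (h u - h v) ^ 2 else 0)) := by
  apply Real.le_sqrt_of_sq_le
  rw [sq_abs]
  have hnn : ∀ u v, 0 ≤ (if G.Adj u v then (h u - h v) ^ 2 else 0) := by
    intro u v; split_ifs <;> positivity
  calc (h u - h v) ^ 2 = if G.Adj u v then (h u - h v) ^ 2 else 0 := by rw [if_pos huv]
    _ ≤ ∑ v, (if G.Adj u v then (h u - h v) ^ 2 else 0) :=
        Finset.single_le_sum (f := fun v => if G.Adj u v then (h u - h v) ^ 2 else 0)
          (fun v _ => hnn u v) (Finset.mem_univ v)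
    _ ≤ _ := Finset.single_le_sum
          (f := fun u => ∑ v, if G.Adj u v then (h u - h v) ^ 2 else 0)
          (fun u _ => Finset.sum_nonneg fun v _ => hnn u v) (Finset.mem_univ u)

/-- Expected hitting times are at most `4 |E| |V|²`. -/
theorem sum_avoidProb_le (hG : ∀ v, 0 < G.degree v) (hconn : G.Connected) (x : V) (n : ℕ) (v : V) :
    ∑ k ∈ Finset.range n, avoidProb G x k v ≤
      2 * (2 * (G.edgeFinset.card : ℝ)) * (Fintype.card V : ℝ) ^ 2 := by
  classical
  set h : V → ℝ := fun v => ∑ k ∈ Finset.range n, avoidProb G x k v with hdef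
  have hh : 0 ≤ h := fun v => Finset.sum_nonneg fun k _ => avoidProb_nonneg x k v
  have hx : h x = 0 := Finset.sum_eq_zero fun k _ => avoidProb_self x k
  -- For the truncated hitting time the difference telescopes to the avoidance probability at time
  -- `0` minus that at time `n`.
  have hle : ∀ v, v ≠ x → h v - walkOp G h v ≤ 1 := by
    intro v hv
    rw [hdef, walkOp_sum]
    have h1 : ∀ k, walkOp G (avoidProb G x k) v = avoidProb G x (k + 1) v := by
      intro k; rw [avoidProb_succ_of_ne hv]
    simp only [h1, ← Finset.sum_sub_distrib]
    rw [Finset.sum_range_sub' (fun k => avoidProb G x k v)]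
    have := avoidProb_nonneg (G := G) x n v
    have := avoidProb_le_one (G := G) x v
    simp only [Pi.zero_apply] at *
    linarith
  have hD := sum_sq_sub_le hG hh hx hle
  set 𝓔 := ∑ u, ∑ v, (if G.Adj u v then (h u - h v) ^ 2 else 0)
  have h𝓔 : 0 ≤ 𝓔 := Finset.sum_nonneg fun u _ => Finset.sum_nonneg fun v _ => by
    split_ifs <;> positivity
  have hwalk : ∀ {u v : V} (p : G.Walk u v), h v ≤ h u + p.length * √𝓔 := by
    intro u v p
    induction p with
    | nil => simp
    | @cons u w v huw p ih =>
      have := abs_sub_le_sqrt_of_adj h huw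
      rw [abs_sub_comm] at this
      have := le_of_abs_le this
      rw [SimpleGraph.Walk.length_cons]
      push_cast
      linarith
  have hpt : ∀ v, h v ≤ Fintype.card V * √𝓔 := by
    intro v
    obtain ⟨p, hp⟩ := hconn.exists_isPath x v
    have h1 := hwalk p
    rw [hx, zero_add] at h1
    refine h1.trans (mul_le_mul_of_nonneg_right ?_ (Real.sqrt_nonneg _))
    exact_mod_cast hp.length_lt.le
  have hdeg : ∑ v, (G.degree v : ℝ) = 2 * (G.edgeFinset.card : ℝ) := by
    exact_mod_cast G.sum_degrees_eq_twice_card_edges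
  have h2 : √𝓔 ≤ 2 * (2 * (G.edgeFinset.card : ℝ)) * Fintype.card V := by
    -- The Dirichlet energy bounds `h` along a simple path from `x`, and `h` bounds the energy in
    -- turn; the resulting inequality `𝓔 ≤ c * √𝓔` is solved for `√𝓔`.
    have h3 : 𝓔 ≤ 2 * (2 * (G.edgeFinset.card : ℝ)) * Fintype.card V * √𝓔 := by
      refine hD.trans ?_
      rw [← hdeg, mul_assoc, mul_assoc, Finset.sum_mul]
      refine mul_le_mul_of_nonneg_left (Finset.sum_le_sum fun v _ => ?_) zero_le_two
      exact mul_le_mul_of_nonneg_left (hpt v) (Nat.cast_nonneg _)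
    rcases (Real.sqrt_nonneg 𝓔).eq_or_lt with h0 | h0
    · rw [← h0]
      exact mul_nonneg (mul_nonneg zero_le_two (mul_nonneg zero_le_two (Nat.cast_nonneg _)))
        (Nat.cast_nonneg _)
    · have h4 := Real.mul_self_sqrt h𝓔
      exact le_of_mul_le_mul_right (h4.trans_le h3) h0
  calc h v ≤ Fintype.card V * √𝓔 := hpt v
    _ ≤ Fintype.card V * (2 * (2 * (G.edgeFinset.card : ℝ)) * Fintype.card V) := by gcongr
    _ = _ := by ring

/-- Tail sums of avoidance probabilities. -/
theorem sum_avoidProb_tail_le (hG : ∀ v, 0 < G.degree v) {x : V} {M : ℝ}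
    (hM : ∀ n v, ∑ k ∈ Finset.range n, avoidProb G x k v ≤ M) (R n : ℕ) (v : V) :
    ∑ k ∈ Finset.range n, avoidProb G x (R + k) v ≤ M ^ 2 / (R + 1) := by
  have hM0 : 0 ≤ M := by simpa using hM 0 v
  -- Restarting the walk at time `R` costs the probability of having avoided `x` so far, which by
  -- monotonicity is at most `M / (R + 1)`.
  have h1 : ∀ R v, ∑ k ∈ Finset.range n, avoidProb G x (R + k) v ≤ M * avoidProb G x R v := by
    intro R
    induction R with
    | zero =>
      intro v
      by_cases hv : v = x
      · subst hv; simp [avoidProb_self]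
      · simpa [avoidProb, hv] using hM n v
    | succ R ih =>
      intro v
      by_cases hv : v = x
      · subst hv; simp [avoidProb_self]
      · have h2 : ∀ k, avoidProb G x (R + 1 + k) v = walkOp G (avoidProb G x (R + k)) v := by
          intro k
          rw [show R + 1 + k = R + k + 1 by ring, avoidProb_succ_of_ne hv]
        have h3 := walkOp_mono (G := G) (f := fun w => ∑ k ∈ Finset.range n, avoidProb G x (R + k) w)
          (g := M • avoidProb G x R) ih v
        rw [walkOp_sum (fun k => avoidProb G x (R + k)), walkOp_smul] at h3
        simp only [h2]
        rw [avoidProb_succ_of_ne hv]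
        exact h3
  have h2 : (R + 1) * avoidProb G x R v ≤ M := by
    refine le_trans ?_ (hM (R + 1) v)
    have := Finset.card_nsmul_le_sum (Finset.range (R + 1)) (fun k => avoidProb G x k v)
      (avoidProb G x R v) fun k hk => avoidProb_antitone hG x
        (Nat.lt_succ_iff.1 (Finset.mem_range.1 hk)) v
    simpa using this
  refine (h1 R v).trans ?_
  rw [le_div_iff₀ (by positivity)]
  nlinarith

variable {ι Ω : Type*} [MeasurableSpace Ω] {P : Measure Ω} [IsProbabilityMeasure P]
  {X : ι → ℕ → Ω → V}

/-- First-step decomposition: the event `E` is general so that the first step can be absorbed into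
the past. -/
theorem IsStationaryWalkSystem.real_avoid (hX : IsStationaryWalkSystem G P X) {g : ι} (x : V)
    (k : ℕ) {t : ℕ} {E : Set Ω} (hE : IsPrefixEvent (X g) t E) (u : V) :
    P.real (E ∩ {ω | X g t ω = u} ∩ {ω | ∀ i ≤ k, X g (t + i) ω ≠ x}) =
      P.real (E ∩ {ω | X g t ω = u}) * avoidProb G x k u := by
  induction k generalizing t E u with
  | zero =>
    by_cases hu : u = x
    · subst hu
      have : E ∩ {ω | X g t ω = u} ∩ {ω | ∀ i ≤ 0, X g (t + i) ω ≠ u} = ∅ := by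
        ext ω
        simp only [Set.mem_inter_iff, Set.mem_ofPred_eq, Set.mem_empty_iff_false, iff_false]
        rintro ⟨⟨_, h1⟩, h2⟩
        exact h2 0 le_rfl h1
      rw [this]; simp [avoidProb]
    · have : E ∩ {ω | X g t ω = u} ∩ {ω | ∀ i ≤ 0, X g (t + i) ω ≠ x} =
          E ∩ {ω | X g t ω = u} := by
        ext ω
        simp only [Set.mem_inter_iff, Set.mem_ofPred_eq, and_iff_left_iff_imp]
        rintro ⟨_, h1⟩ i hi
        obtain rfl : i = 0 := by omega
        rw [add_zero, h1]; exact hu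
      rw [this]; simp [avoidProb, hu]
  | succ k ih =>
    by_cases hu : u = x
    · subst hu
      have : E ∩ {ω | X g t ω = u} ∩ {ω | ∀ i ≤ k + 1, X g (t + i) ω ≠ u} = ∅ := by
        ext ω
        simp only [Set.mem_inter_iff, Set.mem_ofPred_eq, Set.mem_empty_iff_false, iff_false]
        rintro ⟨⟨_, h1⟩, h2⟩
        exact h2 0 (Nat.zero_le _) h1
      rw [this, avoidProb_self]; simp
    · have hE' : IsPrefixEvent (X g) (t + 1) (E ∩ {ω | X g t ω = u}) :=
        (hE.inter (isPrefixEvent_eq (X g) le_rfl u)).mono (Nat.le_succ t)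
      have hset : E ∩ {ω | X g t ω = u} ∩ {ω | ∀ i ≤ k + 1, X g (t + i) ω ≠ x} =
          E ∩ {ω | X g t ω = u} ∩ {ω | ∀ i ≤ k, X g (t + 1 + i) ω ≠ x} := by
        ext ω
        simp only [Set.mem_inter_iff, Set.mem_ofPred_eq, and_congr_right_iff]
        rintro ⟨_, h1⟩
        constructor
        · intro h i hi
          have := h (i + 1) (by omega)
          rwa [show t + (i + 1) = t + 1 + i by ring] at this
        · intro h i hi
          rcases Nat.eq_zero_or_pos i with rfl | hi0
          · rw [add_zero, h1]; exact hu
          · have := h (i - 1) (by omega)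
            rwa [show t + 1 + (i - 1) = t + i by omega] at this
      have hpre : IsPrefixEvent (X g) (t + 1 + k) {ω | ∀ i ≤ k, X g (t + 1 + i) ω ≠ x} := by
        intro ω ω' h hω i hi
        rw [← h (t + 1 + i) (by omega)]
        exact hω i hi
      have hm := hX.measurableSet_of_prefix ((hE'.mono (Nat.le_add_right _ k)).inter hpre)
      rw [hset, ← hX.sum_real_inter_fiber hm (g := g) (t + 1), avoidProb_succ_of_ne hu, walkOp,
        Finset.mul_sum]
      refine Finset.sum_congr rfl fun z _ => ?_
      rw [Set.inter_right_comm, ih hE' z, hX.markov_step hE]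
      ring

theorem IsStationaryWalkSystem.real_avoid_stationary (hX : IsStationaryWalkSystem G P X)
    (hG : ∀ v, 0 < G.degree v) (g : ι) (x : V) (t k : ℕ) :
    P.real {ω | ∀ i ≤ k, X g (t + i) ω ≠ x} =
      ∑ u, stationaryProb G u * avoidProb G x k u := by
  have hpre : IsPrefixEvent (X g) (t + k) {ω | ∀ i ≤ k, X g (t + i) ω ≠ x} := by
    intro ω ω' h hω i hi
    rw [← h (t + i) (by omega)]
    exact hω i hi
  rw [← hX.sum_real_inter_fiber (hX.measurableSet_of_prefix hpre) (g := g) t]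
  refine Finset.sum_congr rfl fun u _ => ?_
  have := hX.real_avoid (g := g) x k (isPrefixEvent_univ (X g) t) u
  rw [Set.univ_inter, hX.real_position hG] at this
  rw [← this, Set.inter_comm]

/-- The tail of the time at which visit-exchange informs all vertices, from a single agent. -/
theorem tsum_measure_visit_tail_le (hX : IsStationaryWalkSystem G P X)
    (hG : ∀ v, 0 < G.degree v) (hE : G.edgeFinset.Nonempty) (g : ι) (s : V) {M : ℝ}
    (hM : ∀ x n v, ∑ k ∈ Finset.range n, avoidProb G x k v ≤ M) (R : ℕ) :
    ∑' k, P {ω | (visitState s (fun g t => X g t ω) (2 * (R + k))).1 ≠ Set.univ} ≤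
      ENNReal.ofReal ((1 + Fintype.card V) * (M ^ 2 / (R + 1))) := by
  classical
  let a : V → ℕ → ℝ := fun x k => ∑ u, stationaryProb G u * avoidProb G x k u
  have ha : ∀ x k, 0 ≤ a x k := fun x k => Finset.sum_nonneg fun u _ =>
    mul_nonneg (stationaryProb_nonneg G u) (avoidProb_nonneg x k u)
  have hP : ∀ x t k, P {ω | ∀ i ≤ k, X g (t + i) ω ≠ x} = ENNReal.ofReal (a x k) := by
    intro x t k
    rw [← ofReal_measureReal, hX.real_avoid_stationary hG]
  -- One agent suffices: it meets the source within rounds `0` to `k` and then every vertex within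
  -- rounds `k` to `2 * k`.
  have hsub : ∀ k, {ω | (visitState s (fun g t => X g t ω) (2 * k)).1 ≠ Set.univ} ⊆
      {ω | ∀ i ≤ k, X g (0 + i) ω ≠ s} ∪
        ⋃ x ∈ (Finset.univ : Finset V), {ω | ∀ i ≤ k, X g (k + i) ω ≠ x} := by
    intro k ω hω
    by_contra hn
    apply hω
    simp only [Finset.mem_univ, Set.iUnion_true, Set.mem_union, Set.mem_ofPred_eq, Set.mem_iUnion,
      not_or, not_exists, not_forall, not_not, exists_prop] at hn
    obtain ⟨⟨i, hi, hs⟩, hx⟩ := hn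
    rw [Set.eq_univ_iff_forall]
    intro x
    obtain ⟨j, hj, rfl⟩ := hx x
    have h0 : s ∈ (visitState s (fun g t => X g t ω) i).1 :=
      (visitState_mono (Nat.zero_le i)).1 rfl
    rw [zero_add] at hs
    have h1 := mem_visitState_of_visit (x := fun g t => X g t ω) (g := g) (t := i) (t' := k + j)
      (by simpa [hs] using h0) (by omega)
    exact (visitState_mono (by omega)).1 h1
  have hk : ∀ k, P {ω | (visitState s (fun g t => X g t ω) (2 * k)).1 ≠ Set.univ} ≤
      ENNReal.ofReal (a s k + ∑ x, a x k) := by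
    intro k
    refine (measure_mono (hsub k)).trans ((measure_union_le _ _).trans ?_)
    rw [ENNReal.ofReal_add (ha s k) (Finset.sum_nonneg fun x _ => ha x k), hP,
      ENNReal.ofReal_sum_of_nonneg fun x _ => ha x k]
    gcongr
    refine (measure_biUnion_finset_le _ _).trans (le_of_eq ?_)
    exact Finset.sum_congr rfl fun x _ => hP x k k
  refine (ENNReal.tsum_le_tsum fun k => hk (R + k)).trans ?_
  refine ENNReal.tsum_le_of_sum_range_le fun n => ?_
  rw [← ENNReal.ofReal_sum_of_nonneg fun k _ =>
    add_nonneg (ha s _) (Finset.sum_nonneg fun x _ => ha x _)]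
  apply ENNReal.ofReal_le_ofReal
  have hx : ∀ x, ∑ k ∈ Finset.range n, a x (R + k) ≤ M ^ 2 / (R + 1) := by
    intro x
    rw [Finset.sum_comm]
    calc _ = ∑ u, stationaryProb G u * ∑ k ∈ Finset.range n, avoidProb G x (R + k) u := by
          simp only [Finset.mul_sum]
      _ ≤ ∑ u, stationaryProb G u * (M ^ 2 / (R + 1)) := by
          refine Finset.sum_le_sum fun u _ => mul_le_mul_of_nonneg_left ?_
            (stationaryProb_nonneg G u)
          exact sum_avoidProb_tail_le hG (hM x) R n u
      _ = _ := by rw [← Finset.sum_mul, sum_stationaryProb G hE, one_mul]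
  rw [Finset.sum_add_distrib, add_mul, one_mul]
  refine add_le_add (hx s) ?_
  · rw [Finset.sum_comm]
    refine (Finset.sum_le_sum fun x _ => hx x).trans (le_of_eq ?_)
    rw [Finset.sum_const, Finset.card_univ, nsmul_eq_mul]

end HittingTimes

/-! ### From tail probabilities to the expected time of visit-exchange -/

section VisitUpperBound

/-- The time is a count of unfinished rounds; if the process never finishes, the sum is infinite as
well. -/
theorem visitTime_le_tsum {V ι : Type*} (s : V) (x : ι → ℕ → V) :
    visitTime s x ≤ ∑' t, {t | (visitState s x t).1 ≠ Set.univ}.indicator (fun _ => 1) t := by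
  classical
  by_cases h : ∃ t, (visitState s x t).1 = Set.univ
  · calc visitTime s x ≤ (Nat.find h : ℝ≥0∞) := 
          iInf₂_le (f := fun (t : ℕ) _ => (t : ℝ≥0∞)) (Nat.find h) (Nat.find_spec h)
      _ = ∑ t ∈ Finset.range (Nat.find h), (1 : ℝ≥0∞) := by simp
      _ = ∑ t ∈ Finset.range (Nat.find h),
            {t | (visitState s x t).1 ≠ Set.univ}.indicator (fun _ => (1 : ℝ≥0∞)) t := by
          refine Finset.sum_congr rfl fun t ht => ?_
          rw [Set.indicator_of_mem]
          exact Nat.find_min h (Finset.mem_range.1 ht)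
      _ ≤ _ := ENNReal.sum_le_tsum _
  · push Not at h
    have : ∀ t, {t | (visitState s x t).1 ≠ Set.univ}.indicator (fun _ => (1 : ℝ≥0∞)) t = 1 :=
      fun t => Set.indicator_of_mem (h t) _
    simp only [this, ENNReal.tsum_const_eq_top_of_ne_zero one_ne_zero, le_top]

theorem lintegral_visitTime_le {V ι Ω : Type*} [MeasurableSpace Ω] (P : Measure Ω) (s : V)
    (X : ι → ℕ → Ω → V) :
    ∫⁻ ω, visitTime s (fun g t => X g t ω) ∂P ≤
      ∑' t, P {ω | (visitState s (fun g t => X g t ω) t).1 ≠ Set.univ} := by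
  set U : ℕ → Set Ω := fun t => {ω | (visitState s (fun g t => X g t ω) t).1 ≠ Set.univ}
  have hm : ∀ t, MeasurableSet (toMeasurable P (U t)) := fun t => measurableSet_toMeasurable _ _
  -- Measurable hulls make integral and sum interchangeable without measurability of the unfinished
  -- events, and have the same measure.
  calc _ ≤ ∫⁻ ω, ∑' t, (toMeasurable P (U t)).indicator (fun _ => 1) ω ∂P := by
        refine lintegral_mono fun ω => (visitTime_le_tsum s _).trans ?_
        refine ENNReal.tsum_le_tsum fun t => ?_
        refine Set.indicator_apply_le' (fun ht => ?_) fun _ => zero_le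
        rw [Set.indicator_of_mem (subset_toMeasurable P _ (show ω ∈ U t from ht))]
    _ = ∑' t, ∫⁻ ω, (toMeasurable P (U t)).indicator (fun _ => 1) ω ∂P :=
        lintegral_tsum fun t => (measurable_const.indicator (hm t)).aemeasurable
    _ = ∑' t, P (U t) := by
        refine tsum_congr fun t => ?_
        rw [lintegral_indicator_const (hm t), one_mul, measure_toMeasurable]

/-- Three regimes: up to `t₁` terms are at most `1`; up to `2 * R` they are at most `f t₁`, later
exponentially small against a polynomial `R`; beyond that, even and odd terms are paired. -/
theorem tsum_le_of_antitone {f : ℕ → ℝ≥0∞} (hf : Antitone f) (h1 : ∀ t, f t ≤ 1) (t₁ R : ℕ) :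
    ∑' t, f t ≤ t₁ + 2 * R * f t₁ + 2 * ∑' k, f (2 * (R + k)) := by
  rw [← ENNReal.summable.sum_add_tsum_nat_add' (k := 2 * R)]
  refine add_le_add ?_ ?_
  · calc ∑ t ∈ Finset.range (2 * R), f t
        ≤ ∑ t ∈ Finset.range (2 * R), ((if t < t₁ then 1 else 0) + f t₁) := by
          refine Finset.sum_le_sum fun t _ => ?_
          split_ifs with h
          · exact (h1 t).trans le_self_add
          · rw [zero_add]; exact hf (not_lt.1 h)
      _ ≤ _ := by
          rw [Finset.sum_add_distrib, Finset.sum_const, Finset.card_range, nsmul_eq_mul]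
          push_cast
          gcongr
          rw [← Finset.sum_filter, Finset.sum_const, nsmul_eq_mul, mul_one]
          refine Nat.cast_le.2 ?_
          calc _ ≤ (Finset.range t₁).card := Finset.card_le_card fun t ht => by
                simpa using (Finset.mem_filter.1 ht).2
            _ = t₁ := Finset.card_range _
  · rw [← tsum_even_add_odd ENNReal.summable ENNReal.summable,
      two_mul (∑' k, f (2 * (R + k)))]
    exact add_le_add (ENNReal.tsum_le_tsum fun k => hf (by omega))
      (ENNReal.tsum_le_tsum fun k => hf (by omega))

variable {m A : ℕ} {Ω : Type*} [MeasurableSpace Ω] {P : Measure Ω} [IsProbabilityMeasure P]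
  {X : Fin A → ℕ → Ω → CycleStarCliqueVertex m}

theorem card_vertices_le (hm : 3 ≤ m) :
    (Fintype.card (CycleStarCliqueVertex m) : ℝ) ≤ 2 * m ^ 3 := by
  rw [card_vertices]
  have h3 : 3 * m ≤ m ^ 2 := by nlinarith
  have h4 : 3 * m ^ 2 ≤ m ^ 3 := by nlinarith [sq_nonneg m]
  exact_mod_cast (by omega : m + m ^ 2 + m ^ 3 ≤ 2 * m ^ 3)

/-- With high probability visit-exchange informs all vertices within `O(m ^ 2)` rounds. -/
theorem measure_visit_slow_le (hX : IsStationaryWalkSystem (cycleStarClique m) P X)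
    (hm : 8 ≤ m) {a : ℝ} (ha : 0 < a) (hA : a * m ^ 3 ≤ A) {C : ℕ} (hC : 8 * (C + 1) ≤ m)
    (s : CycleStarCliqueVertex m) {y : ℝ} (hy : 0 < y) (hy1 : y ≤ 1) :
    P {ω | (visitState s (fun g t => X g t ω) (4 * (m ^ 2 / 4) + C * m * m)).1 ≠ Set.univ} ≤
      ENNReal.ofReal (16 * m ^ 6 * Real.exp (-(a / 32)) ^ m +
        ((y + Real.exp (-(a / 4))) ^ C / y) ^ m) := by
  classical
  set L := m ^ 2 / 4
  set D := C * m * m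
  let T : Finset ℕ := [0, L, 2 * L + D, 3 * L + D].toFinset
  let F : Finset (CycleStarCliqueVertex m × CycleStarCliqueVertex m) :=
    Finset.univ.filter fun p => (cycleStarClique m).Adj p.1 p.2
  let N : ℕ → CycleStarCliqueVertex m × CycleStarCliqueVertex m → Set Ω := fun τ p =>
    {ω | ∀ g, ∀ u ∈ Finset.Ico τ (τ + L), ¬ (X g u ω = p.1 ∧ X g (u + 1) ω = p.2)}
  let U : Set Ω := {ω | .inl (starIndex s) ∈ (visitState s (fun g t => X g t ω) (2 * L)).1 ∧
        ¬ ∀ i, .inl i ∈ (visitState s (fun g t => X g t ω) (2 * L + D)).1}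
  have hL : 0 < L := by
    have : 64 ≤ m ^ 2 := by nlinarith
    omega
  have hsub : {ω | (visitState s (fun g t => X g t ω) (4 * L + D)).1 ≠ Set.univ} ⊆
      (⋃ q ∈ T ×ˢ F, N q.1 q.2) ∪ U := by
    intro ω hω
    by_contra hn
    apply hω
    rw [Set.mem_union, not_or] at hn
    refine visitState_eq_univ hL ?_ ?_
    · intro τ hτ v w hvw
      by_contra hno
      apply hn.1
      refine Set.mem_biUnion (x := (τ, (v, w))) (Finset.mem_coe.2 (Finset.mem_product.2
        ⟨List.mem_toFinset.2 hτ, Finset.mem_filter.2 ⟨Finset.mem_univ _, hvw⟩⟩)) ?_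
      intro g u hu h
      exact hno ⟨g, u, hu, h⟩
    · intro h
      by_contra hno
      exact hn.2 ⟨h, hno⟩
  have hU : P U ≤ ENNReal.ofReal (((y + Real.exp (-(a / 4))) ^ C / y) ^ m) :=
    measure_cycle_not_informed_le hX (by omega) ha hA hC s (starIndex s) (2 * L) hy hy1
  have hN : P (⋃ q ∈ T ×ˢ F, N q.1 q.2) ≤
      ENNReal.ofReal (16 * m ^ 6 * Real.exp (-(a / 32)) ^ m) := by
    refine (measure_biUnion_finset_le _ _).trans ?_
    have hT : T.card ≤ 4 := List.toFinset_card_le _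
    have hF : F.card ≤ Fintype.card (CycleStarCliqueVertex m) ^ 2 := by
      refine (Finset.card_filter_le _ _).trans (le_of_eq ?_)
      rw [Finset.card_univ, Fintype.card_prod, sq]
    set B := Real.exp (-(a / 32)) ^ m with hB
    have hq : ∀ q ∈ T ×ˢ F, P (N q.1 q.2) ≤ ENNReal.ofReal B := by
      intro q hq
      have h1 := measure_no_edge_crossing_le hX hm ha hA
        (Finset.mem_filter.1 (Finset.mem_product.1 hq).2).2 q.1
      rwa [← neg_mul, mul_comm _ (m : ℝ), Real.exp_nat_mul] at h1
    have hB0 : 0 ≤ B := pow_nonneg (Real.exp_nonneg _) m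
    clear_value B N T F
    refine (Finset.sum_le_card_nsmul _ _ _ hq).trans ?_
    rw [nsmul_eq_mul, ← ENNReal.ofReal_natCast, ← ENNReal.ofReal_mul (Nat.cast_nonneg _)]
    refine ENNReal.ofReal_le_ofReal (mul_le_mul_of_nonneg_right ?_ hB0)
    have hV := card_vertices_le (m := m) (by omega)
    rw [Finset.card_product]
    push_cast
    calc (T.card : ℝ) * F.card ≤ 4 * (Fintype.card (CycleStarCliqueVertex m) : ℝ) ^ 2 :=
          mul_le_mul (by exact_mod_cast hT) (by exact_mod_cast hF) (Nat.cast_nonneg _)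
            (by norm_num)
      _ ≤ 4 * (2 * (m : ℝ) ^ 3) ^ 2 := by gcongr
      _ = 16 * (m : ℝ) ^ 6 := by ring
  refine (measure_mono hsub).trans ((measure_union_le _ _).trans ?_)
  rw [ENNReal.ofReal_add (by positivity) (by positivity)]
  exact add_le_add hN hU

/-- Hitting times sum to at most `M = 16 * m ^ 10`, and `(1 + |V|) * M ^ 2 ≤ 768 * m ^ 23`, so `R =
m ^ 24` and `768 ≤ m` suffice. -/
theorem tsum_visit_tail_le_one (hX : IsStationaryWalkSystem (cycleStarClique m) P X)
    (hm : 768 ≤ m) (hA : 0 < A) (s : CycleStarCliqueVertex m) :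
    ∑' k, P {ω | (visitState s (fun g t => X g t ω) (2 * (m ^ 24 + k))).1 ≠ Set.univ} ≤ 1 := by
  have hm3 : 3 ≤ m := by omega
  have hm' : (768 : ℝ) ≤ m := by exact_mod_cast hm
  have hm0 : (0 : ℝ) < m := by linarith
  have hE0 : (cycleStarClique m).edgeFinset.Nonempty := by
    rw [← Finset.card_pos]
    have h1 := le_two_mul_card_edges hm3
    have h2 : (0 : ℝ) < m ^ 4 := by positivity
    have h3 : (0 : ℝ) < (cycleStarClique m).edgeFinset.card := by linarith
    exact_mod_cast h3
  have hV := card_vertices_le hm3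
  have hM : ∀ x n v, ∑ k ∈ Finset.range n, avoidProb (cycleStarClique m) x k v ≤ 16 * m ^ 10 := by
    intro x n v
    refine (sum_avoidProb_le (degree_pos hm3) (cycleStarClique_connected hm3) x n v).trans ?_
    calc _ ≤ 2 * (2 * (m : ℝ) ^ 4) * (2 * (m : ℝ) ^ 3) ^ 2 := by
          refine mul_le_mul (mul_le_mul_of_nonneg_left (two_mul_card_edges_le hm3) zero_le_two)
            (pow_le_pow_left₀ (Nat.cast_nonneg _) hV 2) (by positivity) (by positivity)
      _ = 16 * (m : ℝ) ^ 10 := by ring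
  refine (tsum_measure_visit_tail_le hX (degree_pos hm3) hE0 ⟨0, hA⟩ s hM (m ^ 24)).trans ?_
  rw [← ENNReal.ofReal_one]
  apply ENNReal.ofReal_le_ofReal
  rw [mul_div_assoc', div_le_one (by positivity)]
  push_cast
  have h3 : (1 : ℝ) ≤ m ^ 3 := one_le_pow₀ (by linarith)
  calc (1 + (Fintype.card (CycleStarCliqueVertex m) : ℝ)) * (16 * (m : ℝ) ^ 10) ^ 2
      ≤ (m ^ 3 + 2 * m ^ 3) * (16 * (m : ℝ) ^ 10) ^ 2 := by gcongr
    _ = 768 * (m : ℝ) ^ 23 := by ring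
    _ ≤ m * (m : ℝ) ^ 23 := by gcongr
    _ = (m : ℝ) ^ 24 := by ring
    _ ≤ (m : ℝ) ^ 24 + 1 := by linarith

end VisitUpperBound

/-- The upper bound for visit-exchange. -/
theorem exists_visitTime_upper_bound {a : ℝ} (ha : 0 < a) :
    ∃ C : ℝ, 0 < C ∧ ∃ M : ℕ, ∀ n m A : ℕ, M ≤ m → m ^ 3 ≤ n → 0 < A → a * n ≤ A →
      ∀ (Ω : Type*) [MeasurableSpace Ω] (P : Measure Ω) [IsProbabilityMeasure P]
        (X : Fin A → ℕ → Ω → CycleStarCliqueVertex m),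
        IsStationaryWalkSystem (cycleStarClique m) P X → ∀ s : CycleStarCliqueVertex m,
          ∫⁻ ω, visitTime s (fun g t => X g t ω) ∂P ≤
            ENNReal.ofReal (C * (n : ℝ) ^ (2 / 3 : ℝ)) := by
  set q := Real.exp (-(a / 4))
  have hq0 : 0 < q := Real.exp_pos _
  have hq1 : q < 1 := Real.exp_lt_one_iff.2 (by linarith)
  -- This makes `y + q < 1`, so a suitable `C` brings `(y + q) ^ C / y` down to `1 / 2` and the
  -- failure probability of the travel to `2 ^ (-m)`.
  set y := (1 - q) / 2
  have hy : 0 < y := by simp only [y]; linarith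
  have hy1 : y ≤ 1 := by simp only [y]; linarith
  obtain ⟨C, hC⟩ := exists_pow_lt_of_lt_one (y := y + q) (x := y / 2) (by positivity)
    (by simp only [y]; linarith)
  have hz : (y + q) ^ C / y ≤ 1 / 2 := by rw [div_le_iff₀ hy]; linarith
  have hz0 : 0 ≤ (y + q) ^ C / y := by positivity
  have hr : |Real.exp (-(a / 32))| < 1 := by
    rw [abs_of_pos (Real.exp_pos _)]
    exact Real.exp_lt_one_iff.2 (by linarith)
  -- The exponent `30` combines the horizon `m ^ 24` with the factor `m ^ 6` from pairs of vertices.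
  have ht1 := (tendsto_pow_const_mul_const_pow_of_abs_lt_one 30 hr).const_mul 16
  have ht2 := tendsto_pow_const_mul_const_pow_of_abs_lt_one 24
    (show |(1 / 2 : ℝ)| < 1 by rw [abs_of_pos] <;> norm_num)
  have ht := ht1.add ht2
  rw [mul_zero, add_zero] at ht
  obtain ⟨M₀, hM₀⟩ := Filter.eventually_atTop.1 (ht.eventually (ge_mem_nhds zero_lt_one))
  refine ⟨C + 5, by positivity, max M₀ (max 768 (8 * (C + 1))), ?_⟩
  intro n m A hM hn hA0 hA Ω _ P _ X hX s
  have h1 : M₀ ≤ m := (le_max_left _ _).trans hM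
  have h2 : 768 ≤ m := (le_max_left _ _).trans ((le_max_right _ _).trans hM)
  have h3 : 8 * (C + 1) ≤ m := (le_max_right _ _).trans ((le_max_right _ _).trans hM)
  have hm' : (768 : ℝ) ≤ m := by exact_mod_cast h2
  have hnR : (m : ℝ) ^ 3 ≤ n := by exact_mod_cast hn
  have hA' : a * (m : ℝ) ^ 3 ≤ A := le_trans (by gcongr) hA
  have hslow := measure_visit_slow_le hX (by omega) ha hA' h3 s hy hy1
  have htail := tsum_visit_tail_le_one hX h2 hA0 s
  set t₁ := 4 * (m ^ 2 / 4) + C * m * m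
  have hslow' : (m ^ 24 : ℕ) * P {ω | (visitState s (fun g t => X g t ω) t₁).1 ≠ Set.univ} ≤ 1 := by
    refine (mul_le_mul_right hslow _).trans ?_
    rw [← ENNReal.ofReal_natCast, ← ENNReal.ofReal_mul (Nat.cast_nonneg _), ← ENNReal.ofReal_one]
    apply ENNReal.ofReal_le_ofReal
    refine le_trans ?_ (hM₀ m h1)
    push_cast
    have : ((y + q) ^ C / y) ^ m ≤ (1 / 2) ^ m := by gcongr
    calc (m : ℝ) ^ 24 * (16 * m ^ 6 * Real.exp (-(a / 32)) ^ m + ((y + q) ^ C / y) ^ m)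
        ≤ (m : ℝ) ^ 24 * (16 * m ^ 6 * Real.exp (-(a / 32)) ^ m + (1 / 2) ^ m) := by gcongr
      _ = _ := by ring
  refine (lintegral_visitTime_le P s X).trans ?_
  have hanti : Antitone fun t => P {ω | (visitState s (fun g t => X g t ω) t).1 ≠ Set.univ} := by
    intro t t' htt
    refine measure_mono ?_
    intro ω hω h
    exact hω (Set.eq_univ_of_univ_subset (h ▸ (visitState_mono htt).1))
  refine (tsum_le_of_antitone hanti (fun t => prob_le_one) t₁ (m ^ 24)).trans ?_
  · have hpow : (m : ℝ) ^ 2 ≤ (n : ℝ) ^ (2 / 3 : ℝ) := by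
      calc (m : ℝ) ^ 2 = ((m : ℝ) ^ 3) ^ (2 / 3 : ℝ) := by
            rw [← Real.rpow_natCast, ← Real.rpow_natCast, ← Real.rpow_mul (by positivity)]
            norm_num
        _ ≤ _ := Real.rpow_le_rpow (by positivity) hnR (by norm_num)
    -- The four windows take at most `m ^ 2` rounds, and the two smaller regimes contribute `2`
    -- each.
    have ht₁ : t₁ + 4 ≤ (C + 5) * m ^ 2 := by
      have e1 : 4 * (m ^ 2 / 4) ≤ m ^ 2 := Nat.mul_div_le _ _
      have e2 : 1 ≤ m ^ 2 := Nat.one_le_pow _ _ (by omega)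
      have e3 : (C + 5) * m ^ 2 = C * m * m + 5 * m ^ 2 := by ring
      simp only [t₁]
      omega
    calc _ ≤ (t₁ : ℝ≥0∞) + 2 * 1 + 2 * 1 := by
          rw [mul_assoc 2]
          gcongr
      _ = ((t₁ + 4 : ℕ) : ℝ≥0∞) := by push_cast; ring
      _ ≤ (((C + 5) * m ^ 2 : ℕ) : ℝ≥0∞) := by exact_mod_cast ht₁
      _ = ENNReal.ofReal ((C + 5) * (m : ℝ) ^ 2) := by
          rw [← ENNReal.ofReal_natCast]; push_cast; rfl
      _ ≤ _ := ENNReal.ofReal_le_ofReal (by gcongr)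

end RumorSpreading

-- The condition `m ^ 3 ≤ n < (m + 1) ^ 3` expresses `m = ⌊n ^ (1 / 3)⌋`, and `3 ≤ m` then amounts
-- to `27 ≤ n`.
open RumorSpreading in
theorem mainTheorem10 :
    (∀ n m : ℕ, 3 ≤ m → m ^ 3 ≤ n → n < (m + 1) ^ 3 →
      (cycleStarClique m).Connected ∧
      (∀ v, m ≤ (cycleStarClique m).degree v ∧ (cycleStarClique m).degree v ≤ m + 2) ∧
      n ≤ 2 * Fintype.card (CycleStarCliqueVertex m) ∧
      Fintype.card (CycleStarCliqueVertex m) ≤ 2 * n) ∧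
    ∀ a b : ℝ, 0 < a → a ≤ b →
      ∃ C c : ℝ, 0 < C ∧ 0 < c ∧ ∃ N : ℕ, ∀ n m A : ℕ, N ≤ n → m ^ 3 ≤ n → n < (m + 1) ^ 3 →
        a * n ≤ A → (A : ℝ) ≤ b * n →
        ∀ (Ω : Type*) [MeasurableSpace Ω] (P : Measure Ω) [IsProbabilityMeasure P]
          (X : Fin A → ℕ → Ω → CycleStarCliqueVertex m),
          IsStationaryWalkSystem (cycleStarClique m) P X →
          ∀ s : CycleStarCliqueVertex m,
            ∫⁻ ω, visitTime s (fun g t => X g t ω) ∂P ≤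
              ENNReal.ofReal (C * (n : ℝ) ^ (2 / 3 : ℝ)) ∧
            ENNReal.ofReal (c * ((n : ℝ) ^ (2 / 3 : ℝ) * Real.log n)) ≤
              ∫⁻ ω, meetTime s (fun g t => X g t ω) ∂P := by
  refine ⟨fun n m hm h1 h2 => graph_properties hm h1 h2, fun a b ha hab => ?_⟩
  obtain ⟨C, hC, M₁, h₁⟩ := exists_visitTime_upper_bound ha
  obtain ⟨c, hc, M₂, h₂⟩ := exists_meetTime_lower_bound (ha.trans_le hab)
  -- Since `n < (m + 1) ^ 3`, this threshold for `n` forces `m` above both thresholds for `m`.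
  refine ⟨C, c, hC, hc, (max M₁ M₂ + 1) ^ 3, fun n m A hN h1 h2 hA hA' Ω _ P _ X hX s => ?_⟩
  have hm : max M₁ M₂ ≤ m := by
    by_contra hlt
    have := Nat.pow_le_pow_left (show m + 1 ≤ max M₁ M₂ + 1 by omega) 3
    omega
  have hn : 0 < n := lt_of_lt_of_le (by positivity) hN
  have hA0 : 0 < A := by
    have h0 : (0 : ℝ) < n := by exact_mod_cast hn
    have h3 : (0 : ℝ) < A := lt_of_lt_of_le (by positivity) hA
    exact_mod_cast h3
  exact ⟨h₁ n m A ((le_max_left _ _).trans hm) h1 hA0 hA Ω P X hX s,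
    h₂ n m A ((le_max_right _ _).trans hm) h2 hn hA0 hA' Ω P X hX s⟩
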